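/- Let $\mathcal{V}$ be a cosmos, i.e. a bicomplete symmetric monoidal closed category, let $\mathcal{A}$ be a small monoidal $\mathcal{V}$-category with monoidal product $m\colon\mathcal{A}\otimes\mathcal{A}\to\mathcal{A}$ and unit object $i$, and let $\mathcal{K}$ be a $\mathcal{V}$-category with copowers $V\odot K$ ($V\in\mathcal{V}$, $K\in\mathcal{K}$). Suppose that for all $\mathcal{V}$-functors $F\colon\mathcal{A}\to\mathcal{V}$ and $X\colon\mathcal{A}\to\mathcal{K}$ and all $x\in\mathcal{A}$ the coend $$(F*X)(x)=\int^{a,b\in\mathcal{A}}\big(\mathcal{A}(m(a,b),x)\otimes F(a)\big)\odot X(b)$$ exists in $\mathcal{K}$. Equip the $\mathcal{V}$-category $[\mathcal{A},\mathcal{V}]$ with the Day convolution monoidal structure (the same formula with $\mathcal{K}=\mathcal{V}$ and $\odot=\otimes$; the unit is $I=\mathcal{A}(i,-)$). Then: (i) The assignment $(F,X)\mapsto F*X$ extends, $\mathcal{V}$-naturally with respect to the universal cowedges, to a $\mathcal{V}$-functor $[\mathcal{A},\mathcal{V}]\otimes[\mathcal{A},\mathcal{K}]\to[\mathcal{A},\mathcal{K}]$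 which, together with the canonical $\mathcal{V}$-natural isomorphisms $F*(G*X)\cong(F*G)*X$ and $I*X\cong X$, makes $[\mathcal{A},\mathcal{K}]$ a left $[\mathcal{A},\mathcal{V}]$-actegory; that is, these isomorphisms satisfy the coherence conditions of an action (the associativity pentagon and the two unit axioms). For every $X\colon\mathcal{A}\to\mathcal{K}$, the $\mathcal{V}$-functor $-*X\colon[\mathcal{A},\mathcal{V}]\to[\mathcal{A},\mathcal{K}]$ has a right adjoint $\mathcal{V}$-functor $\langle X,-\rangle$, where $$\langle X,Y\rangle=\int_{b\in\mathcal{A}}\mathcal{K}\big(X(b),Y(m(-,b))\big).$$ (ii) The underlying category $[\mathcal{A},\mathcal{K}]_0$ of $[\mathcal{A},\mathcal{K}]$ is the underlying category of a copowered $[\mathcal{A},\mathcal{V}]$-category, with hom-objects $\langle X,Y\rangle$ and with the copower of $X$ by $F$ given by $F*X$. -/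

import Mathlib

open CategoryTheory MonoidalCategory Limits Opposite

universe w v u u₁ u₂ u₃ u₄ u₅ u₆

attribute [instance] MonoidalClosed.enrichedCategorySelf

noncomputable section

namespace VCat

/-- Objects of the tensor product `C ⊗ D` of two `V`-categories. -/
structure TensorObj (C : Type u₁) (D : Type u₂) where
  fst : C
  snd : D

variable {V : Type v} [Category.{w} V] [MonoidalCategory V]

lemma comp_tensorHom {X Y Z X' Y' : V} (a : X ⟶ Y) (b : Y ⟶ Z) (c : X' ⟶ Y') :
    ((a ≫ b) ⊗ₘ c) = a ▷ X' ≫ (b ⊗ₘ c) := by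
  rw [MonoidalCategory.tensorHom_def, comp_whiskerRight, Category.assoc,
    ← MonoidalCategory.tensorHom_def]

lemma tensorHom_comp {X Y Z X' Y' : V} (c : X' ⟶ Y') (a : X ⟶ Y) (b : Y ⟶ Z) :
    (c ⊗ₘ (a ≫ b)) = X' ◁ a ≫ (c ⊗ₘ b) := by
  rw [MonoidalCategory.tensorHom_def', MonoidalCategory.whiskerLeft_comp, Category.assoc,
    ← MonoidalCategory.tensorHom_def']

lemma assoc_map_id_aux {X Y Z : V} (f : 𝟙_ V ⟶ X) (g : 𝟙_ V ⟶ Y) (h : 𝟙_ V ⟶ Z) :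
    ((λ_ (𝟙_ V)).inv ≫ (((λ_ (𝟙_ V)).inv ≫ (f ⊗ₘ g)) ⊗ₘ h)) ≫ (α_ X Y Z).hom =
      (λ_ (𝟙_ V)).inv ≫ (f ⊗ₘ ((λ_ (𝟙_ V)).inv ≫ (g ⊗ₘ h))) := by
  rw [comp_tensorHom, tensorHom_comp, Category.assoc, Category.assoc, associator_naturality]
  monoidal

section comp
variable {C : Type u₁} [EnrichedCategory V C] {D : Type u₂} [EnrichedCategory V D]

/-- Composition of generalized elements of hom-objects. -/
def gcomp {U U' : V} {X Y Z : C} (f : U ⟶ (X ⟶[V] Y)) (g : U' ⟶ (Y ⟶[V] Z)) :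
    U ⊗ U' ⟶ (X ⟶[V] Z) :=
  (f ⊗ₘ g) ≫ eComp V X Y Z

lemma tensor_gcomp {U U' W W' : V} {X Y Z : C} (a : W ⟶ U) (b : W' ⟶ U')
    (f : U ⟶ (X ⟶[V] Y)) (g : U' ⟶ (Y ⟶[V] Z)) :
    (a ⊗ₘ b) ≫ gcomp f g = gcomp (a ≫ f) (b ≫ g) := by
  simp [gcomp]

lemma whisker_gcomp {U U' W : V} {X Y Z : C} (f : U ⟶ (X ⟶[V] Y)) (a : W ⟶ U')
    (g : U' ⟶ (Y ⟶[V] Z)) : U ◁ a ≫ gcomp f g = gcomp f (a ≫ g) := by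
  rw [← id_tensorHom, tensor_gcomp, Category.id_comp]

lemma gcomp_whisker {U U' W : V} {X Y Z : C} (a : W ⟶ U) (f : U ⟶ (X ⟶[V] Y))
    (g : U' ⟶ (Y ⟶[V] Z)) : a ▷ U' ≫ gcomp f g = gcomp (a ≫ f) g := by
  rw [← tensorHom_id, tensor_gcomp, Category.id_comp]

lemma gcomp_assoc {U₁ U₂ U₃ : V} {W X Y Z : C} (f : U₁ ⟶ (W ⟶[V] X)) (g : U₂ ⟶ (X ⟶[V] Y))
    (h : U₃ ⟶ (Y ⟶[V] Z)) :
    gcomp (gcomp f g) h = (α_ _ _ _).hom ≫ gcomp f (gcomp g h) := by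
  have h1 : gcomp (gcomp f g) h = ((f ⊗ₘ g) ⊗ₘ h) ≫ eComp V W X Y ▷ _ ≫ eComp V W Y Z := by
    rw [gcomp, gcomp, ← Category.assoc, tensorHom_comp_whiskerRight]
  have h2 : gcomp f (gcomp g h) = (f ⊗ₘ (g ⊗ₘ h)) ≫ _ ◁ eComp V X Y Z ≫ eComp V W X Z := by
    rw [gcomp, gcomp, ← Category.assoc, tensorHom_comp_whiskerLeft]
  rw [h1, h2, ← e_assoc', associator_naturality_assoc]

lemma gcomp_map (F : EnrichedFunctor V C D) {U U' : V} {X Y Z : C} (f : U ⟶ (X ⟶[V] Y))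
    (g : U' ⟶ (Y ⟶[V] Z)) :
    gcomp f g ≫ F.map X Z = gcomp (f ≫ F.map X Y) (g ≫ F.map Y Z) := by
  simp [gcomp]

lemma eId_gcomp {U : V} {X Y : C} (f : U ⟶ (X ⟶[V] Y)) :
    gcomp (eId V X) f = (λ_ U).hom ≫ f := by
  have := e_id_comp V X Y
  rw [Iso.inv_comp_eq, Category.comp_id] at this
  rw [gcomp, MonoidalCategory.tensorHom_def', Category.assoc, this, leftUnitor_naturality]

lemma gcomp_eId {U : V} {X Y : C} (f : U ⟶ (X ⟶[V] Y)) :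
    gcomp f (eId V Y) = (ρ_ U).hom ≫ f := by
  have := e_comp_id V X Y
  rw [Iso.inv_comp_eq, Category.comp_id] at this
  rw [gcomp, MonoidalCategory.tensorHom_def, Category.assoc, this, rightUnitor_naturality]

lemma eComp_eq_gcomp (X Y Z : C) : eComp V X Y Z = gcomp (𝟙 _) (𝟙 _) := by
  simp [gcomp]

end comp

section tensor
variable [BraidedCategory V]
variable {C : Type u₁} [EnrichedCategory V C] {D : Type u₂} [EnrichedCategory V D]
  {E : Type u₃} [EnrichedCategory V E] {C' : Type u₄} [EnrichedCategory V C']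
  {D' : Type u₅} [EnrichedCategory V D']

/-- The tensor product of two `V`-categories. -/
instance tensorCategory : EnrichedCategory V (TensorObj C D) where
  Hom p q := (p.fst ⟶[V] q.fst) ⊗ (p.snd ⟶[V] q.snd)
  id p := (λ_ (𝟙_ V)).inv ≫ (eId V p.fst ⊗ₘ eId V p.snd)
  comp p q r := tensorμ _ _ _ _ ≫ (eComp V p.fst q.fst r.fst ⊗ₘ eComp V p.snd q.snd r.snd)
  id_comp p q := by
    rw [comp_whiskerRight, Category.assoc, tensorμ_natural_left_assoc, tensorHom_comp_tensorHom,
      ← cancel_epi (λ_ _).hom, Iso.hom_inv_id_assoc, tensor_left_unitality, Category.assoc,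
      Category.assoc]
    congr 2
    rw [Category.comp_id]
    congr 1
    · have := e_id_comp V p.fst q.fst
      rwa [Iso.inv_comp_eq, Category.comp_id] at this
    · have := e_id_comp V p.snd q.snd
      rwa [Iso.inv_comp_eq, Category.comp_id] at this
  comp_id p q := by
    rw [MonoidalCategory.whiskerLeft_comp, Category.assoc, tensorμ_natural_right_assoc,
      tensorHom_comp_tensorHom,
      ← cancel_epi (ρ_ _).hom, Iso.hom_inv_id_assoc, tensor_right_unitality, Category.assoc,
      Category.assoc]
    congr 2
    rw [Category.comp_id]
    congr 1
    · have := e_comp_id V p.fst q.fst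
      rwa [Iso.inv_comp_eq, Category.comp_id] at this
    · have := e_comp_id V p.snd q.snd
      rwa [Iso.inv_comp_eq, Category.comp_id] at this
  assoc p q r s := by
    rw [Iso.inv_comp_eq, comp_whiskerRight, Category.assoc, tensorμ_natural_left_assoc,
      MonoidalCategory.whiskerLeft_comp, Category.assoc, tensorμ_natural_right_assoc,
      tensorHom_comp_tensorHom, tensorHom_comp_tensorHom, ← e_assoc', ← e_assoc',
      ← tensorHom_comp_tensorHom]
    have := tensor_associativity (p.fst ⟶[V] q.fst) (p.snd ⟶[V] q.snd) (q.fst ⟶[V] r.fst)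
      (q.snd ⟶[V] r.snd) (r.fst ⟶[V] s.fst) (r.snd ⟶[V] s.snd)
    simp only [← Category.assoc] at this ⊢
    rw [this]

lemma tensor_eId (p : TensorObj C D) :
    eId V p = (λ_ (𝟙_ V)).inv ≫ (eId V p.fst ⊗ₘ eId V p.snd) := rfl

lemma tensor_eComp (p q r : TensorObj C D) :
    eComp V p q r =
      tensorμ _ _ _ _ ≫ (eComp V p.fst q.fst r.fst ⊗ₘ eComp V p.snd q.snd r.snd) := rfl

lemma tensor_gcomp_tensor {U₁ U₂ U₃ U₄ : V} {p q r : TensorObj C D}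
    (f : U₁ ⟶ (p.fst ⟶[V] q.fst)) (f' : U₂ ⟶ (p.snd ⟶[V] q.snd))
    (g : U₃ ⟶ (q.fst ⟶[V] r.fst)) (g' : U₄ ⟶ (q.snd ⟶[V] r.snd)) :
    gcomp (C := TensorObj C D) (X := p) (Y := q) (Z := r) (f ⊗ₘ f') (g ⊗ₘ g') =
      tensorμ _ _ _ _ ≫ (gcomp f g ⊗ₘ gcomp f' g') := by
  have := tensorμ_natural_assoc f f' g g'
    (eComp V p.fst q.fst r.fst ⊗ₘ eComp V p.snd q.snd r.snd)
  rw [tensorHom_comp_tensorHom] at this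
  exact this

/-- The tensor product of two `V`-functors. -/
def prodFunctor (F : EnrichedFunctor V C C') (G : EnrichedFunctor V D D') :
    EnrichedFunctor V (TensorObj C D) (TensorObj C' D') where
  obj p := ⟨F.obj p.fst, G.obj p.snd⟩
  map p q := F.map p.fst q.fst ⊗ₘ G.map p.snd q.snd
  map_id p := by
    rw [tensor_eId, tensor_eId, Category.assoc, tensorHom_comp_tensorHom, F.map_id, G.map_id]
  map_comp p q r := by
    rw [tensor_eComp, tensor_eComp, Category.assoc, tensorHom_comp_tensorHom, F.map_comp,
      G.map_comp, ← tensorHom_comp_tensorHom, tensorμ_natural_assoc]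

lemma tensorμ_unit_aux (X Y : V) :
    ((λ_ X).inv ⊗ₘ (ρ_ Y).inv) ≫ tensorμ (𝟙_ V) X Y (𝟙_ V) ≫ ((λ_ Y).hom ⊗ₘ (ρ_ X).hom) =
      (β_ X Y).hom := by
  have h : ((λ_ Y).hom ⊗ₘ (ρ_ X).hom) =
    (α_ (𝟙_ V) Y (X ⊗ 𝟙_ V)).hom ≫ 𝟙_ V ◁ (α_ Y X (𝟙_ V)).inv ≫ (λ_ _).hom ≫ (ρ_ _).hom := by
    monoidal
  rw [h, tensorμ]
  simp only [Category.assoc, Iso.inv_hom_id_assoc]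
  rw [← MonoidalCategory.whiskerLeft_comp_assoc (𝟙_ V) (α_ Y X (𝟙_ V)).hom, Iso.hom_inv_id,
    MonoidalCategory.whiskerLeft_id, Category.id_comp, leftUnitor_naturality_assoc,
    rightUnitor_naturality]
  have h' : ((λ_ X).inv ⊗ₘ (ρ_ Y).inv) ≫ (α_ (𝟙_ V) X (Y ⊗ 𝟙_ V)).hom ≫
      𝟙_ V ◁ (α_ X Y (𝟙_ V)).inv ≫ (λ_ _).hom ≫ (ρ_ _).hom = 𝟙 _ := by monoidal
  have h'' := congrArg (fun t => t ≫ (β_ X Y).hom) h'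
  simpa only [Category.assoc, Category.id_comp] using h''

lemma tensorμ_unit_aux' (X Y : V) :
    ((ρ_ Y).inv ⊗ₘ (λ_ X).inv) ≫ tensorμ Y (𝟙_ V) (𝟙_ V) X ≫ ((ρ_ Y).hom ⊗ₘ (λ_ X).hom) =
      𝟙 _ := by
  rw [tensorμ, braiding_tensorUnit_right]
  monoidal

/-- The `V`-functor `d ↦ (c, d)`. -/
def insertLeft (D : Type u₂) [EnrichedCategory V D] (c : C) :
    EnrichedFunctor V D (TensorObj C D) where
  obj d := ⟨c, d⟩
  map d d' := (λ_ _).inv ≫ (eId V c ⊗ₘ 𝟙 (d ⟶[V] d'))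
  map_id d := by
    rw [tensor_eId, leftUnitor_inv_naturality_assoc]
    simp [MonoidalCategory.tensorHom_def']
  map_comp d d' d'' := by
    rw [← tensorHom_comp_tensorHom, Category.assoc]
    have := tensor_gcomp_tensor (p := (⟨c, d⟩ : TensorObj C D)) (q := ⟨c, d'⟩) (r := ⟨c, d''⟩)
      (eId V c) (𝟙 (d ⟶[V] d')) (eId V c) (𝟙 (d' ⟶[V] d''))
    rw [gcomp] at this
    rw [this, eId_gcomp, ← eComp_eq_gcomp, MonoidalCategory.tensorHom_def (_ ≫ _),
      comp_whiskerRight, Category.assoc, ← MonoidalCategory.tensorHom_def,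
      leftUnitor_inv_naturality_assoc]
    have h := leftUnitor_monoidal (d ⟶[V] d') (d' ⟶[V] d'')
    rw [← Category.assoc, ← Iso.comp_inv_eq, ← cancel_epi ((λ_ _).inv ⊗ₘ (λ_ _).inv),
      tensorHom_comp_tensorHom_assoc, Iso.inv_hom_id, Iso.inv_hom_id, id_tensorHom_id,
      Category.id_comp] at h
    simp only [h, Category.assoc]
    simp [MonoidalCategory.tensorHom_def']

/-- The `V`-functor `c ↦ (c, d)`. -/
def insertRight (C : Type u₁) [EnrichedCategory V C] (d : D) :
    EnrichedFunctor V C (TensorObj C D) where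
  obj c := ⟨c, d⟩
  map c c' := (ρ_ _).inv ≫ (𝟙 (c ⟶[V] c') ⊗ₘ eId V d)
  map_id c := by
    rw [tensor_eId, rightUnitor_inv_naturality_assoc, unitors_inv_equal]
    simp [MonoidalCategory.tensorHom_def]
  map_comp c c' c'' := by
    rw [← tensorHom_comp_tensorHom, Category.assoc]
    have := tensor_gcomp_tensor (p := (⟨c, d⟩ : TensorObj C D)) (q := ⟨c', d⟩) (r := ⟨c'', d⟩)
      (𝟙 (c ⟶[V] c')) (eId V d) (𝟙 (c' ⟶[V] c'')) (eId V d)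
    rw [gcomp] at this
    rw [this, eId_gcomp, ← eComp_eq_gcomp, MonoidalCategory.tensorHom_def' _ (_ ≫ _),
      MonoidalCategory.whiskerLeft_comp, Category.assoc, ← MonoidalCategory.tensorHom_def',
      rightUnitor_inv_naturality_assoc]
    have h := rightUnitor_monoidal (c ⟶[V] c') (c' ⟶[V] c'')
    rw [← Category.assoc, ← Iso.comp_inv_eq, ← cancel_epi ((ρ_ _).inv ⊗ₘ (ρ_ _).inv),
      tensorHom_comp_tensorHom_assoc, Iso.inv_hom_id, Iso.inv_hom_id, id_tensorHom_id,
      Category.id_comp] at h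
    simp only [h, Category.assoc]
    simp [MonoidalCategory.tensorHom_def]

lemma assoc_map_comp_aux {X₁ X₂ X₃ Y₁ Y₂ Y₃ Z₁ Z₂ Z₃ : V} (f : X₁ ⊗ Y₁ ⟶ Z₁) (g : X₂ ⊗ Y₂ ⟶ Z₂)
    (h : X₃ ⊗ Y₃ ⟶ Z₃) :
    (tensorμ (X₁ ⊗ X₂) X₃ (Y₁ ⊗ Y₂) Y₃ ≫ ((tensorμ X₁ X₂ Y₁ Y₂ ≫ (f ⊗ₘ g)) ⊗ₘ h)) ≫
        (α_ Z₁ Z₂ Z₃).hom =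
      ((α_ X₁ X₂ X₃).hom ⊗ₘ (α_ Y₁ Y₂ Y₃).hom) ≫ tensorμ X₁ (X₂ ⊗ X₃) Y₁ (Y₂ ⊗ Y₃) ≫
        (f ⊗ₘ (tensorμ X₂ X₃ Y₂ Y₃ ≫ (g ⊗ₘ h))) := by
  rw [comp_tensorHom, tensorHom_comp, Category.assoc, Category.assoc, associator_naturality,
    associator_monoidal_assoc]

lemma insert_gcomp (c c' : C) (d d' : D) :
    gcomp ((insertLeft (V := V) D c).map d d') ((insertRight (V := V) C d').map c c') =
      (β_ _ _).hom ≫ gcomp ((insertRight (V := V) C d).map c c') ((insertLeft (V := V) D c').map d d') := by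
  have h1 : gcomp ((insertLeft (V := V) D c).map d d') ((insertRight (V := V) C d').map c c') =
      ((λ_ _).inv ⊗ₘ (ρ_ _).inv) ≫ tensorμ (𝟙_ V) (d ⟶[V] d') (c ⟶[V] c') (𝟙_ V) ≫
        (gcomp (eId V c) (𝟙 (c ⟶[V] c')) ⊗ₘ gcomp (𝟙 (d ⟶[V] d')) (eId V d')) :=
    (tensor_gcomp _ _ _ _).symm.trans (congrArg (fun t => _ ≫ t)
      (tensor_gcomp_tensor (p := (⟨c, d⟩ : TensorObj C D)) (q := ⟨c, d'⟩) (r := ⟨c', d'⟩)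
        _ _ _ _))
  have h2 : gcomp ((insertRight (V := V) C d).map c c') ((insertLeft (V := V) D c').map d d') =
      ((ρ_ _).inv ⊗ₘ (λ_ _).inv) ≫ tensorμ (c ⟶[V] c') (𝟙_ V) (𝟙_ V) (d ⟶[V] d') ≫
        (gcomp (𝟙 (c ⟶[V] c')) (eId V c') ⊗ₘ gcomp (eId V d) (𝟙 (d ⟶[V] d'))) :=
    (tensor_gcomp _ _ _ _).symm.trans (congrArg (fun t => _ ≫ t)
      (tensor_gcomp_tensor (p := (⟨c, d⟩ : TensorObj C D)) (q := ⟨c', d⟩) (r := ⟨c', d'⟩)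
        _ _ _ _))
  rw [h1, h2, eId_gcomp, eId_gcomp, gcomp_eId, gcomp_eId, Category.comp_id, Category.comp_id,
    Category.comp_id, Category.comp_id, tensorμ_unit_aux, tensorμ_unit_aux']
  exact (Category.comp_id _).symm

/-- The canonical `V`-functor `(C ⊗ D) ⊗ E ⟶ C ⊗ (D ⊗ E)`. -/
def assocFunctor (C : Type u₁) [EnrichedCategory V C] (D : Type u₂) [EnrichedCategory V D]
    (E : Type u₃) [EnrichedCategory V E] :
    EnrichedFunctor V (TensorObj (TensorObj C D) E) (TensorObj C (TensorObj D E)) where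
  obj p := ⟨p.fst.fst, ⟨p.fst.snd, p.snd⟩⟩
  map _ _ := (α_ _ _ _).hom
  map_id _ := assoc_map_id_aux _ _ _
  map_comp _ _ _ := assoc_map_comp_aux _ _ _

/-- The canonical `V`-functor `C ⊗ (D ⊗ E) ⟶ (C ⊗ D) ⊗ E`. -/
def assocInvFunctor (C : Type u₁) [EnrichedCategory V C] (D : Type u₂) [EnrichedCategory V D]
    (E : Type u₃) [EnrichedCategory V E] :
    EnrichedFunctor V (TensorObj C (TensorObj D E)) (TensorObj (TensorObj C D) E) where
  obj p := ⟨⟨p.fst, p.snd.fst⟩, p.snd.snd⟩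
  map _ _ := (α_ _ _ _).inv
  map_id _ := (Iso.comp_inv_eq _).mpr (assoc_map_id_aux (V := V) _ _ _).symm
  map_comp _ _ _ := by
    refine (Iso.comp_inv_eq _).mpr ?_
    refine Eq.trans ?_ (Category.assoc _ _ _).symm
    refine Eq.trans ?_ (congrArg (fun t => _ ≫ t) (assoc_map_comp_aux (V := V) _ _ _).symm)
    rw [tensorHom_comp_tensorHom_assoc, Iso.inv_hom_id, Iso.inv_hom_id, id_tensorHom_id,
      Category.id_comp]
    rfl

/-- The opposite of a `V`-functor. -/
def opFunctor (F : EnrichedFunctor V C D) : EnrichedFunctor V Cᵒᵖ Dᵒᵖ where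
  obj c := op (F.obj c.unop)
  map c c' := F.map c'.unop c.unop
  map_id c := F.map_id c.unop
  map_comp c c' c'' := by
    rw [eComp_op_eq, Category.assoc, F.map_comp, tensorHom_eComp_op_eq]
    rfl

end tensor

section functorCategory
variable [BraidedCategory V]
variable {C : Type w} [EnrichedCategory V C] {D : Type u₂} [EnrichedCategory V D]
  {E : Type u₃} [EnrichedCategory V E]

/-- `V`-naturality of a family of generalized elements `U ⟶ D(F c, G c)`. For `U = 𝟙_ V` this is
the usual condition for a `V`-natural transformation; for general `U` it is the condition that the
family is a wedge for the end of `D(F c, G c)`. -/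
def IsNatural {C : Type u₁} [EnrichedCategory V C] {D : Type u₂} [EnrichedCategory V D]
    (F G : EnrichedFunctor V C D) {U : V} (app : ∀ c, U ⟶ (F.obj c ⟶[V] G.obj c)) : Prop :=
  ∀ c c' : C, gcomp (F.map c c') (app c') = (β_ _ _).hom ≫ gcomp (app c) (G.map c c')

lemma isNatural_id (F : EnrichedFunctor V C D) : IsNatural F F fun c => eId V (F.obj c) := by
  intro c c'
  rw [gcomp_eId, eId_gcomp, braiding_leftUnitor_assoc]

lemma isNatural_comp {F G H : EnrichedFunctor V C D} {U U' : V}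
    {s : ∀ c, U ⟶ (F.obj c ⟶[V] G.obj c)} {t : ∀ c, U' ⟶ (G.obj c ⟶[V] H.obj c)}
    (hs : IsNatural F G s) (ht : IsNatural G H t) :
    IsNatural F H fun c => gcomp (s c) (t c) := by
  intro c c'
  have h1 : gcomp (F.map c c') (gcomp (s c') (t c')) =
      (α_ _ _ _).inv ≫ gcomp (gcomp (F.map c c') (s c')) (t c') := by
    rw [gcomp_assoc, Iso.inv_hom_id_assoc]
  rw [h1, hs, ← gcomp_whisker, gcomp_assoc, ht, ← whisker_gcomp, gcomp_assoc,
    BraidedCategory.braiding_tensor_right_hom]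
  simp only [Category.assoc, Iso.inv_hom_id_assoc]

variable [MonoidalClosed V] [HasLimits V]

/-- The object of `V`-natural transformations, i.e. the end of `D(F c, G c)`. -/
def natObj (F G : EnrichedFunctor V C D) : V :=
  equalizer
    (Pi.lift fun p : C × C => MonoidalClosed.curry
      (gcomp (F.map p.1 p.2) (Pi.π (fun c => (F.obj c ⟶[V] G.obj c)) p.2)))
    (Pi.lift fun p : C × C => MonoidalClosed.curry
      ((β_ _ _).hom ≫ gcomp (Pi.π (fun c => (F.obj c ⟶[V] G.obj c)) p.1) (G.map p.1 p.2)))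

/-- The projection from the end. -/
def natπ (F G : EnrichedFunctor V C D) (c : C) : natObj F G ⟶ (F.obj c ⟶[V] G.obj c) :=
  equalizer.ι _ _ ≫ Pi.π _ c

lemma natπ_natural (F G : EnrichedFunctor V C D) : IsNatural F G (natπ F G) := by
  intro c c'
  have h := equalizer.condition
    (Pi.lift fun p : C × C => MonoidalClosed.curry
      (gcomp (F.map p.1 p.2) (Pi.π (fun c => (F.obj c ⟶[V] G.obj c)) p.2)))
    (Pi.lift fun p : C × C => MonoidalClosed.curry
      ((β_ _ _).hom ≫ gcomp (Pi.π (fun c => (F.obj c ⟶[V] G.obj c)) p.1) (G.map p.1 p.2)))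
  have h := congrArg (fun t => t ≫ Pi.π _ (c, c')) h
  simp only [Category.assoc, Pi.lift_π] at h
  rw [← MonoidalClosed.curry_natural_left, ← MonoidalClosed.curry_natural_left] at h
  have h := MonoidalClosed.curry_injective h
  rw [whisker_gcomp, BraidedCategory.braiding_naturality_right_assoc, gcomp_whisker] at h
  exact h

/-- The universal property of the end. -/
def natLift (F G : EnrichedFunctor V C D) {U : V} (app : ∀ c, U ⟶ (F.obj c ⟶[V] G.obj c))
    (h : IsNatural F G app) : U ⟶ natObj F G :=
  equalizer.lift (Pi.lift app) (by
    refine Pi.hom_ext _ _ fun p => ?_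
    simp only [Category.assoc, Pi.lift_π]
    rw [← MonoidalClosed.curry_natural_left, ← MonoidalClosed.curry_natural_left, whisker_gcomp,
      BraidedCategory.braiding_naturality_right_assoc, gcomp_whisker, Pi.lift_π, Pi.lift_π,
      h p.1 p.2])

@[simp]
lemma natLift_π (F G : EnrichedFunctor V C D) {U : V} (app : ∀ c, U ⟶ (F.obj c ⟶[V] G.obj c))
    (h : IsNatural F G app) (c : C) : natLift F G app h ≫ natπ F G c = app c :=
  (Category.assoc _ _ _).symm.trans <| (congrArg (fun t => t ≫ _) (equalizer.lift_ι _ _)).trans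
    (Pi.lift_π _ _)

lemma natObj_hom_ext {F G : EnrichedFunctor V C D} {U : V} {f g : U ⟶ natObj F G}
    (h : ∀ c, f ≫ natπ F G c = g ≫ natπ F G c) : f = g := by
  refine equalizer.hom_ext (Pi.hom_ext _ _ fun c => ?_)
  exact (Category.assoc _ _ _).trans ((h c).trans (Category.assoc _ _ _).symm)

/-- The `V`-category `[C, D]` of `V`-functors `C ⟶ D`, for `C` small. -/
instance functorCategory : EnrichedCategory V (EnrichedFunctor V C D) where
  Hom F G := natObj F G
  id F := natLift F F (fun c => eId V (F.obj c)) (isNatural_id F)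
  comp F G H := natLift F H (fun c => gcomp (natπ F G c) (natπ G H c))
    (isNatural_comp (natπ_natural F G) (natπ_natural G H))
  id_comp F G := natObj_hom_ext fun c => by
    rw [Category.assoc, Category.assoc, natLift_π, gcomp_whisker, natLift_π, eId_gcomp,
      Iso.inv_hom_id_assoc, Category.id_comp]
  comp_id F G := natObj_hom_ext fun c => by
    rw [Category.assoc, Category.assoc, natLift_π, whisker_gcomp, natLift_π, gcomp_eId,
      Iso.inv_hom_id_assoc, Category.id_comp]
  assoc F G H K := natObj_hom_ext fun c => by
    rw [Category.assoc, Category.assoc, natLift_π, gcomp_whisker, natLift_π, gcomp_assoc,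
      Iso.inv_hom_id_assoc, Category.assoc, natLift_π, whisker_gcomp, natLift_π]

lemma functorCategory_eId_π (F : EnrichedFunctor V C D) (c : C) :
    eId V F ≫ natπ F F c = eId V (F.obj c) :=
  natLift_π F F _ (isNatural_id F) c

lemma functorCategory_eComp_π (F G H : EnrichedFunctor V C D) (c : C) :
    eComp V F G H ≫ natπ F H c = gcomp (natπ F G c) (natπ G H c) :=
  natLift_π F H _ (isNatural_comp (natπ_natural F G) (natπ_natural G H)) c

/-- Evaluation at `c`, as a `V`-functor `[C, D] ⟶ D`. -/
def evalFunctor (D : Type u₂) [EnrichedCategory V D] (c : C) :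
    EnrichedFunctor V (EnrichedFunctor V C D) D where
  obj F := F.obj c
  map F G := natπ F G c
  map_id F := functorCategory_eId_π F c
  map_comp F G H := functorCategory_eComp_π F G H c

/-- The partial `V`-functor `B(e, -)`. -/
def fixLeft {C : Type u₁} [EnrichedCategory V C] (B : EnrichedFunctor V (TensorObj E C) D)
    (e : E) : EnrichedFunctor V C D := (insertLeft C e).comp V B

/-- The partial `V`-functor `B(-, c)`. -/
def fixRight {C : Type u₁} [EnrichedCategory V C] (B : EnrichedFunctor V (TensorObj E C) D)
    (c : C) : EnrichedFunctor V E D := (insertRight E c).comp V B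

/-- The action on hom-objects of `B(-, c)`, as a family indexed by `c`. -/
def curryApp (B : EnrichedFunctor V (TensorObj E C) D) (e e' : E) (c : C) :
    (e ⟶[V] e') ⟶ ((fixLeft B e).obj c ⟶[V] (fixLeft B e').obj c) :=
  (fixRight B c).map e e'

lemma curryApp_natural (B : EnrichedFunctor V (TensorObj E C) D) (e e' : E) :
    IsNatural (fixLeft B e) (fixLeft B e') (curryApp B e e') := by
  intro c c'
  refine (gcomp_map B _ _).symm.trans ?_
  refine Eq.trans ?_ (congrArg (fun t => _ ≫ t) (gcomp_map B _ _))
  exact (congrArg (fun t => t ≫ B.map ⟨e, c⟩ ⟨e', c'⟩) (insert_gcomp e e' c c')).trans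
    (Category.assoc _ _ _)

/-- The `V`-functor `E ⟶ [C, D]`, `e ↦ B(e, -)`. -/
def curryFunctor (B : EnrichedFunctor V (TensorObj E C) D) :
    EnrichedFunctor V E (EnrichedFunctor V C D) where
  obj e := fixLeft B e
  map e e' := natLift _ _ (curryApp B e e') (curryApp_natural B e e')
  map_id e := natObj_hom_ext fun c => by
    rw [Category.assoc, natLift_π, functorCategory_eId_π]
    exact (fixRight B c).map_id e
  map_comp e e' e'' := natObj_hom_ext fun c => by
    rw [Category.assoc, natLift_π, Category.assoc, functorCategory_eComp_π, tensor_gcomp,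
      natLift_π, natLift_π]
    exact (fixRight B c).map_comp e e' e''

end functorCategory

section copower

/-- `η : v ⟶ C(k, c)` exhibits `c` as the copower `v ⊙ k`: composition with `η` gives, naturally in
`G`, a bijection between morphisms `G ⟶ C(c, l)` and morphisms `v ⊗ G ⟶ C(k, l)`. When `V` is
closed this says that `η` induces isomorphisms `C(c, l) ≅ [v, C(k, l)]`. -/
def IsCopower {C : Type u₁} [EnrichedCategory V C] (v : V) (k c : C) (η : v ⟶ (k ⟶[V] c)) : Prop :=
  ∀ (l : C) (G : V), Function.Bijective fun g : G ⟶ (c ⟶[V] l) => gcomp η g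

variable (V) in
/-- A choice of copowers in a `V`-category. -/
structure Copowers (K : Type u₁) [EnrichedCategory V K] where
  /-- the copower `v ⊙ k` -/
  obj : V → K → K
  /-- the unit `v ⟶ K(k, v ⊙ k)` -/
  unit (v : V) (k : K) : v ⟶ (k ⟶[V] obj v k)
  isCopower (v : V) (k : K) : IsCopower v k (obj v k) (unit v k)

variable {K : Type u₁} [EnrichedCategory V K]

namespace Copowers
variable (P : Copowers V K)

/-- The morphism `G ⟶ K(v ⊙ k, l)` corresponding to `v ⊗ G ⟶ K(k, l)`. -/
def desc {v : V} {k l : K} {G : V} (h : v ⊗ G ⟶ (k ⟶[V] l)) : G ⟶ (P.obj v k ⟶[V] l) :=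
  ((P.isCopower v k l G).2 h).choose

lemma unit_desc {v : V} {k l : K} {G : V} (h : v ⊗ G ⟶ (k ⟶[V] l)) :
    gcomp (P.unit v k) (P.desc h) = h :=
  ((P.isCopower v k l G).2 h).choose_spec

lemma hom_ext {v : V} {k l : K} {G : V} {f g : G ⟶ (P.obj v k ⟶[V] l)}
    (h : gcomp (P.unit v k) f = gcomp (P.unit v k) g) : f = g :=
  (P.isCopower v k l G).1 h

end Copowers

end copower

lemma whisker_aux {X U U' A B Y Z : V} (f : U ⟶ A) (g : U' ⟶ B) (e : X ⊗ A ⟶ Y)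
    (e' : Y ⊗ B ⟶ Z) :
    X ◁ (f ▷ U' ≫ A ◁ g) ≫ (α_ X A B).inv ≫ e ▷ B ≫ e' =
      (α_ X U U').inv ≫ (X ◁ f) ▷ U' ≫ (X ⊗ A) ◁ g ≫ e ▷ B ≫ e' := by
  simp

section self
variable [MonoidalClosed V]

lemma uncurry_gcomp {U U' X Y Z : V} (f : U ⟶ EnrichedCategory.Hom X Y)
    (g : U' ⟶ EnrichedCategory.Hom Y Z) :
    MonoidalClosed.uncurry (gcomp f g) =
      (α_ X U U').inv ≫ MonoidalClosed.uncurry f ▷ U' ≫ MonoidalClosed.uncurry g := by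
  have h : MonoidalClosed.uncurry (gcomp f g) =
      X ◁ (f ⊗ₘ g) ≫ MonoidalClosed.compTranspose X Y Z := by
    refine (MonoidalClosed.uncurry_natural_left (f ⊗ₘ g) (MonoidalClosed.comp X Y Z)).trans ?_
    rw [MonoidalClosed.comp_eq, MonoidalClosed.uncurry_curry]
  rw [h, MonoidalClosed.compTranspose_eq, MonoidalClosed.uncurry_eq, MonoidalClosed.uncurry_eq]
  rw [comp_whiskerRight, Category.assoc, ← whisker_exchange_assoc,
    MonoidalCategory.tensorHom_def]
  exact whisker_aux f g ((ihom.ev X).app Y) ((ihom.ev Y).app Z)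

/-- Evaluation `v ⊗ [v, v'] ⟶ v'`. -/
def evalHom (v v' : V) : v ⊗ EnrichedCategory.Hom v v' ⟶ v' := (ihom.ev v).app v'

lemma uncurry_eq_evalHom {U v v' : V} (f : U ⟶ EnrichedCategory.Hom v v') :
    MonoidalClosed.uncurry f = v ◁ f ≫ evalHom v v' := MonoidalClosed.uncurry_eq f

variable [BraidedCategory V]

variable (V) in
/-- In `V` itself, copowers are given by the monoidal product. -/
def selfCopowers : Copowers V V where
  obj v k := v ⊗ k
  unit v k := MonoidalClosed.curry (β_ k v).hom
  isCopower v k l G := by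
    have h (g : G ⟶ EnrichedCategory.Hom (v ⊗ k) l) :
      gcomp (V := V) (X := k) (MonoidalClosed.curry (β_ k v).hom) g =
      MonoidalClosed.curry
        ((α_ k v G).inv ≫ (β_ k v).hom ▷ G ≫ MonoidalClosed.uncurry g) := by
      apply MonoidalClosed.uncurry_injective
      rw [uncurry_gcomp, MonoidalClosed.uncurry_curry, MonoidalClosed.uncurry_curry]
    constructor
    · intro f g hfg
      simp only [h] at hfg
      have := MonoidalClosed.curry_injective hfg
      rw [cancel_epi, cancel_epi] at this
      exact MonoidalClosed.uncurry_injective this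
    · intro f
      refine ⟨MonoidalClosed.curry ((β_ k v).inv ▷ G ≫ (α_ k v G).hom ≫
        MonoidalClosed.uncurry f), ?_⟩
      refine (h _).trans ?_
      rw [MonoidalClosed.uncurry_curry, hom_inv_whiskerRight_assoc, Iso.inv_hom_id_assoc,
        MonoidalClosed.curry_uncurry]

end self

section copowerFunctor
variable [SymmetricCategory V] [MonoidalClosed V]
variable {K : Type u₁} [EnrichedCategory V K] (P : Copowers V K)

namespace Copowers

/-- The transpose of the action on hom-objects of the copower `V`-functor. -/
def mapAux (v v' : V) (k k' : K) :
    v ⊗ (EnrichedCategory.Hom v v' ⊗ (k ⟶[V] k')) ⟶ (k ⟶[V] P.obj v' k') :=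
  (α_ _ _ _).inv ≫ evalHom v v' ▷ _ ≫ (β_ _ _).hom ≫ gcomp (𝟙 _) (P.unit v' k')

lemma mapAux_comp {U U' : V} {v v' : V} {k k' : K} (f : U ⟶ EnrichedCategory.Hom v v')
    (g : U' ⟶ (k ⟶[V] k')) :
    v ◁ (f ⊗ₘ g) ≫ P.mapAux v v' k k' =
      (α_ _ _ _).inv ≫ MonoidalClosed.uncurry f ▷ _ ≫ (β_ _ _).hom ≫ gcomp g (P.unit v' k') := by
  have h : gcomp g (P.unit v' k') = g ▷ _ ≫ gcomp (𝟙 _) (P.unit v' k') := by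
    rw [gcomp_whisker, Category.comp_id]
  rw [h, ← BraidedCategory.braiding_naturality_right_assoc, uncurry_eq_evalHom, mapAux,
    MonoidalCategory.tensorHom_def]
  refine (whisker_aux f g (evalHom v v') _).trans ?_
  rw [comp_whiskerRight, Category.assoc, whisker_exchange_assoc]

lemma map_comp_aux {X A B A' B' Y Z : V} (e₁ : X ⊗ A ⟶ Y) (e₂ : Y ⊗ A' ⟶ Z) :
    X ◁ tensorμ A B A' B' ≫ (α_ _ _ _).inv ≫ ((α_ _ _ _).inv ≫ e₁ ▷ A' ≫ e₂) ▷ (B ⊗ B') ≫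
        (β_ Z (B ⊗ B')).hom =
      (α_ _ _ _).inv ≫ ((α_ _ _ _).inv ≫ e₁ ▷ B ≫ (β_ Y B).hom) ▷ (A' ⊗ B') ≫ (α_ _ _ _).hom ≫
        B ◁ ((α_ _ _ _).inv ≫ e₂ ▷ B' ≫ (β_ Z B').hom) ≫ (α_ _ _ _).inv := by
  dsimp only [tensorμ]
  rw [BraidedCategory.braiding_tensor_right_hom]
  calc
    _ = 𝟙 _ ⊗≫ ((X ⊗ A) ◁ (β_ B A').hom ≫ e₁ ▷ (A' ⊗ B)) ▷ B' ⊗≫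
          (e₂ ▷ B ≫ (β_ Z B).hom) ▷ B' ⊗≫ B ◁ (β_ Z B').hom ⊗≫ 𝟙 _ := by monoidal
    _ = 𝟙 _ ⊗≫ e₁ ▷ (B ⊗ A') ▷ B' ⊗≫ Y ◁ ((β_ B A').hom ≫ (β_ A' B).hom) ▷ B' ⊗≫
          (β_ Y B).hom ▷ A' ▷ B' ⊗≫ B ◁ e₂ ▷ B' ⊗≫ B ◁ (β_ Z B').hom ⊗≫ 𝟙 _ := by
        rw [whisker_exchange, BraidedCategory.braiding_naturality_left,
          BraidedCategory.braiding_tensor_left_hom]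
        monoidal
    _ = _ := by
        rw [SymmetricCategory.symmetry]
        monoidal

/-- The copower as a `V`-functor `V ⊗ K ⟶ K`. -/
def functor : EnrichedFunctor V (TensorObj V K) K where
  obj p := P.obj p.fst p.snd
  map p q := P.desc (P.mapAux p.fst q.fst p.snd q.snd)
  map_id p := P.hom_ext (by
    rw [← whisker_gcomp, P.unit_desc, tensor_eId, MonoidalCategory.whiskerLeft_comp,
      Category.assoc, P.mapAux_comp, gcomp_eId, eId_gcomp]
    have h : MonoidalClosed.uncurry (eId V p.fst) = (ρ_ p.fst).hom :=
      MonoidalClosed.uncurry_curry _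
    rw [h, braiding_tensorUnit_right]
    simp only [Category.assoc, Iso.inv_hom_id_assoc]
    simp only [← Category.assoc]
    congr 1
    monoidal)
  map_comp p q r := P.hom_ext (by
    have h : MonoidalClosed.uncurry (eComp V p.fst q.fst r.fst) = (α_ _ _ _).inv ≫
        evalHom p.fst q.fst ▷ _ ≫ evalHom q.fst r.fst :=
      MonoidalClosed.uncurry_curry _
    have h1 : gcomp (P.unit p.fst p.snd) ((P.desc (P.mapAux p.fst q.fst p.snd q.snd) ⊗ₘ
        P.desc (P.mapAux q.fst r.fst q.snd r.snd)) ≫ eComp V _ _ _) =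
        (α_ _ _ _).inv ≫ gcomp (P.mapAux p.fst q.fst p.snd q.snd)
          (P.desc (P.mapAux q.fst r.fst q.snd r.snd)) := by
      rw [← P.unit_desc (P.mapAux p.fst q.fst p.snd q.snd), gcomp_assoc, P.unit_desc,
        Iso.inv_hom_id_assoc]
      rfl
    have h2 : gcomp (P.mapAux p.fst q.fst p.snd q.snd)
        (P.desc (P.mapAux q.fst r.fst q.snd r.snd)) =
        ((α_ _ _ _).inv ≫ evalHom p.fst q.fst ▷ _ ≫ (β_ _ _).hom) ▷ _ ≫ (α_ _ _ _).hom ≫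
          _ ◁ ((α_ _ _ _).inv ≫ evalHom q.fst r.fst ▷ _ ≫ (β_ _ _).hom) ≫
            (α_ _ _ _).inv ≫ gcomp (eComp V _ _ _) (P.unit r.fst r.snd) := by
      have a1 (v v' : V) (k k' : K) : P.mapAux v v' k k' = ((α_ _ _ _).inv ≫
          evalHom v v' ▷ _ ≫ (β_ _ _).hom) ≫ gcomp (𝟙 _) (P.unit v' k') := by
        simp only [mapAux, Category.assoc]
      rw [eComp_eq_gcomp p.snd, gcomp_assoc, Iso.inv_hom_id_assoc, whisker_gcomp,
        a1 p.fst, ← gcomp_whisker, gcomp_assoc, P.unit_desc, a1 q.fst]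
    rw [h1, h2, ← whisker_gcomp, P.unit_desc, tensor_eComp, MonoidalCategory.whiskerLeft_comp,
      Category.assoc, P.mapAux_comp, h]
    have := map_comp_aux (B := (p.snd ⟶[V] q.snd)) (B' := (q.snd ⟶[V] r.snd))
      (evalHom p.fst q.fst) (evalHom q.fst r.fst)
    have := congrArg (fun t => t ≫ gcomp (eComp V p.snd q.snd r.snd) (P.unit r.fst r.snd)) this
    simp only [Category.assoc] at this ⊢
    exact this)

end Copowers

end copowerFunctor

lemma unit_tensor_aux {A B : V} (x : 𝟙_ V ⟶ A) (g : 𝟙_ V ⟶ B) :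
    g ≫ (λ_ B).inv ≫ (x ⊗ₘ 𝟙 B) = (λ_ (𝟙_ V)).inv ≫ (x ⊗ₘ g) := by
  rw [leftUnitor_inv_naturality_assoc, ← id_tensorHom, tensorHom_comp_tensorHom,
    Category.id_comp, Category.comp_id]

lemma unit_tensor_aux' {A B : V} (x : 𝟙_ V ⟶ A) (g : 𝟙_ V ⟶ B) :
    g ≫ (ρ_ B).inv ≫ (𝟙 B ⊗ₘ x) = (λ_ (𝟙_ V)).inv ≫ (g ⊗ₘ x) := by
  rw [rightUnitor_inv_naturality_assoc, ← tensorHom_id, tensorHom_comp_tensorHom,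
    Category.id_comp, Category.comp_id, unitors_inv_equal]

section naturalIso
variable [BraidedCategory V]
variable {C : Type u₁} [EnrichedCategory V C] {D : Type u₂} [EnrichedCategory V D]
  {E : Type u₃} [EnrichedCategory V E] {C' : Type u₄} [EnrichedCategory V C']
  {D' : Type u₅} [EnrichedCategory V D']

/-- `V`-naturality of a family of morphisms of the underlying category of `D`. -/
def IsNaturalFamily (F G : EnrichedFunctor V C D)
    (app : ∀ c, ForgetEnrichment.of V (F.obj c) ⟶ ForgetEnrichment.of V (G.obj c)) : Prop :=
  IsNatural F G fun c => ForgetEnrichment.homTo V (app c)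

/-- A `V`-natural isomorphism. -/
structure NaturalIso (F G : EnrichedFunctor V C D) where
  iso : ∀ c, ForgetEnrichment.of V (F.obj c) ≅ ForgetEnrichment.of V (G.obj c)
  natural : IsNaturalFamily F G fun c => (iso c).hom

lemma homTo_comp' {X Y Z : ForgetEnrichment V C} (f : X ⟶ Y) (g : Y ⟶ Z) :
    ForgetEnrichment.homTo V (f ≫ g) = (λ_ (𝟙_ V)).inv ≫
      gcomp (ForgetEnrichment.homTo V f) (ForgetEnrichment.homTo V g) :=
  Category.assoc _ _ _

lemma IsNatural.unit_eq {F G : EnrichedFunctor V C D} {a : ∀ c, 𝟙_ V ⟶ (F.obj c ⟶[V] G.obj c)}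
    (h : IsNatural F G a) {X Y : C} (f : 𝟙_ V ⟶ (X ⟶[V] Y)) :
    (λ_ (𝟙_ V)).inv ≫ gcomp (f ≫ F.map X Y) (a Y) =
      (λ_ (𝟙_ V)).inv ≫ gcomp (a X) (f ≫ G.map X Y) := by
  have h1 := congrArg (fun t => (λ_ (𝟙_ V)).inv ≫ f ▷ _ ≫ t) (h X Y)
  rw [gcomp_whisker, BraidedCategory.braiding_naturality_left_assoc, whisker_gcomp,
    braiding_tensorUnit_left] at h1
  rw [h1, Category.assoc, Iso.inv_hom_id_assoc, unitors_inv_equal]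

lemma IsNaturalFamily.forget {F G : EnrichedFunctor V C D}
    {app : ∀ c, ForgetEnrichment.of V (F.obj c) ⟶ ForgetEnrichment.of V (G.obj c)}
    (h : IsNaturalFamily F G app) {X Y : C}
    (f : ForgetEnrichment.of V X ⟶ ForgetEnrichment.of V Y) :
    F.forget.map f ≫ app Y = app X ≫ G.forget.map f :=
  (homTo_comp' (V := V) (C := D) _ _).trans
    ((IsNatural.unit_eq h (ForgetEnrichment.homTo V f)).trans
      (homTo_comp' (V := V) (C := D) _ _).symm)

/-- The morphism `(f, g)` of the underlying category of `C ⊗ D`. -/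
def pairHom {X X' : C} {Y Y' : D} (f : ForgetEnrichment.of V X ⟶ ForgetEnrichment.of V X')
    (g : ForgetEnrichment.of V Y ⟶ ForgetEnrichment.of V Y') :
    ForgetEnrichment.of V (⟨X, Y⟩ : TensorObj C D) ⟶
      ForgetEnrichment.of V (⟨X', Y'⟩ : TensorObj C D) :=
  ForgetEnrichment.homOf V
    ((λ_ (𝟙_ V)).inv ≫ (ForgetEnrichment.homTo V f ⊗ₘ ForgetEnrichment.homTo V g))

lemma pairHom_id (X : C) (Y : D) :
    pairHom (𝟙 (ForgetEnrichment.of V X)) (𝟙 (ForgetEnrichment.of V Y)) = 𝟙 _ := by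
  refine Eq.trans (congrArg₂ (fun s t => (λ_ (𝟙_ V)).inv ≫ (s ⊗ₘ t))
    (ForgetEnrichment.homTo_id V (ForgetEnrichment.of V X))
    (ForgetEnrichment.homTo_id V (ForgetEnrichment.of V Y))) ?_
  exact (ForgetEnrichment.homTo_id V (ForgetEnrichment.of V (⟨X, Y⟩ : TensorObj C D))).symm

lemma tensorμ_unit_unit : tensorμ (𝟙_ V) (𝟙_ V) (𝟙_ V) (𝟙_ V) = 𝟙 _ := by
  rw [tensorμ, braiding_tensorUnit_right]
  monoidal

lemma pairHom_comp {X X' X'' : C} {Y Y' Y'' : D}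
    (f : ForgetEnrichment.of V X ⟶ ForgetEnrichment.of V X')
    (f' : ForgetEnrichment.of V X' ⟶ ForgetEnrichment.of V X'')
    (g : ForgetEnrichment.of V Y ⟶ ForgetEnrichment.of V Y')
    (g' : ForgetEnrichment.of V Y' ⟶ ForgetEnrichment.of V Y'') :
    pairHom (f ≫ f') (g ≫ g') = pairHom f g ≫ pairHom f' g' := by
  refine Eq.trans ?_ (homTo_comp' (V := V) (C := TensorObj C D) _ _).symm
  have h : gcomp (C := TensorObj C D) (X := ⟨X, Y⟩) (Y := ⟨X', Y'⟩) (Z := ⟨X'', Y''⟩)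
      ((λ_ (𝟙_ V)).inv ≫ (ForgetEnrichment.homTo V f ⊗ₘ ForgetEnrichment.homTo V g))
      ((λ_ (𝟙_ V)).inv ≫ (ForgetEnrichment.homTo V f' ⊗ₘ ForgetEnrichment.homTo V g')) =
      ((λ_ (𝟙_ V)).inv ⊗ₘ (λ_ (𝟙_ V)).inv) ≫
        (gcomp (ForgetEnrichment.homTo V f) (ForgetEnrichment.homTo V f') ⊗ₘ
          gcomp (ForgetEnrichment.homTo V g) (ForgetEnrichment.homTo V g')) := by
    rw [← tensor_gcomp]
    refine (congrArg (fun t => _ ≫ t) (tensor_gcomp_tensor (p := (⟨X, Y⟩ : TensorObj C D))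
      (q := ⟨X', Y'⟩) (r := ⟨X'', Y''⟩) _ _ _ _)).trans ?_
    rw [tensorμ_unit_unit, Category.id_comp]
  refine Eq.trans ?_ (congrArg (fun t => (λ_ (𝟙_ V)).inv ≫ t) h.symm)
  rw [tensorHom_comp_tensorHom]
  exact congrArg₂ (fun s t => (λ_ (𝟙_ V)).inv ≫ (s ⊗ₘ t)) (homTo_comp' (V := V) (C := C) f f')
    (homTo_comp' (V := V) (C := D) g g')

/-- The action of a `V`-functor of two variables on morphisms of underlying categories. -/
def map₂ (B : EnrichedFunctor V (TensorObj C D) E) {X X' : C} {Y Y' : D}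
    (f : ForgetEnrichment.of V X ⟶ ForgetEnrichment.of V X')
    (g : ForgetEnrichment.of V Y ⟶ ForgetEnrichment.of V Y') :
    ForgetEnrichment.of V (B.obj ⟨X, Y⟩) ⟶ ForgetEnrichment.of V (B.obj ⟨X', Y'⟩) :=
  B.forget.map (pairHom f g)

lemma map₂_id (B : EnrichedFunctor V (TensorObj C D) E) (X : C) (Y : D) :
    map₂ B (𝟙 (ForgetEnrichment.of V X)) (𝟙 (ForgetEnrichment.of V Y)) = 𝟙 _ := by
  rw [map₂, pairHom_id]
  exact B.forget.map_id _

lemma map₂_comp (B : EnrichedFunctor V (TensorObj C D) E) {X X' X'' : C} {Y Y' Y'' : D}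
    (f : ForgetEnrichment.of V X ⟶ ForgetEnrichment.of V X')
    (f' : ForgetEnrichment.of V X' ⟶ ForgetEnrichment.of V X'')
    (g : ForgetEnrichment.of V Y ⟶ ForgetEnrichment.of V Y')
    (g' : ForgetEnrichment.of V Y' ⟶ ForgetEnrichment.of V Y'') :
    map₂ B (f ≫ f') (g ≫ g') = map₂ B f g ≫ map₂ B f' g' := by
  rw [map₂, pairHom_comp]
  exact B.forget.map_comp _ _

lemma prodFunctor_map_pairHom (F : EnrichedFunctor V C C') (G : EnrichedFunctor V D D')
    {X X' : C} {Y Y' : D} (f : ForgetEnrichment.of V X ⟶ ForgetEnrichment.of V X')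
    (g : ForgetEnrichment.of V Y ⟶ ForgetEnrichment.of V Y') :
    (prodFunctor F G).forget.map (pairHom f g) =
      pairHom (F.forget.map f) (G.forget.map g) := by
  have h : ((λ_ (𝟙_ V)).inv ≫ (ForgetEnrichment.homTo V f ⊗ₘ ForgetEnrichment.homTo V g)) ≫
      (F.map X X' ⊗ₘ G.map Y Y') = (λ_ (𝟙_ V)).inv ≫
        ((ForgetEnrichment.homTo V f ≫ F.map X X') ⊗ₘ
          (ForgetEnrichment.homTo V g ≫ G.map Y Y')) := by
    rw [Category.assoc, tensorHom_comp_tensorHom]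
  exact h

lemma assocFunctor_map_pairHom {X X' : C} {Y Y' : D} {Z Z' : E}
    (f : ForgetEnrichment.of V X ⟶ ForgetEnrichment.of V X')
    (g : ForgetEnrichment.of V Y ⟶ ForgetEnrichment.of V Y')
    (h : ForgetEnrichment.of V Z ⟶ ForgetEnrichment.of V Z') :
    (assocFunctor C D E).forget.map (pairHom (pairHom f g) h) = pairHom f (pairHom g h) :=
  assoc_map_id_aux (ForgetEnrichment.homTo V f) (ForgetEnrichment.homTo V g)
    (ForgetEnrichment.homTo V h)

lemma forget_comp_map (F : EnrichedFunctor V C D) (G : EnrichedFunctor V D E) {X Y : C}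
    (f : ForgetEnrichment.of V X ⟶ ForgetEnrichment.of V Y) :
    (F.comp V G).forget.map f = G.forget.map (F.forget.map f) :=
  (Category.assoc (ForgetEnrichment.homTo V f) (F.map X Y) (G.map _ _)).symm

lemma forget_id_map {X Y : C} (f : ForgetEnrichment.of V X ⟶ ForgetEnrichment.of V Y) :
    (EnrichedFunctor.id V C).forget.map f = f :=
  Category.comp_id (ForgetEnrichment.homTo V f)

lemma fixLeft_forget_map (B : EnrichedFunctor V (TensorObj C D) E) (X : C) {Y Y' : D}
    (g : ForgetEnrichment.of V Y ⟶ ForgetEnrichment.of V Y') :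
    (fixLeft B X).forget.map g = map₂ B (𝟙 (ForgetEnrichment.of V X)) g := by
  refine (forget_comp_map (insertLeft D X) B g).trans (congrArg B.forget.map ?_)
  exact (unit_tensor_aux (eId V X) (ForgetEnrichment.homTo V g)).trans
    (congrArg (fun t => (λ_ (𝟙_ V)).inv ≫ (t ⊗ₘ ForgetEnrichment.homTo V g))
      (ForgetEnrichment.homTo_id V (ForgetEnrichment.of V X)).symm)

lemma fixRight_forget_map (B : EnrichedFunctor V (TensorObj C D) E) (Y : D) {X X' : C}
    (f : ForgetEnrichment.of V X ⟶ ForgetEnrichment.of V X') :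
    (fixRight B Y).forget.map f = map₂ B f (𝟙 (ForgetEnrichment.of V Y)) := by
  refine (forget_comp_map (insertRight C Y) B f).trans (congrArg B.forget.map ?_)
  exact (unit_tensor_aux' (eId V Y) (ForgetEnrichment.homTo V f)).trans
    (congrArg (fun t => (λ_ (𝟙_ V)).inv ≫ (ForgetEnrichment.homTo V f ⊗ₘ t))
      (ForgetEnrichment.homTo_id V (ForgetEnrichment.of V Y)).symm)

end naturalIso

section monoidal
variable [BraidedCategory V]

variable (V) in
/-- A monoidal structure on a `V`-category `M`. -/
structure MonoidalStructure (M : Type u₁) [EnrichedCategory V M] where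
  tensor : EnrichedFunctor V (TensorObj M M) M
  unit : M
  /-- `(X ⊗ Y) ⊗ Z ≅ X ⊗ (Y ⊗ Z)` -/
  assoc : NaturalIso
    ((prodFunctor tensor (EnrichedFunctor.id V M)).comp V tensor)
    ((assocFunctor M M M).comp V ((prodFunctor (EnrichedFunctor.id V M) tensor).comp V tensor))
  /-- `I ⊗ X ≅ X` -/
  leftUnitor : NaturalIso (fixLeft tensor unit) (EnrichedFunctor.id V M)
  /-- `X ⊗ I ≅ X` -/
  rightUnitor : NaturalIso (fixRight tensor unit) (EnrichedFunctor.id V M)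
  pentagon (W X Y Z : M) :
    map₂ tensor (assoc.iso ⟨⟨W, X⟩, Y⟩).hom (𝟙 (ForgetEnrichment.of V Z)) ≫
        (assoc.iso ⟨⟨W, tensor.obj ⟨X, Y⟩⟩, Z⟩).hom ≫
          map₂ tensor (𝟙 (ForgetEnrichment.of V W)) (assoc.iso ⟨⟨X, Y⟩, Z⟩).hom =
      (assoc.iso ⟨⟨tensor.obj ⟨W, X⟩, Y⟩, Z⟩).hom ≫
        (assoc.iso ⟨⟨W, X⟩, tensor.obj ⟨Y, Z⟩⟩).hom
  triangle (X Y : M) :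
    (assoc.iso ⟨⟨X, unit⟩, Y⟩).hom ≫
        map₂ tensor (𝟙 (ForgetEnrichment.of V X)) (leftUnitor.iso Y).hom =
      map₂ tensor (rightUnitor.iso X).hom (𝟙 (ForgetEnrichment.of V Y))

/-- A left action of a monoidal `V`-category `M` on a `V`-category `L`. -/
structure Actegory {M : Type u₁} [EnrichedCategory V M] (S : MonoidalStructure V M)
    (L : Type u₂) [EnrichedCategory V L] where
  act : EnrichedFunctor V (TensorObj M L) L
  /-- `X * (Y * K) ≅ (X ⊗ Y) * K` -/
  assoc : NaturalIso
    ((assocFunctor M M L).comp V ((prodFunctor (EnrichedFunctor.id V M) act).comp V act))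
    ((prodFunctor S.tensor (EnrichedFunctor.id V L)).comp V act)
  /-- `I * K ≅ K` -/
  unitor : NaturalIso (fixLeft act S.unit) (EnrichedFunctor.id V L)
  pentagon (X Y Z : M) (K : L) :
    (assoc.iso ⟨⟨X, Y⟩, act.obj ⟨Z, K⟩⟩).hom ≫ (assoc.iso ⟨⟨S.tensor.obj ⟨X, Y⟩, Z⟩, K⟩).hom ≫
        map₂ act (S.assoc.iso ⟨⟨X, Y⟩, Z⟩).hom (𝟙 (ForgetEnrichment.of V K)) =
      map₂ act (𝟙 (ForgetEnrichment.of V X)) (assoc.iso ⟨⟨Y, Z⟩, K⟩).hom ≫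
        (assoc.iso ⟨⟨X, S.tensor.obj ⟨Y, Z⟩⟩, K⟩).hom
  left_unit (X : M) (K : L) :
    (assoc.iso ⟨⟨S.unit, X⟩, K⟩).hom ≫
        map₂ act (S.leftUnitor.iso X).hom (𝟙 (ForgetEnrichment.of V K)) =
      (unitor.iso (act.obj ⟨X, K⟩)).hom
  right_unit (X : M) (K : L) :
    (assoc.iso ⟨⟨X, S.unit⟩, K⟩).hom ≫
        map₂ act (S.rightUnitor.iso X).hom (𝟙 (ForgetEnrichment.of V K)) =
      map₂ act (𝟙 (ForgetEnrichment.of V X)) (unitor.iso K).hom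

/-- The underlying category `M₀` of a monoidal `V`-category. -/
def MonoidalStructure.Underlying {M : Type u₁} [EnrichedCategory V M]
    (_S : MonoidalStructure V M) : Type u₁ := ForgetEnrichment V M

variable {M : Type u₁} [EnrichedCategory V M] (S : MonoidalStructure V M)

instance : Category S.Underlying := inferInstanceAs (Category (ForgetEnrichment V M))

/-- An object of `M` as an object of the underlying category. -/
def MonoidalStructure.of (X : M) : S.Underlying := X

instance : MonoidalCategoryStruct S.Underlying where
  tensorObj X Y := S.of (S.tensor.obj ⟨X, Y⟩)
  tensorHom {X₁ Y₁ X₂ Y₂} f g := map₂ (X := X₁) (X' := Y₁) (Y := X₂) (Y' := Y₂) S.tensor f g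
  whiskerLeft X Y Y' f := map₂ (X := X) (X' := X) (Y := Y) (Y' := Y') S.tensor
    (𝟙 (ForgetEnrichment.of V (C := M) X)) f
  whiskerRight {X X'} f Y := map₂ (X := X) (X' := X') (Y := Y) (Y' := Y) S.tensor f
    (𝟙 (ForgetEnrichment.of V (C := M) Y))
  tensorUnit := S.of S.unit
  associator X Y Z := S.assoc.iso ⟨⟨X, Y⟩, Z⟩
  leftUnitor X := S.leftUnitor.iso X
  rightUnitor X := S.rightUnitor.iso X

lemma MonoidalStructure.assoc_naturality {X X' Y Y' Z Z' : M}
    (f : ForgetEnrichment.of V X ⟶ ForgetEnrichment.of V X')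
    (g : ForgetEnrichment.of V Y ⟶ ForgetEnrichment.of V Y')
    (h : ForgetEnrichment.of V Z ⟶ ForgetEnrichment.of V Z') :
    map₂ S.tensor (map₂ S.tensor f g) h ≫ (S.assoc.iso ⟨⟨X', Y'⟩, Z'⟩).hom =
      (S.assoc.iso ⟨⟨X, Y⟩, Z⟩).hom ≫ map₂ S.tensor f (map₂ S.tensor g h) := by
  have key := S.assoc.natural.forget (pairHom (pairHom f g) h)
  have h1 : ((prodFunctor S.tensor (EnrichedFunctor.id V M)).comp V S.tensor).forget.map
      (pairHom (pairHom f g) h) = map₂ S.tensor (map₂ S.tensor f g) h := by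
    refine (forget_comp_map (prodFunctor S.tensor (EnrichedFunctor.id V M)) S.tensor _).trans
      (congrArg S.tensor.forget.map ?_)
    exact (prodFunctor_map_pairHom _ _ _ _).trans (congrArg (pairHom _) (forget_id_map h))
  have h2 : ((assocFunctor M M M).comp V
      ((prodFunctor (EnrichedFunctor.id V M) S.tensor).comp V S.tensor)).forget.map
      (pairHom (pairHom f g) h) = map₂ S.tensor f (map₂ S.tensor g h) := by
    refine (forget_comp_map (assocFunctor M M M) _ _).trans ?_
    refine (congrArg _ (assocFunctor_map_pairHom f g h)).trans ?_
    refine (forget_comp_map (prodFunctor (EnrichedFunctor.id V M) S.tensor) S.tensor _).trans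
      (congrArg S.tensor.forget.map ?_)
    exact (prodFunctor_map_pairHom _ _ _ _).trans
      (congrArg (fun t => pairHom t _) (forget_id_map f))
  exact (congrArg (fun t => t ≫ (S.assoc.iso ⟨⟨X', Y'⟩, Z'⟩).hom) h1).symm.trans
    (key.trans (congrArg (fun t => (S.assoc.iso ⟨⟨X, Y⟩, Z⟩).hom ≫ t) h2))

lemma MonoidalStructure.leftUnitor_naturality {X Y : M}
    (f : ForgetEnrichment.of V X ⟶ ForgetEnrichment.of V Y) :
    map₂ S.tensor (𝟙 (ForgetEnrichment.of V S.unit)) f ≫ (S.leftUnitor.iso Y).hom =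
      (S.leftUnitor.iso X).hom ≫ f :=
  (congrArg (fun t => t ≫ (S.leftUnitor.iso Y).hom) (fixLeft_forget_map _ _ f)).symm.trans
    ((S.leftUnitor.natural.forget f).trans
      (congrArg (fun t => (S.leftUnitor.iso X).hom ≫ t) (forget_id_map f)))

lemma MonoidalStructure.rightUnitor_naturality {X Y : M}
    (f : ForgetEnrichment.of V X ⟶ ForgetEnrichment.of V Y) :
    map₂ S.tensor f (𝟙 (ForgetEnrichment.of V S.unit)) ≫ (S.rightUnitor.iso Y).hom =
      (S.rightUnitor.iso X).hom ≫ f :=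
  (congrArg (fun t => t ≫ (S.rightUnitor.iso Y).hom) (fixRight_forget_map _ _ f)).symm.trans
    ((S.rightUnitor.natural.forget f).trans
      (congrArg (fun t => (S.rightUnitor.iso X).hom ≫ t) (forget_id_map f)))

/-- The underlying category of a monoidal `V`-category is a monoidal category. -/
instance : MonoidalCategory S.Underlying :=
  MonoidalCategory.ofTensorHom
    (fun X Y => map₂_id S.tensor X Y)
    (fun _ _ _ _ => rfl)
    (fun _ _ => rfl)
    (fun f₁ f₂ g₁ g₂ => (map₂_comp S.tensor f₁ g₁ f₂ g₂).symm)
    (fun f g h => S.assoc_naturality f g h)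
    (fun f => S.leftUnitor_naturality f)
    (fun f => S.rightUnitor_naturality f)
    (fun W X Y Z => S.pentagon W X Y Z)
    (fun X Y => S.triangle X Y)

end monoidal

section coend
variable [BraidedCategory V] {C : Type u₁} [EnrichedCategory V C] {K : Type u₂}
  [EnrichedCategory V K]

/-- A cowedge under `T` with vertex `Y`, with generalized elements of shape `U` as components:
a wedge `U ⟶ K(T(c, c), Y)`. An ordinary cowedge is the case `U = 𝟙_ V`. -/
structure Cowedge (T : EnrichedFunctor V (TensorObj Cᵒᵖ C) K) (U : V) (Y : K) where
  app (c : C) : U ⟶ (T.obj ⟨op c, c⟩ ⟶[V] Y)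
  condition (c c' : C) :
    gcomp ((fixLeft T (op c')).map c c') (app c') =
      gcomp ((fixRight T c).map (op c') (op c)) (app c)

/-- The cowedge `ω` exhibits `Z` as the coend of `T`: the induced families
`K(Z, Y) ⟶ K(T(c, c), Y)` exhibit `K(Z, Y)` as the end of `K(T(-, -), Y)`, for all `Y`. -/
def Cowedge.IsCoend {T : EnrichedFunctor V (TensorObj Cᵒᵖ C) K} {Z : K}
    (ω : Cowedge T (𝟙_ V) Z) : Prop :=
  ∀ (U : V) (Y : K) (φ : Cowedge T U Y),
    ∃! g : U ⟶ (Z ⟶[V] Y), ∀ c, (λ_ U).inv ≫ gcomp (ω.app c) g = φ.app c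

/-- The coend of `T` exists in `K`. -/
def HasCoend (T : EnrichedFunctor V (TensorObj Cᵒᵖ C) K) : Prop :=
  ∃ (Z : K) (ω : Cowedge T (𝟙_ V) Z), ω.IsCoend

end coend

section representable
variable [MonoidalClosed V] {C : Type u₁} [EnrichedCategory V C]

/-- The representable `V`-functor `C(a, -)`. -/
def corep (a : C) : EnrichedFunctor V C V where
  obj b := (a ⟶[V] b)
  map b b' := MonoidalClosed.curry (eComp V a b b')
  map_id b := by
    apply MonoidalClosed.uncurry_injective
    refine (MonoidalClosed.uncurry_natural_left _ _).trans ?_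
    refine Eq.trans ?_ (MonoidalClosed.uncurry_curry _).symm
    rw [MonoidalClosed.uncurry_curry]
    have := e_comp_id V a b
    rwa [Iso.inv_comp_eq, Category.comp_id] at this
  map_comp b b' b'' := by
    apply MonoidalClosed.uncurry_injective
    refine (MonoidalClosed.uncurry_natural_left _ _).trans ?_
    refine Eq.trans ?_ (uncurry_gcomp _ _).symm
    rw [MonoidalClosed.uncurry_curry, MonoidalClosed.uncurry_curry, MonoidalClosed.uncurry_curry,
      e_assoc]

/-- The representable `V`-functor `C(-, x)`. -/
def rep [BraidedCategory V] (x : C) : EnrichedFunctor V Cᵒᵖ V := corep (op x)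

end representable

section adjunction
variable [BraidedCategory V] {C : Type u₁} [EnrichedCategory V C] {D : Type u₂}
  [EnrichedCategory V D]

/-- An adjunction `L ⊣ R` of `V`-functors. -/
structure Adjunction (L : EnrichedFunctor V C D) (R : EnrichedFunctor V D C) where
  unit (c : C) : ForgetEnrichment.of V c ⟶ ForgetEnrichment.of V (R.obj (L.obj c))
  counit (d : D) : ForgetEnrichment.of V (L.obj (R.obj d)) ⟶ ForgetEnrichment.of V d
  unit_natural : IsNaturalFamily (EnrichedFunctor.id V C) (L.comp V R) unit
  counit_natural : IsNaturalFamily (R.comp V L) (EnrichedFunctor.id V D) counit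
  left_triangle (c : C) : L.forget.map (unit c) ≫ counit (L.obj c) = 𝟙 _
  right_triangle (d : D) : unit (R.obj d) ≫ R.forget.map (counit d) = 𝟙 _

end adjunction

section convolution
variable [SymmetricCategory V] [MonoidalClosed V] [HasLimits V]
variable {A : Type w} [EnrichedCategory V A] (m : MonoidalStructure V A)
variable {K : Type u₁} [EnrichedCategory V K]

/-- The integrand `((a, b), (a', b')) ↦ (A(m(a, b), x) ⊗ F(a')) ⊙ X(b')` of the convolution. -/
def integrand (P : Copowers V K) (F : EnrichedFunctor V A V) (X : EnrichedFunctor V A K) (x : A) :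
    EnrichedFunctor V (TensorObj (TensorObj A A)ᵒᵖ (TensorObj A A)) K :=
  (prodFunctor ((opFunctor m.tensor).comp V (rep x)) (prodFunctor F X)).comp V
    ((assocInvFunctor V V K).comp V
      ((prodFunctor (selfCopowers V).functor (EnrichedFunctor.id V K)).comp V P.functor))

/-- The `V`-functor `x ↦ (A(m(a, b), x) ⊗ F(a)) ⊙ X(b)`. -/
def integrandFunctor (P : Copowers V K) (F : EnrichedFunctor V A V) (X : EnrichedFunctor V A K)
    (a b : A) : EnrichedFunctor V A K :=
  (corep (m.tensor.obj ⟨a, b⟩)).comp V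
    ((fixRight (selfCopowers V).functor (F.obj a)).comp V (fixRight P.functor (X.obj b)))

/-- The `V`-functor `(F, X) ↦ (A(m(a, b), x) ⊗ F(a)) ⊙ X(b)`. -/
def integrandFunctor₂ (P : Copowers V K) (x a b : A) :
    EnrichedFunctor V (TensorObj (EnrichedFunctor V A V) (EnrichedFunctor V A K)) K :=
  (prodFunctor (evalFunctor V a) (evalFunctor K b)).comp V
    ((prodFunctor (fixLeft (selfCopowers V).functor (m.tensor.obj ⟨a, b⟩ ⟶[V] x))
      (EnrichedFunctor.id V K)).comp V P.functor)

/-- The data exhibiting a `V`-functor `[A, V] ⊗ [A, K] ⟶ [A, K]`, `(F, X) ↦ F * X`, as the one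
defined by the coends `(F * X)(x) = ∫^{a, b} (A(m(a, b), x) ⊗ F(a)) ⊙ X(b)`: universal cowedges
that are `V`-natural in `x` and in `(F, X)`. -/
structure Convolution (P : Copowers V K)
    (act : EnrichedFunctor V (TensorObj (EnrichedFunctor V A V) (EnrichedFunctor V A K))
      (EnrichedFunctor V A K)) where
  ι (F : EnrichedFunctor V A V) (X : EnrichedFunctor V A K) (x : A) :
    Cowedge (integrand m P F X x) (𝟙_ V) ((act.obj ⟨F, X⟩).obj x)
  isCoend (F : EnrichedFunctor V A V) (X : EnrichedFunctor V A K) (x : A) : (ι F X x).IsCoend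
  natural (F : EnrichedFunctor V A V) (X : EnrichedFunctor V A K) (a b : A) :
    IsNatural (integrandFunctor m P F X a b) (act.obj ⟨F, X⟩) fun x => (ι F X x).app ⟨a, b⟩
  natural₂ (x a b : A) :
    IsNatural (integrandFunctor₂ m P x a b) (act.comp V (evalFunctor K x))
      fun p => (ι p.fst p.snd x).app ⟨a, b⟩

/-- Composition of a generalized element with a morphism of the underlying category. -/
def postComp {U : V} {X Y Z : K} (f : U ⟶ (X ⟶[V] Y)) (g : 𝟙_ V ⟶ (Y ⟶[V] Z)) :
    U ⟶ (X ⟶[V] Z) :=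
  (ρ_ U).inv ≫ gcomp f g

/-- The component at `x` of a morphism of `[A, K]₀`. -/
def component {X Y : EnrichedFunctor V A K}
    (φ : ForgetEnrichment.of V X ⟶ ForgetEnrichment.of V Y) (x : A) :
    𝟙_ V ⟶ (X.obj x ⟶[V] Y.obj x) :=
  ForgetEnrichment.homTo V φ ≫ natπ X Y x

/-- The value of a `V`-functor at a morphism of the underlying category. -/
def mapHom (X : EnrichedFunctor V A K) {a b : A}
    (f : ForgetEnrichment.of V a ⟶ ForgetEnrichment.of V b) :
    𝟙_ V ⟶ (X.obj a ⟶[V] X.obj b) :=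
  ForgetEnrichment.homTo V f ≫ X.map a b

variable {m}

namespace Convolution
variable {P : Copowers V K}
  {act : EnrichedFunctor V (TensorObj (EnrichedFunctor V A V) (EnrichedFunctor V A K))
    (EnrichedFunctor V A K)}
  {tens : EnrichedFunctor V (TensorObj (EnrichedFunctor V A V) (EnrichedFunctor V A V))
    (EnrichedFunctor V A V)}

/-- The transpose `F(a) ⟶ K(X(b), (F * X)(m(a, b)))` of the canonical morphism
`F(a) ⊙ X(b) ⟶ (F * X)(m(a, b))`. -/
def coproj (κ : Convolution m P act) (F : EnrichedFunctor V A V) (X : EnrichedFunctor V A K)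
    (a b : A) : F.obj a ⟶ (X.obj b ⟶[V] (act.obj ⟨F, X⟩).obj (m.tensor.obj ⟨a, b⟩)) :=
  (λ_ (F.obj a)).inv ≫ eId V (m.tensor.obj ⟨a, b⟩) ▷ F.obj a ≫
    postComp (P.unit ((m.tensor.obj ⟨a, b⟩ ⟶[V] m.tensor.obj ⟨a, b⟩) ⊗ F.obj a) (X.obj b))
      ((κ.ι F X (m.tensor.obj ⟨a, b⟩)).app ⟨a, b⟩)

/-- The canonical morphism `F(a) ⊗ G(b) ⟶ (F * G)(m(a, b))` of the Day convolution. -/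
def tensorCoproj (δ : Convolution m (selfCopowers V) tens) (F G : EnrichedFunctor V A V)
    (a b : A) : F.obj a ⊗ G.obj b ⟶ (tens.obj ⟨F, G⟩).obj (m.tensor.obj ⟨a, b⟩) :=
  (β_ _ _).hom ≫ MonoidalClosed.uncurry (δ.coproj F G a b)

/-- The isomorphisms `F * (G * X) ≅ (F * G) * X` are the canonical ones, i.e. they are compatible
with the canonical morphisms out of `F(a) ⊗ G(b)` and with the associator of `A`. -/
def IsAssociator (δ : Convolution m (selfCopowers V) tens) (κ : Convolution m P act)
    (α : ∀ (F G : EnrichedFunctor V A V) (X : EnrichedFunctor V A K),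
      ForgetEnrichment.of V (act.obj ⟨F, act.obj ⟨G, X⟩⟩) ≅
        ForgetEnrichment.of V (act.obj ⟨tens.obj ⟨F, G⟩, X⟩)) : Prop :=
  ∀ (F G : EnrichedFunctor V A V) (X : EnrichedFunctor V A K) (a b c : A),
    postComp (δ.tensorCoproj F G a b ≫ κ.coproj (tens.obj ⟨F, G⟩) X (m.tensor.obj ⟨a, b⟩) c)
        (mapHom (act.obj ⟨tens.obj ⟨F, G⟩, X⟩) (m.assoc.iso ⟨⟨a, b⟩, c⟩).hom) =
      postComp ((β_ _ _).hom ≫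
          gcomp (κ.coproj G X b c) (κ.coproj F (act.obj ⟨G, X⟩) a (m.tensor.obj ⟨b, c⟩)))
        (component (α F G X).hom (m.tensor.obj ⟨a, m.tensor.obj ⟨b, c⟩⟩))

/-- The isomorphisms `I * X ≅ X` are the canonical ones, where `j` is the universal element
of `I ≅ A(i, -)`. -/
def IsLeftUnitor (κ : Convolution m P act) {I : EnrichedFunctor V A V} (j : 𝟙_ V ⟶ I.obj m.unit)
    (l : ∀ X : EnrichedFunctor V A K,
      ForgetEnrichment.of V (act.obj ⟨I, X⟩) ≅ ForgetEnrichment.of V X) : Prop :=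
  ∀ (X : EnrichedFunctor V A K) (b : A),
    postComp (postComp (j ≫ κ.coproj I X m.unit b)
        (component (l X).hom (m.tensor.obj ⟨m.unit, b⟩)))
      (mapHom X (m.leftUnitor.iso b).hom) = eId V (X.obj b)

/-- The isomorphisms `F * I ≅ F` are the canonical ones, where `j` is the universal element
of `I ≅ A(i, -)`. -/
def IsRightUnitor (δ : Convolution m (selfCopowers V) tens) {I : EnrichedFunctor V A V}
    (j : 𝟙_ V ⟶ I.obj m.unit)
    (r : ∀ F : EnrichedFunctor V A V,
      ForgetEnrichment.of V (tens.obj ⟨F, I⟩) ≅ ForgetEnrichment.of V F) : Prop :=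
  ∀ (F : EnrichedFunctor V A V) (a : A),
    (λ_ (F.obj a)).inv ≫ j ▷ F.obj a ≫ MonoidalClosed.uncurry
      (postComp (postComp (δ.coproj F I a m.unit)
          (component (r F).hom (m.tensor.obj ⟨a, m.unit⟩)))
        (mapHom F (m.rightUnitor.iso a).hom)) = 𝟙 (F.obj a)

end Convolution

variable (m) in
/-- The data exhibiting a monoidal structure on the `V`-category `[A, V]` as Day convolution. -/
structure DayConvolution (S : MonoidalStructure V (EnrichedFunctor V A V)) where
  conv : Convolution m (selfCopowers V) S.tensor
  unitIso : ForgetEnrichment.of V (corep m.unit : EnrichedFunctor V A V) ≅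
    ForgetEnrichment.of V S.unit
  isAssociator : conv.IsAssociator conv fun F G H => (S.assoc.iso ⟨⟨F, G⟩, H⟩).symm
  isLeftUnitor : conv.IsLeftUnitor
    ((λ_ (𝟙_ V)).inv ≫ (eId V m.unit ⊗ₘ component unitIso.hom m.unit) ≫ evalHom _ _)
    S.leftUnitor.iso
  isRightUnitor : conv.IsRightUnitor
    ((λ_ (𝟙_ V)).inv ≫ (eId V m.unit ⊗ₘ component unitIso.hom m.unit) ≫ evalHom _ _)
    S.rightUnitor.iso

/-- The universal element of the unit of a Day convolution structure. -/
def DayConvolution.unitElement {S : MonoidalStructure V (EnrichedFunctor V A V)}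
    (day : DayConvolution m S) : 𝟙_ V ⟶ S.unit.obj m.unit :=
  (λ_ (𝟙_ V)).inv ≫ (eId V m.unit ⊗ₘ component day.unitIso.hom m.unit) ≫ evalHom _ _

variable (m) in
/-- `⟨X, Y⟩ = [A, K](X, Y(m(-, ?)))`, i.e. `⟨X, Y⟩(a) = ∫_b K(X(b), Y(m(a, b)))`. -/
def angle (X Y : EnrichedFunctor V A K) : EnrichedFunctor V A V :=
  (curryFunctor (m.tensor.comp V Y)).comp V (corep X)

end convolution

end VCat

end

/-! The whole proof rests on one universal property. By the Yoneda lemma in the variable x, a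
cowedge on (A(m(a,b),x) ⊗ F(a)) ⊙ X(b) that is natural in x is determined by its value at x = m(a,b)
on the identity. Hence morphisms F * X ⟶ Y are the same as families F(a) ⟶ K(X(b), Y(m(a,b))) that
are V-natural in a and in b (`IsBilinear`). The universal such family is `Convolution.coproj`;
existence of factorizations is `exists_of_isBilinear`, uniqueness is `natural_ext`. The universal
cowedges assemble into a V-functor of (x, F, X) because uniqueness forces functoriality
(`paramFunctor`, `jointConv`).

Since ⟨X,Y⟩(a) is the end over b of K(X(b), Y(m(a,b))), the same bilinear families are also the
morphisms F ⟶ ⟨X,Y⟩ (`IsBilinear.exists_angle`). This gives the V-adjunction between - * X and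
⟨X,-⟩. The adjunction in turn extends the universal property of F * X from morphisms to generalized
elements of arbitrary shape U (`exists_of_isBilinearFamily`), which is needed to iterate it.

Iterating, morphisms out of F * (G * X) are families G(b) ⊗ F(a) ⟶ K(X(c), W(m(a,m(b,c)))) natural
in three variables, and morphisms out of (F * G) * X are such families with W(m(m(a,b),c)). Applying
W to the associator of A passes from one kind to the other, which defines the associativity
isomorphism. Similarly I * X ≅ X comes from Yoneda for A(i,-) and the left unitor of A, and F * I ≅
F from the right unitor. Each coherence axiom is tested on the universal families, where every
structural isomorphism turns into the corresponding one of A: the pentagon becomes the pentagon of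
A, and the unit axioms become the triangle and its standard consequence for the left unitor of a
product.

The Day convolution structure on [A,V] is the case K = V, where the required coends exist because A
is small and V is cocomplete. For part (ii), an action whose functors - * X all have right adjoints
⟨X,-⟩ makes the category acted upon into an enriched category with copowers F * X: identities and
composition are the transposes of the unitor and of the iterated evaluation, and the enriched axioms
are transposes of the axioms of the action (`ClosedAction`).

Throughout, elements of hom-objects are handled as generalized elements U ⟶ K(X,Y), composed with
`gcomp`. -/

set_option linter.unusedSectionVars false

noncomputable section

namespace VCat

variable {V : Type v} [Category.{w} V] [MonoidalCategory V]

/-! ### Composition with morphisms of the underlying category -/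

section postPre
variable {C : Type u₁} [EnrichedCategory V C] {D : Type u₂} [EnrichedCategory V D]

/-- Composition with a morphism of the underlying category, on hom-objects. -/
def post {X Y Z : C} (g : 𝟙_ V ⟶ (Y ⟶[V] Z)) : (X ⟶[V] Y) ⟶ (X ⟶[V] Z) :=
  (ρ_ _).inv ≫ gcomp (𝟙 _) g

/-- Precomposition with a morphism of the underlying category, on hom-objects. -/
def pre {X Y Z : C} (f : 𝟙_ V ⟶ (X ⟶[V] Y)) : (Y ⟶[V] Z) ⟶ (X ⟶[V] Z) :=
  (λ_ _).inv ≫ gcomp f (𝟙 _)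

lemma comp_post {U : V} {X Y Z : C} (f : U ⟶ (X ⟶[V] Y)) (g : 𝟙_ V ⟶ (Y ⟶[V] Z)) :
    f ≫ post g = (ρ_ U).inv ≫ gcomp f g := by
  rw [post, rightUnitor_inv_naturality_assoc, gcomp_whisker, Category.comp_id]

lemma postComp_eq {U : V} {X Y Z : C} (f : U ⟶ (X ⟶[V] Y)) (g : 𝟙_ V ⟶ (Y ⟶[V] Z)) :
    postComp f g = f ≫ post g := (comp_post f g).symm

lemma comp_pre {U : V} {X Y Z : C} (f : 𝟙_ V ⟶ (X ⟶[V] Y)) (g : U ⟶ (Y ⟶[V] Z)) :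
    g ≫ pre f = (λ_ U).inv ≫ gcomp f g := by
  rw [pre, leftUnitor_inv_naturality_assoc, whisker_gcomp, Category.comp_id]

lemma gcomp_unit_right {U : V} {X Y Z : C} (f : U ⟶ (X ⟶[V] Y)) (g : 𝟙_ V ⟶ (Y ⟶[V] Z)) :
    gcomp f g = (ρ_ U).hom ≫ f ≫ post g := by
  rw [comp_post, Iso.hom_inv_id_assoc]

lemma gcomp_unit_left {U : V} {X Y Z : C} (f : 𝟙_ V ⟶ (X ⟶[V] Y)) (g : U ⟶ (Y ⟶[V] Z)) :
    gcomp f g = (λ_ U).hom ≫ g ≫ pre f := by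
  rw [comp_pre, Iso.hom_inv_id_assoc]

lemma gcomp_post {U U' : V} {X Y Z Z' : C} (f : U ⟶ (X ⟶[V] Y)) (g : U' ⟶ (Y ⟶[V] Z))
    (h : 𝟙_ V ⟶ (Z ⟶[V] Z')) : gcomp f (g ≫ post h) = gcomp f g ≫ post h := by
  rw [comp_post, comp_post, gcomp_assoc, ← whisker_gcomp]
  simp

lemma gcomp_pre {U U' : V} {W X Y Z : C} (f : U ⟶ (X ⟶[V] Y)) (g : U' ⟶ (Y ⟶[V] Z))
    (h : 𝟙_ V ⟶ (W ⟶[V] X)) : gcomp (f ≫ pre h) g = gcomp f g ≫ pre h := by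
  rw [comp_pre, comp_pre, ← gcomp_whisker, gcomp_assoc]
  simp

lemma gcomp_post_left {U U' : V} {X Y Y' Z : C} (f : U ⟶ (X ⟶[V] Y)) (h : 𝟙_ V ⟶ (Y ⟶[V] Y'))
    (g : U' ⟶ (Y' ⟶[V] Z)) : gcomp (f ≫ post h) g = gcomp f (g ≫ pre h) := by
  rw [comp_post, comp_pre, ← gcomp_whisker, gcomp_assoc, ← whisker_gcomp]
  simp

lemma pre_post {W X Y Z : C} (f : 𝟙_ V ⟶ (W ⟶[V] X)) (g : 𝟙_ V ⟶ (Y ⟶[V] Z)) :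
    (pre f : (X ⟶[V] Y) ⟶ _) ≫ post g = post g ≫ pre f := by
  rw [pre, Category.assoc, ← gcomp_post, Category.id_comp, gcomp_unit_left,
    Iso.inv_hom_id_assoc]

lemma pre_unit {X Y Z : C} (f : 𝟙_ V ⟶ (X ⟶[V] Y)) (g : 𝟙_ V ⟶ (Y ⟶[V] Z)) :
    g ≫ pre f = f ≫ post g := by
  rw [comp_pre, comp_post, unitors_inv_equal]

@[simp]
lemma post_eId {X Y : C} : (post (eId V Y) : (X ⟶[V] Y) ⟶ _) = 𝟙 _ := by
  rw [post, gcomp_eId, Category.comp_id, Iso.inv_hom_id]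

@[simp]
lemma pre_eId {X Y : C} : (pre (eId V X) : (X ⟶[V] Y) ⟶ _) = 𝟙 _ := by
  rw [pre, eId_gcomp, Category.comp_id, Iso.inv_hom_id]

lemma post_post {W X Y Z : C} (f : 𝟙_ V ⟶ (X ⟶[V] Y)) (g : 𝟙_ V ⟶ (Y ⟶[V] Z)) :
    (post f : (W ⟶[V] X) ⟶ _) ≫ post g = post (f ≫ post g) := by
  rw [post, Category.assoc, ← gcomp_post, ← post]

lemma pre_pre {X Y Z W : C} (f : 𝟙_ V ⟶ (X ⟶[V] Y)) (g : 𝟙_ V ⟶ (Y ⟶[V] Z)) :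
    (pre g : (Z ⟶[V] W) ⟶ _) ≫ pre f = pre (f ≫ post g) := by
  rw [pre, Category.assoc, ← gcomp_pre, ← pre, pre_unit]

lemma homTo_comp_eq {X Y Z : ForgetEnrichment V C} (f : X ⟶ Y) (g : Y ⟶ Z) :
    ForgetEnrichment.homTo V (f ≫ g) =
      ForgetEnrichment.homTo V f ≫ post (ForgetEnrichment.homTo V g) := by
  rw [comp_post, ← unitors_inv_equal]
  exact Category.assoc _ _ _

lemma eId_post {X Y : C} (f : 𝟙_ V ⟶ (X ⟶[V] Y)) : eId V X ≫ post f = f := by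
  rw [← pre_unit, pre_eId, Category.comp_id]

lemma eId_pre {X Y : C} (f : 𝟙_ V ⟶ (X ⟶[V] Y)) : eId V Y ≫ pre f = f := by
  rw [pre_unit, post_eId, Category.comp_id]

lemma post_map (F : EnrichedFunctor V C D) {X Y Z : C} (g : 𝟙_ V ⟶ (Y ⟶[V] Z)) :
    post g ≫ F.map X Z = F.map X Y ≫ post (g ≫ F.map Y Z) := by
  rw [post, Category.assoc, gcomp_map, comp_post, Category.id_comp]

lemma pre_map (F : EnrichedFunctor V C D) {X Y Z : C} (g : 𝟙_ V ⟶ (X ⟶[V] Y)) :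
    pre g ≫ F.map X Z = F.map Y Z ≫ pre (g ≫ F.map X Y) := by
  rw [pre, Category.assoc, gcomp_map, comp_pre, Category.id_comp]

end postPre

/-! ### Calculus of V-natural families of generalized elements -/

section natural
variable [BraidedCategory V]
variable {C : Type u₁} [EnrichedCategory V C] {D : Type u₂} [EnrichedCategory V D]
  {E : Type u₃} [EnrichedCategory V E] {C' : Type u₄} [EnrichedCategory V C']
  {D' : Type u₅} [EnrichedCategory V D']

/-- The square with sides `f`, `s'`, `s`, `g` commutes, up to the symmetry. -/
def Sq {U P : V} {W X Y Z : C} (f : P ⟶ (W ⟶[V] X)) (s' : U ⟶ (X ⟶[V] Z)) (s : U ⟶ (W ⟶[V] Y))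
    (g : P ⟶ (Y ⟶[V] Z)) : Prop :=
  gcomp f s' = (β_ _ _).hom ≫ gcomp s g

/-- `IsNatural F G s` at c, c' unfolds to `Sq (F.map c c') (s c') (s c) (G.map c c')`, so every
closure property of squares is at once a closure property of natural families. -/
lemma Sq.precomp {U P U' P' : V} {W X Y Z : C} {f : P ⟶ (W ⟶[V] X)} {s' : U ⟶ (X ⟶[V] Z)}
    {s : U ⟶ (W ⟶[V] Y)} {g : P ⟶ (Y ⟶[V] Z)} (h : Sq f s' s g) (a : U' ⟶ U) (b : P' ⟶ P) :
    Sq (b ≫ f) (a ≫ s') (a ≫ s) (b ≫ g) := by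
  rw [Sq, ← tensor_gcomp, h, ← tensor_gcomp, BraidedCategory.braiding_naturality_assoc]

lemma Sq.map {U P : V} {W X Y Z : C} {f : P ⟶ (W ⟶[V] X)} {s' : U ⟶ (X ⟶[V] Z)}
    {s : U ⟶ (W ⟶[V] Y)} {g : P ⟶ (Y ⟶[V] Z)} (h : Sq f s' s g) (F : EnrichedFunctor V C D) :
    Sq (f ≫ F.map _ _) (s' ≫ F.map _ _) (s ≫ F.map _ _) (g ≫ F.map _ _) := by
  rw [Sq, ← gcomp_map, h, Category.assoc, gcomp_map]

/-- Squares paste. The hexagon identity splits the braiding of P with U ⊗ U' into the two braidings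
supplied by the squares; `Sq.hcomp` uses the other hexagon. -/
lemma Sq.vcomp {U U' P : V} {W X Y Z Y' Z' : C} {f : P ⟶ (W ⟶[V] X)} {s' : U ⟶ (X ⟶[V] Z)}
    {s : U ⟶ (W ⟶[V] Y)} {g : P ⟶ (Y ⟶[V] Z)} (h : Sq f s' s g) {t' : U' ⟶ (Z ⟶[V] Z')}
    {t : U' ⟶ (Y ⟶[V] Y')} {k : P ⟶ (Y' ⟶[V] Z')} (h' : Sq g t' t k) :
    Sq f (gcomp s' t') (gcomp s t) k := by
  have h1 : gcomp f (gcomp s' t') = (α_ _ _ _).inv ≫ gcomp (gcomp f s') t' := by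
    rw [gcomp_assoc, Iso.inv_hom_id_assoc]
  rw [Sq, h1, h, ← gcomp_whisker, gcomp_assoc, h', ← whisker_gcomp, gcomp_assoc,
    BraidedCategory.braiding_tensor_right_hom]
  simp only [Category.assoc, Iso.inv_hom_id_assoc]

lemma Sq.hcomp {U P P' : V} {W X Y Z X' Z' : C} {f : P ⟶ (W ⟶[V] X)} {s' : U ⟶ (X ⟶[V] Z)}
    {s : U ⟶ (W ⟶[V] Y)} {g : P ⟶ (Y ⟶[V] Z)} (h : Sq f s' s g) {f' : P' ⟶ (X ⟶[V] X')}
    {s'' : U ⟶ (X' ⟶[V] Z')} {g' : P' ⟶ (Z ⟶[V] Z')} (h' : Sq f' s'' s' g') :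
    Sq (gcomp f f') s'' s (gcomp g g') := by
  have h1 : gcomp s (gcomp g g') = (α_ _ _ _).inv ≫ gcomp (gcomp s g) g' := by
    rw [gcomp_assoc, Iso.inv_hom_id_assoc]
  have h2 : gcomp f (gcomp s' g') = (α_ _ _ _).inv ≫ gcomp (gcomp f s') g' := by
    rw [gcomp_assoc, Iso.inv_hom_id_assoc]
  rw [Sq, gcomp_assoc, h', ← whisker_gcomp, h1, h2, h, ← gcomp_whisker,
    BraidedCategory.braiding_tensor_left_hom]
  simp only [Category.assoc, Iso.hom_inv_id_assoc]

lemma IsNatural.precomp {F G : EnrichedFunctor V C D} {U U' : V}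
    {s : ∀ c, U ⟶ (F.obj c ⟶[V] G.obj c)} (h : IsNatural F G s) (f : U' ⟶ U) :
    IsNatural F G fun c => f ≫ s c := by
  intro c c'
  rw [← whisker_gcomp, h, ← gcomp_whisker, BraidedCategory.braiding_naturality_right_assoc]

lemma IsNatural.comp {F G H : EnrichedFunctor V C D} {U U' : V}
    {s : ∀ c, U ⟶ (F.obj c ⟶[V] G.obj c)} {t : ∀ c, U' ⟶ (G.obj c ⟶[V] H.obj c)}
    (hs : IsNatural F G s) (ht : IsNatural G H t) :
    IsNatural F H fun c => gcomp (s c) (t c) :=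
  fun c c' => Sq.vcomp (hs c c') (ht c c')

lemma IsNatural.whiskerLeft {F G : EnrichedFunctor V C D} {U : V}
    {s : ∀ c, U ⟶ (F.obj c ⟶[V] G.obj c)} (h : IsNatural F G s) (H : EnrichedFunctor V C' C) :
    IsNatural (H.comp V F) (H.comp V G) fun c => s (H.obj c) := fun c c' => by
  have := Sq.precomp (h (H.obj c) (H.obj c')) (𝟙 _) (H.map c c')
  rwa [Category.id_comp, Category.id_comp] at this

lemma IsNatural.whiskerRight {F G : EnrichedFunctor V C D} {U : V}
    {s : ∀ c, U ⟶ (F.obj c ⟶[V] G.obj c)} (h : IsNatural F G s) (H : EnrichedFunctor V D E) :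
    IsNatural (F.comp V H) (G.comp V H) fun c => s c ≫ H.map (F.obj c) (G.obj c) :=
  fun c c' => Sq.map (h c c') H

/-- `V`-naturality only depends on the action of the `V`-functors on objects and hom-objects. -/
lemma IsNatural.congr {oF oG : C → D}
    {mF mF' : ∀ c c', (c ⟶[V] c') ⟶ (oF c ⟶[V] oF c')}
    {mG mG' : ∀ c c', (c ⟶[V] c') ⟶ (oG c ⟶[V] oG c')} {i₁ c₁ i₂ c₂ i₃ c₃ i₄ c₄} {U : V}
    {s : ∀ c, U ⟶ (oF c ⟶[V] oG c)}
    (h : IsNatural (⟨oF, mF, i₁, c₁⟩ : EnrichedFunctor V C D) ⟨oG, mG, i₂, c₂⟩ s)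
    (hF : ∀ c c', mF' c c' = mF c c') (hG : ∀ c c', mG' c c' = mG c c') :
    IsNatural (⟨oF, mF', i₃, c₃⟩ : EnrichedFunctor V C D) ⟨oG, mG', i₄, c₄⟩ s := by
  intro c c'
  have := h c c'
  dsimp only at this ⊢
  rw [hF, hG, this]

lemma isNatural_unit_iff {F G : EnrichedFunctor V C D} {s : ∀ c, 𝟙_ V ⟶ (F.obj c ⟶[V] G.obj c)} :
    IsNatural F G s ↔ ∀ c c', F.map c c' ≫ post (s c') = G.map c c' ≫ pre (s c) := by
  refine forall₂_congr fun c c' => ?_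
  rw [gcomp_unit_right, gcomp_unit_left, braiding_tensorUnit_right, Category.assoc,
    Iso.inv_hom_id_assoc, cancel_epi]

/-- The naturality of composites with a `V`-natural family of morphisms. -/
lemma IsNatural.post {F G H : EnrichedFunctor V C D} {U : V}
    {s : ∀ c, U ⟶ (F.obj c ⟶[V] G.obj c)} (hs : IsNatural F G s)
    {t : ∀ c, 𝟙_ V ⟶ (G.obj c ⟶[V] H.obj c)} (ht : IsNatural G H t) :
    IsNatural F H fun c => s c ≫ post (t c) := by
  have := (IsNatural.comp hs ht).precomp (ρ_ U).inv
  simpa only [comp_post] using this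

/-- The naturality of composites with a `V`-natural family of morphisms. -/
lemma IsNatural.pre {F G H : EnrichedFunctor V C D} {U : V}
    {s : ∀ c, U ⟶ (G.obj c ⟶[V] H.obj c)} (hs : IsNatural G H s)
    {t : ∀ c, 𝟙_ V ⟶ (F.obj c ⟶[V] G.obj c)} (ht : IsNatural F G t) :
    IsNatural F H fun c => s c ≫ pre (t c) := by
  have := (IsNatural.comp ht hs).precomp (λ_ U).inv
  simpa only [comp_pre] using this

/-- In C ⊗ D the pair (f, g) is (f, 1) followed by (1, g), and F preserves this composite. The
interchange involves only the braiding of two units, which is trivial. -/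
lemma tensor_map_eq (F : EnrichedFunctor V (TensorObj C D) E) (c c' : C) (d d' : D) :
    F.map ⟨c, d⟩ ⟨c', d'⟩ = gcomp ((fixRight F d).map c c') ((fixLeft F c').map d d') := by
  refine Eq.trans ?_ (gcomp_map F _ _)
  refine (Category.id_comp _).symm.trans (congrArg (fun t => t ≫ F.map ⟨c, d⟩ ⟨c', d'⟩) ?_)
  symm
  refine (tensor_gcomp _ _ _ _).symm.trans ((congrArg (fun t => _ ≫ t)
      (tensor_gcomp_tensor (p := (⟨c, d⟩ : TensorObj C D)) (q := ⟨c', d⟩) (r := ⟨c', d'⟩)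
        _ _ _ _)).trans ?_)
  rw [gcomp_eId, eId_gcomp, Category.comp_id, Category.comp_id, tensorμ_unit_aux']
  rfl

/-- The square for (f, g) is the horizontal pasting of the square in the first variable with the
square in the second, so naturality can be checked one variable at a time. -/
lemma isNatural_of_partial {F G : EnrichedFunctor V (TensorObj C D) E} {U : V}
    {s : ∀ p, U ⟶ (F.obj p ⟶[V] G.obj p)}
    (h₁ : ∀ d, IsNatural (fixRight F d) (fixRight G d) fun c => s ⟨c, d⟩)
    (h₂ : ∀ c, IsNatural (fixLeft F c) (fixLeft G c) fun d => s ⟨c, d⟩) : IsNatural F G s := by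
  rintro ⟨c, d⟩ ⟨c', d'⟩
  have := Sq.hcomp (h₁ d c c') (h₂ c' d d')
  rw [tensor_map_eq F, tensor_map_eq G]
  exact this

end natural

/-! ### Exchange of variables and products of natural families -/

section symmetric
variable [SymmetricCategory V]
variable {C : Type u₁} [EnrichedCategory V C] {D : Type u₂} [EnrichedCategory V D]
  {E : Type u₃} [EnrichedCategory V E] {C' : Type u₄} [EnrichedCategory V C']
  {D' : Type u₅} [EnrichedCategory V D']

/-- The symmetry of V is used here, not only a braiding: the crossing of C with B is replaced by the
inverse of the crossing of B with C. This makes the exchange C ⊗ D ⟶ D ⊗ C compatible with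
composition. -/
lemma tensorμ_braiding (A B C D : V) :
    tensorμ A B C D ≫ (β_ (A ⊗ C) (B ⊗ D)).hom =
      ((β_ A B).hom ⊗ₘ (β_ C D).hom) ≫ tensorμ B A D C := by
  simp [tensorμ, SymmetricCategory.braiding_swap_eq_inv_braiding C B, MonoidalCategory.tensorHom_def]

lemma braiding_tensorμ (A B C D : V) :
    (β_ (A ⊗ B) (C ⊗ D)).hom ≫ tensorμ C D A B =
      tensorμ A B C D ≫ ((β_ A C).hom ⊗ₘ (β_ B D).hom) := by
  simp [tensorμ, SymmetricCategory.braiding_swap_eq_inv_braiding A D, MonoidalCategory.tensorHom_def]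

/-- The symmetry `C ⊗ D ⟶ D ⊗ C`. -/
def swapFunctor (C : Type u₁) [EnrichedCategory V C] (D : Type u₂) [EnrichedCategory V D] :
    EnrichedFunctor V (TensorObj C D) (TensorObj D C) where
  obj p := ⟨p.snd, p.fst⟩
  map _ _ := (β_ _ _).hom
  map_id p := by
    rw [tensor_eId, Category.assoc, BraidedCategory.braiding_naturality,
      braiding_tensorUnit_left, unitors_equal, Category.assoc, Iso.hom_inv_id_assoc]
    rfl
  map_comp p q r := by
    rw [tensor_eComp, Category.assoc, BraidedCategory.braiding_naturality,
      ← Category.assoc, tensorμ_braiding, Category.assoc]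
    rfl

lemma Sq.prod {U P U' P' : V} {p q r t : TensorObj C D} {f : P ⟶ (p.fst ⟶[V] q.fst)}
    {s' : U ⟶ (q.fst ⟶[V] t.fst)} {s : U ⟶ (p.fst ⟶[V] r.fst)} {g : P ⟶ (r.fst ⟶[V] t.fst)}
    {f₂ : P' ⟶ (p.snd ⟶[V] q.snd)} {s₂' : U' ⟶ (q.snd ⟶[V] t.snd)}
    {s₂ : U' ⟶ (p.snd ⟶[V] r.snd)} {g₂ : P' ⟶ (r.snd ⟶[V] t.snd)}
    (h : Sq f s' s g) (h₂ : Sq f₂ s₂' s₂ g₂) :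
    Sq (C := TensorObj C D) (W := p) (X := q) (Y := r) (Z := t) (f ⊗ₘ f₂) (s' ⊗ₘ s₂') (s ⊗ₘ s₂)
      (g ⊗ₘ g₂) := by
  refine (tensor_gcomp_tensor _ _ _ _).trans
    (Eq.trans ?_ (congrArg (fun t => _ ≫ t) (tensor_gcomp_tensor _ _ _ _).symm))
  rw [h, h₂, ← tensorHom_comp_tensorHom, ← Category.assoc, ← braiding_tensorμ, Category.assoc]

lemma IsNatural.prod {F G : EnrichedFunctor V C D} {F' G' : EnrichedFunctor V C' D'} {U U' : V}
    {s : ∀ c, U ⟶ (F.obj c ⟶[V] G.obj c)} (hs : IsNatural F G s)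
    {t : ∀ c, U' ⟶ (F'.obj c ⟶[V] G'.obj c)} (ht : IsNatural F' G' t) :
    IsNatural (prodFunctor F F') (prodFunctor G G') fun p => s p.fst ⊗ₘ t p.snd :=
  fun p q => Sq.prod (hs p.fst q.fst) (ht p.snd q.snd)

end symmetric

/-! ### V as a category enriched over itself -/

section closed
variable [SymmetricCategory V] [MonoidalClosed V]

/-- Currying, with values in the hom-object of the `V`-category `V`. -/
def cur {X U Y : V} (f : X ⊗ U ⟶ Y) : U ⟶ EnrichedCategory.Hom X Y := MonoidalClosed.curry f

/-- Uncurrying, for the hom-object of the `V`-category `V`. -/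
def unc {X U Y : V} (f : U ⟶ EnrichedCategory.Hom X Y) : X ⊗ U ⟶ Y := MonoidalClosed.uncurry f

@[simp]
lemma unc_cur {X U Y : V} (f : X ⊗ U ⟶ Y) : unc (cur f) = f := MonoidalClosed.uncurry_curry f

@[simp]
lemma cur_unc {X U Y : V} (f : U ⟶ EnrichedCategory.Hom X Y) : cur (unc f) = f := MonoidalClosed.curry_uncurry f

lemma unc_injective {X U Y : V} {f g : U ⟶ EnrichedCategory.Hom X Y} (h : unc f = unc g) : f = g :=
  MonoidalClosed.uncurry_injective h

lemma unc_comp {X U U' Y : V} (f : U' ⟶ U) (g : U ⟶ EnrichedCategory.Hom X Y) :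
    unc (f ≫ g) = X ◁ f ≫ unc g := MonoidalClosed.uncurry_natural_left f g

lemma comp_cur {X U U' Y : V} (f : U' ⟶ U) (g : X ⊗ U ⟶ Y) :
    f ≫ cur g = cur (X ◁ f ≫ g) := (MonoidalClosed.curry_natural_left f g).symm

lemma unc_gcomp {U U' X Y Z : V} (f : U ⟶ EnrichedCategory.Hom X Y) (g : U' ⟶ EnrichedCategory.Hom Y Z) :
    unc (gcomp f g) = (α_ X U U').inv ≫ unc f ▷ U' ≫ unc g :=
  uncurry_gcomp f g

lemma unc_eId (X : V) : unc (eId V X) = (ρ_ X).hom := MonoidalClosed.uncurry_curry _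

lemma sq_iff_unc {U P W X Y Z : V} {f : P ⟶ EnrichedCategory.Hom W X} {s' : U ⟶ EnrichedCategory.Hom X Z}
    {s : U ⟶ EnrichedCategory.Hom W Y} {g : P ⟶ EnrichedCategory.Hom Y Z} :
    Sq f s' s g ↔ (α_ _ _ _).inv ≫ unc f ▷ U ≫ unc s' =
      W ◁ (β_ _ _).hom ≫ (α_ _ _ _).inv ≫ unc s ▷ P ≫ unc g := by
  rw [Sq, ← unc_gcomp, ← unc_gcomp, ← unc_comp]
  exact ⟨congrArg _, unc_injective⟩

lemma sq_cur {U P W X Y Z : V} {f : W ⊗ P ⟶ X} {s' : X ⊗ U ⟶ Z} {s : W ⊗ U ⟶ Y}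
    {g : Y ⊗ P ⟶ Z}
    (h : (α_ _ _ _).inv ≫ f ▷ U ≫ s' = W ◁ (β_ _ _).hom ≫ (α_ _ _ _).inv ≫ s ▷ P ≫ g) :
    Sq (cur f) (cur s') (cur s) (cur g) :=
  sq_iff_unc.mpr (by simpa only [unc_cur] using h)

/-- A morphism of `V` as a morphism of the underlying category of the `V`-category `V`. -/
def elt {X Y : V} (f : X ⟶ Y) : 𝟙_ V ⟶ EnrichedCategory.Hom X Y := cur ((ρ_ X).hom ≫ f)

/-- A morphism of the underlying category of the `V`-category `V` as a morphism of `V`. -/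
def mor {X Y : V} (f : 𝟙_ V ⟶ EnrichedCategory.Hom X Y) : X ⟶ Y := (ρ_ X).inv ≫ unc f

@[simp]
lemma mor_elt {X Y : V} (f : X ⟶ Y) : mor (elt f) = f := by simp [mor, elt]

@[simp]
lemma elt_mor {X Y : V} (f : 𝟙_ V ⟶ EnrichedCategory.Hom X Y) : elt (mor f) = f := by simp [mor, elt]

lemma mor_injective {X Y : V} {f g : 𝟙_ V ⟶ EnrichedCategory.Hom X Y} (h : mor f = mor g) : f = g := by
  rw [← elt_mor f, h, elt_mor]

lemma unc_post {U X Y Z : V} (f : U ⟶ EnrichedCategory.Hom X Y) (g : 𝟙_ V ⟶ EnrichedCategory.Hom Y Z) :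
    unc (f ≫ post g) = unc f ≫ mor g := by
  rw [comp_post, unc_comp, unc_gcomp, mor]
  simp

lemma unc_pre {U X Y Z : V} (f : 𝟙_ V ⟶ EnrichedCategory.Hom X Y) (g : U ⟶ EnrichedCategory.Hom Y Z) :
    unc (g ≫ pre f) = mor f ▷ U ≫ unc g := by
  rw [comp_pre, unc_comp, unc_gcomp, mor]
  simp

lemma mor_comp {X Y Z : V} (f : 𝟙_ V ⟶ EnrichedCategory.Hom X Y) (g : 𝟙_ V ⟶ EnrichedCategory.Hom Y Z) :
    mor (f ≫ post g) = mor f ≫ mor g := by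
  simp only [mor, unc_post, Category.assoc]

@[simp]
lemma mor_eId (X : V) : mor (eId V X) = 𝟙 X := by rw [mor, unc_eId, Iso.inv_hom_id]

end closed

/-! ### Universal objects depending on a parameter form a V-functor -/

section parametrized
variable {B : Type u₁} [EnrichedCategory V B] {K : Type u₂} [EnrichedCategory V K] {ι : Type u₃}

/-- A family of objects `Z b`, each with a jointly epimorphic family of morphisms from the values at
`b` of `V`-functors `D i`, is the object part of a `V`-functor. -/
def paramFunctor (D : ι → EnrichedFunctor V B K) (Z : B → K)
    (ω : ∀ i b, 𝟙_ V ⟶ ((D i).obj b ⟶[V] Z b))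
    (hext : ∀ (b : B) {U : V} {Y : K} (g g' : U ⟶ (Z b ⟶[V] Y)),
      (∀ i, g ≫ pre (ω i b) = g' ≫ pre (ω i b)) → g = g')
    (hex : ∀ b b', ∃ g : (b ⟶[V] b') ⟶ (Z b ⟶[V] Z b'),
      ∀ i, g ≫ pre (ω i b) = (D i).map b b' ≫ post (ω i b')) : EnrichedFunctor V B K where
  obj := Z
  -- By `hext` the chosen element is the only one, so both functor laws may be tested after
  -- precomposition with every `ω i b`, where they become the laws of `D i`.
  map b b' := (hex b b').choose
  map_id b := hext _ _ _ fun i => by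
    rw [Category.assoc, (hex b b).choose_spec, EnrichedFunctor.map_id_assoc, eId_post, eId_pre]
  map_comp b b' b'' := hext _ _ _ fun i => by
    have h (X Y Z W : K) {U U' : V} (f : U ⟶ (X ⟶[V] Y)) (g : U' ⟶ (Y ⟶[V] Z)) :
      (f ⊗ₘ g) ≫ eComp V X Y Z = gcomp f g := rfl
    rw [Category.assoc, (hex b b'').choose_spec, EnrichedFunctor.map_comp_assoc,
      h _ _ _ (Z b''), ← Category.assoc, h _ _ _ (Z b''), ← gcomp_post,
      ← (hex b' b'').choose_spec, ← gcomp_post_left, ← (hex b b').choose_spec, gcomp_pre]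

lemma paramFunctor_natural [BraidedCategory V] (D : ι → EnrichedFunctor V B K) (Z : B → K)
    (ω : ∀ i b, 𝟙_ V ⟶ ((D i).obj b ⟶[V] Z b))
    (hext : ∀ (b : B) {U : V} {Y : K} (g g' : U ⟶ (Z b ⟶[V] Y)),
      (∀ i, g ≫ pre (ω i b) = g' ≫ pre (ω i b)) → g = g')
    (hex : ∀ b b', ∃ g : (b ⟶[V] b') ⟶ (Z b ⟶[V] Z b'),
      ∀ i, g ≫ pre (ω i b) = (D i).map b b' ≫ post (ω i b')) (i : ι) :
    IsNatural (D i) (paramFunctor D Z ω hext hex) (ω i) :=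
  isNatural_unit_iff.mpr fun b b' => ((hex b b').choose_spec i).symm

end parametrized

/-! ### Cowedges and coends -/

section cowedge
variable [BraidedCategory V] {C : Type u₁} [EnrichedCategory V C] {K : Type u₂}
  [EnrichedCategory V K]

lemma Cowedge.condition_post {T : EnrichedFunctor V (TensorObj Cᵒᵖ C) K} {Y : K}
    (ω : Cowedge T (𝟙_ V) Y) (c c' : C) :
    (fixLeft T (op c')).map c c' ≫ post (ω.app c') =
      (fixRight T c).map (op c') (op c) ≫ post (ω.app c) := by
  exact (cancel_epi _).mp ((gcomp_unit_right _ _).symm.trans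
    ((ω.condition c c').trans (gcomp_unit_right _ _)))

/-- Cowedges can be precomposed with `V`-natural families. -/
def Cowedge.precomp {T T' : EnrichedFunctor V (TensorObj Cᵒᵖ C) K} {U : V}
    {s : ∀ p, U ⟶ (T.obj p ⟶[V] T'.obj p)} (hs : IsNatural T T' s) {Y : K}
    (ω : Cowedge T' (𝟙_ V) Y) : Cowedge T U Y where
  app c := s ⟨op c, c⟩ ≫ post (ω.app c)
  condition c c' := by
    have h₁ : Sq _ _ _ _ := hs.whiskerLeft (insertLeft C (op c')) c c'
    have h₂ : Sq _ _ _ _ := hs.whiskerLeft (insertRight Cᵒᵖ c) (op c') (op c)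
    have h₃ := ω.condition_post c c'
    refine (gcomp_post _ _ _).trans (Eq.trans ?_ (gcomp_post _ _ _).symm)
    refine (congrArg (fun t => t ≫ post (ω.app c')) h₁).trans
      (Eq.trans ?_ (congrArg (fun t => t ≫ post (ω.app c)) h₂).symm)
    refine (Category.assoc _ _ _).trans (Eq.trans (congrArg (fun t => _ ≫ t) ?_)
      (Category.assoc _ _ _).symm)
    refine (gcomp_post _ _ _).symm.trans (Eq.trans (congrArg (fun t => gcomp _ t) ?_)
      (gcomp_post _ _ _))
    exact h₃

/-- The family `g ≫ pre (ω.app c)` is itself a cowedge of shape U, and both `g` and `g'` factor it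
through ω, so uniqueness in the universal property applies. -/
lemma Cowedge.IsCoend.hom_ext {T : EnrichedFunctor V (TensorObj Cᵒᵖ C) K} {Z Y : K}
    {ω : Cowedge T (𝟙_ V) Z} (h : ω.IsCoend) {U : V} {g g' : U ⟶ (Z ⟶[V] Y)}
    (e : ∀ c, g ≫ pre (ω.app c) = g' ≫ pre (ω.app c)) : g = g' := by
  have cond (c c' : C) : gcomp ((fixLeft T (op c')).map c c') (g ≫ pre (ω.app c')) =
      gcomp ((fixRight T c).map (op c') (op c)) (g ≫ pre (ω.app c)) := by
    refine (gcomp_post_left _ _ _).symm.trans (Eq.trans ?_ (gcomp_post_left _ _ _))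
    exact congrArg (fun t => gcomp t g) (ω.condition_post c c')
  refine (h U Y ⟨fun c => g ≫ pre (ω.app c), cond⟩).unique (fun c => ?_) (fun c => ?_)
  · exact (comp_pre _ _).symm
  · exact (comp_pre _ _).symm.trans (e c).symm

lemma Cowedge.IsCoend.exists_desc {T : EnrichedFunctor V (TensorObj Cᵒᵖ C) K} {Z Y : K}
    {ω : Cowedge T (𝟙_ V) Z} (h : ω.IsCoend) {U : V} (φ : Cowedge T U Y) :
    ∃ g : U ⟶ (Z ⟶[V] Y), ∀ c, g ≫ pre (ω.app c) = φ.app c := by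
  obtain ⟨g, hg, -⟩ := h U Y φ
  exact ⟨g, fun c => (comp_pre _ _).trans (hg c)⟩

end cowedge

/-! ### The convolution as a V-functor -/

section existence
variable [SymmetricCategory V] [MonoidalClosed V] [HasLimits V]
variable {A : Type w} [EnrichedCategory V A] (m : MonoidalStructure V A)
variable {K : Type u₁} [EnrichedCategory V K] (P : Copowers V K)

lemma rep_natural_aux {C : Type u₂} [EnrichedCategory V C] (a' a x y : C) :
    (α_ _ _ _).inv ≫ ((β_ _ _).hom ≫ eComp V a' a x) ▷ (x ⟶[V] y) ≫ eComp V a' x y =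
      (a ⟶[V] x) ◁ (β_ _ _).hom ≫ (α_ _ _ _).inv ≫ eComp V a x y ▷ (a' ⟶[V] a) ≫
        (β_ _ _).hom ≫ eComp V a' a y := by
  rw [BraidedCategory.braiding_naturality_left_assoc, ← e_assoc, comp_whiskerRight]
  simp [SymmetricCategory.braiding_swap_eq_inv_braiding (x ⟶[V] y), e_assoc']

/-- Postcomposition along x ⟶ y commutes with precomposition along a' ⟶ a; this is associativity of
composition in C with the variables permuted. -/
lemma rep_natural {C : Type u₂} [EnrichedCategory V C] (x y : C) :
    IsNatural (rep x : EnrichedFunctor V Cᵒᵖ V) (rep y) fun a : Cᵒᵖ => (corep a.unop).map x y :=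
  fun a a' => sq_cur (rep_natural_aux a'.unop a.unop x y)

/-- The `V`-functor `(x, (F, X)) ↦ (A(m(a, b), x) ⊗ F(a')) ⊙ X(b')`. -/
def jointIntegrand (p : TensorObj (TensorObj A A)ᵒᵖ (TensorObj A A)) :
    EnrichedFunctor V
      (TensorObj A (TensorObj (EnrichedFunctor V A V) (EnrichedFunctor V A K))) K :=
  (prodFunctor (corep (m.tensor.obj p.fst.unop))
    (prodFunctor (evalFunctor V p.snd.fst) (evalFunctor K p.snd.snd))).comp V
    ((assocInvFunctor V V K).comp V
      ((prodFunctor (selfCopowers V).functor (EnrichedFunctor.id V K)).comp V P.functor))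

/-- The three parameters x, F and X vary together, so that a single application of `paramFunctor`
yields both the V-functor F * X in x and its functoriality in (F, X). Naturality in the integration
variables is what lets cowedges be pulled back along a change of parameters. -/
lemma jointIntegrand_natural (x x' : A) (F F' : EnrichedFunctor V A V)
    (X X' : EnrichedFunctor V A K) :
    IsNatural (integrand m P F X x) (integrand m P F' X' x')
      fun p => (jointIntegrand m P p).map ⟨x, ⟨F, X⟩⟩ ⟨x', ⟨F', X'⟩⟩ :=
  (((rep_natural x x').whiskerLeft (opFunctor m.tensor)).prod
    ((natπ_natural F F').prod (natπ_natural X X'))).whiskerRight _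

end existence

section existence
variable [SymmetricCategory V] [MonoidalClosed V] [HasLimits V]
variable {A : Type w} [EnrichedCategory V A] (m : MonoidalStructure V A)
variable {K : Type u₁} [EnrichedCategory V K] (P : Copowers V K)
variable (hK : ∀ (F : EnrichedFunctor V A V) (X : EnrichedFunctor V A K) (x : A),
  HasCoend (integrand m P F X x))

/-- A chosen coend `∫^{a, b} (A(m(a, b), x) ⊗ F(a)) ⊙ X(b)`. -/
def convObj (F : EnrichedFunctor V A V) (X : EnrichedFunctor V A K) (x : A) : K :=
  (hK F X x).choose

/-- The universal cowedge of the chosen coend. -/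
def convCowedge (F : EnrichedFunctor V A V) (X : EnrichedFunctor V A K) (x : A) :
    Cowedge (integrand m P F X x) (𝟙_ V) (convObj m P hK F X x) :=
  (hK F X x).choose_spec.choose

lemma convCowedge_isCoend (F : EnrichedFunctor V A V) (X : EnrichedFunctor V A K) (x : A) :
    (convCowedge m P hK F X x).IsCoend :=
  (hK F X x).choose_spec.choose_spec

/-- The `V`-functor `(x, (F, X)) ↦ (F * X)(x)`. -/
def jointConv : EnrichedFunctor V
    (TensorObj A (TensorObj (EnrichedFunctor V A V) (EnrichedFunctor V A K))) K :=
  paramFunctor (ι := TensorObj A A) (fun c => jointIntegrand m P ⟨op c, c⟩)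
    (fun b => convObj m P hK b.snd.fst b.snd.snd b.fst)
    (fun c b => (convCowedge m P hK b.snd.fst b.snd.snd b.fst).app c)
    (fun b _ _ _ _ h => (convCowedge_isCoend m P hK b.snd.fst b.snd.snd b.fst).hom_ext h)
    (fun b b' => (convCowedge_isCoend m P hK b.snd.fst b.snd.snd b.fst).exists_desc
      (Cowedge.precomp (jointIntegrand_natural m P b.fst b'.fst b.snd.fst b'.snd.fst b.snd.snd
        b'.snd.snd) (convCowedge m P hK b'.snd.fst b'.snd.snd b'.fst)))

lemma jointConv_natural (c : TensorObj A A) :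
    IsNatural (jointIntegrand m P ⟨op c, c⟩) (jointConv m P hK)
      fun b => (convCowedge m P hK b.snd.fst b.snd.snd b.fst).app c :=
  paramFunctor_natural (ι := TensorObj A A) (fun c => jointIntegrand m P ⟨op c, c⟩) _
    (fun c b => (convCowedge m P hK b.snd.fst b.snd.snd b.fst).app c) _ _ c

/-- The `V`-functor `(F, X) ↦ F * X`. -/
def convFunctor :
    EnrichedFunctor V (TensorObj (EnrichedFunctor V A V) (EnrichedFunctor V A K))
      (EnrichedFunctor V A K) :=
  curryFunctor ((swapFunctor _ A).comp V (jointConv m P hK))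

lemma insertLeft_swap_aux {M N Q : V} (e : 𝟙_ V ⟶ N) (f : M ⊗ N ⟶ Q) :
    ((λ_ M).inv ≫ (e ⊗ₘ 𝟙 M)) ≫ (β_ N M).hom ≫ f = ((ρ_ M).inv ≫ (𝟙 M ⊗ₘ e)) ≫ f := by
  rw [Category.assoc, BraidedCategory.braiding_naturality_assoc, braiding_tensorUnit_left]
  simp

lemma insertRight_swap_aux {M N Q : V} (e : 𝟙_ V ⟶ N) (f : N ⊗ M ⟶ Q) :
    ((ρ_ M).inv ≫ (𝟙 M ⊗ₘ e)) ≫ (β_ M N).hom ≫ f = ((λ_ M).inv ≫ (e ⊗ₘ 𝟙 M)) ≫ f := by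
  rw [Category.assoc, BraidedCategory.braiding_naturality_assoc, braiding_tensorUnit_right]
  simp

/-- Compares two actions on hom-objects that agree only up to coherence: inserting the identities of
V-functors and then evaluating them, as `jointIntegrand` does, and inserting the identities of the
values, as `integrandFunctor` does. The next lemma is the analogue with the first variable held
fixed. -/
lemma integrandFunctor_aux {M H G G' L L' N Q : V} (c : M ⟶ H) (e : 𝟙_ V ⟶ G) (e' : 𝟙_ V ⟶ L)
    (eG : 𝟙_ V ⟶ G') (eL : 𝟙_ V ⟶ L') (pG : G' ⟶ G) (pL : L' ⟶ L) (hG : eG ≫ pG = e)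
    (hL : eL ≫ pL = e') (cop : H ⊗ G ⟶ N) (f : N ⊗ L ⟶ Q) :
    c ≫ (((ρ_ _).inv ≫ (𝟙 _ ⊗ₘ e)) ≫ cop) ≫ ((ρ_ _).inv ≫ (𝟙 _ ⊗ₘ e')) ≫ f =
      ((ρ_ _).inv ≫ (𝟙 _ ⊗ₘ ((λ_ (𝟙_ V)).inv ≫ (eG ⊗ₘ eL)))) ≫ (c ⊗ₘ (pG ⊗ₘ pL)) ≫
        (α_ _ _ _).inv ≫ (cop ⊗ₘ 𝟙 _) ≫ f := by
  have h : ((ρ_ M).inv ≫ (𝟙 M ⊗ₘ ((λ_ (𝟙_ V)).inv ≫ (eG ⊗ₘ eL)))) ≫ (c ⊗ₘ (pG ⊗ₘ pL)) =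
      c ≫ (ρ_ H).inv ≫ H ◁ ((λ_ (𝟙_ V)).inv ≫ (e ⊗ₘ e')) := by
    rw [Category.assoc, tensorHom_comp_tensorHom, Category.id_comp, Category.assoc,
      tensorHom_comp_tensorHom, hG, hL, MonoidalCategory.tensorHom_def,
      rightUnitor_inv_naturality_assoc]
  rw [← Category.assoc (_ ≫ _) (c ⊗ₘ _), h, tensorHom_id, id_tensorHom, id_tensorHom]
  have h₂ : cop ≫ (ρ_ N).inv ≫ N ◁ e' ≫ f = (ρ_ _).inv ≫ _ ◁ e' ≫ cop ▷ L ≫ f := by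
    rw [rightUnitor_inv_naturality_assoc, whisker_exchange_assoc]
  simp only [Category.assoc, MonoidalCategory.whiskerLeft_comp]
  rw [h₂, MonoidalCategory.tensorHom_def]
  simp

lemma integrandFunctor₂_aux {M H G G' L L' N Q : V} (c : M ⟶ H) (e : 𝟙_ V ⟶ H) (e' : 𝟙_ V ⟶ M)
    (h : e' ≫ c = e) (pG : G' ⟶ G) (pL : L' ⟶ L) (cop : H ⊗ G ⟶ N) (f : N ⊗ L ⟶ Q) :
    (pG ⊗ₘ pL) ≫ ((((λ_ _).inv ≫ (e ⊗ₘ 𝟙 _)) ≫ cop) ⊗ₘ 𝟙 _) ≫ f =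
      ((λ_ _).inv ≫ (e' ⊗ₘ 𝟙 _)) ≫ (c ⊗ₘ (pG ⊗ₘ pL)) ≫
        (α_ _ _ _).inv ≫ (cop ⊗ₘ 𝟙 _) ≫ f := by
  have h' : ((λ_ _).inv ≫ (e' ⊗ₘ 𝟙 _)) ≫ (c ⊗ₘ (pG ⊗ₘ pL)) =
      (pG ⊗ₘ pL) ≫ (λ_ _).inv ≫ e ▷ _ := by
    rw [Category.assoc, tensorHom_comp_tensorHom, Category.id_comp, h,
      MonoidalCategory.tensorHom_def', leftUnitor_inv_naturality_assoc]
  rw [← Category.assoc (_ ≫ _) (c ⊗ₘ _), h']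
  simp

/-- The convolution, with its universal cowedges. -/
def convolution : Convolution m P (convFunctor m P hK) where
  ι F X x := convCowedge m P hK F X x
  isCoend F X x := convCowedge_isCoend m P hK F X x
  -- Both naturality conditions are the joint one restricted along an insertion functor;
  -- `IsNatural.congr` then replaces the actions on hom-objects by the equal ones in the definition
  -- of `Convolution`.
  natural F X a b := ((jointConv_natural m P hK ⟨a, b⟩).whiskerLeft
      (insertRight A (⟨F, X⟩ : TensorObj (EnrichedFunctor V A V) (EnrichedFunctor V A K)))).congr
    (fun _ _ => integrandFunctor_aux _ _ _ _ _ _ _ (functorCategory_eId_π F a)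
      (functorCategory_eId_π X b) _ _)
    (fun _ _ => insertLeft_swap_aux _ _)
  natural₂ x a b := ((jointConv_natural m P hK ⟨a, b⟩).whiskerLeft
      (insertLeft (TensorObj (EnrichedFunctor V A V) (EnrichedFunctor V A K)) x)).congr
    (fun _ _ => integrandFunctor₂_aux _ _ _ ((corep _).map_id x) _ _ _ _)
    (fun _ _ => (natLift_π _ _ _ (curryApp_natural _ _ _) _).trans (insertRight_swap_aux _ _))

end existence

/-! ### Existence of small coends in V -/

section coends
variable [SymmetricCategory V] [MonoidalClosed V] [HasLimits V] [HasColimits V]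
variable {C : Type w} [EnrichedCategory V C]

/-- The covariant action. -/
def coendLeft (T : EnrichedFunctor V (TensorObj Cᵒᵖ C) V) (c c' : C) :
    T.obj ⟨op c', c⟩ ⊗ (c ⟶[V] c') ⟶ T.obj ⟨op c', c'⟩ :=
  unc ((fixLeft T (op c')).map c c')

/-- The contravariant action. -/
def coendRight (T : EnrichedFunctor V (TensorObj Cᵒᵖ C) V) (c c' : C) :
    T.obj ⟨op c', c⟩ ⊗ (c ⟶[V] c') ⟶ T.obj ⟨op c, c⟩ :=
  unc ((fixRight T c).map (op c') (op c))

/-- The two morphisms whose coequalizer is the coend of `T`. -/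
def coendMaps (T : EnrichedFunctor V (TensorObj Cᵒᵖ C) V) (b : Bool) :
    (∐ fun p : C × C => T.obj ⟨op p.2, p.1⟩ ⊗ (p.1 ⟶[V] p.2)) ⟶ ∐ fun c : C => T.obj ⟨op c, c⟩ :=
  Sigma.desc fun p => bif b then coendLeft T p.1 p.2 ≫ Sigma.ι (fun c => T.obj ⟨op c, c⟩) p.2
    else coendRight T p.1 p.2 ≫ Sigma.ι (fun c => T.obj ⟨op c, c⟩) p.1

/-- The morphism from a component to the coend. -/
def coendι (T : EnrichedFunctor V (TensorObj Cᵒᵖ C) V) (c : C) :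
    T.obj ⟨op c, c⟩ ⟶ coequalizer (coendMaps T true) (coendMaps T false) :=
  Sigma.ι (fun c => T.obj ⟨op c, c⟩) c ≫ coequalizer.π _ _

lemma coendι_condition (T : EnrichedFunctor V (TensorObj Cᵒᵖ C) V) (c c' : C) :
    coendLeft T c c' ≫ coendι T c' = coendRight T c c' ≫ coendι T c := by
  have h := congrArg
    (fun t => Sigma.ι (fun p : C × C => T.obj ⟨op p.2, p.1⟩ ⊗ (p.1 ⟶[V] p.2)) (c, c') ≫ t)
    (coequalizer.condition (coendMaps T true) (coendMaps T false))
  simpa [coendMaps, coendι, Category.assoc] using h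

/-- Transposing the shape P to the other side turns an equation between generalized elements into
one between ordinary morphisms with target [P, W]. -/
lemma sq_unc_aux {U X Y Z W : V} (f : U ⟶ EnrichedCategory.Hom X Y) (g : U ⟶ EnrichedCategory.Hom X Z)
    {P : V} (φ : P ⟶ EnrichedCategory.Hom Y W) (ψ : P ⟶ EnrichedCategory.Hom Z W) (h : gcomp f φ = gcomp g ψ) :
    unc f ≫ cur ((β_ _ _).hom ≫ unc φ) = unc g ≫ cur ((β_ _ _).hom ≫ unc ψ) := by
  have h := congrArg unc h
  rw [unc_gcomp, unc_gcomp, cancel_epi] at h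
  rw [comp_cur, comp_cur, BraidedCategory.braiding_naturality_right_assoc,
    BraidedCategory.braiding_naturality_right_assoc, h]

/-- The coend is the usual coequalizer of two maps between coproducts, which exist because C is
small. This has a priori only the ordinary universal property; since V is symmetric closed, a
cowedge of shape U with vertex Y transposes to an ordinary one with vertex [U, Y], and the enriched
property follows. -/
lemma hasCoend_self (T : EnrichedFunctor V (TensorObj Cᵒᵖ C) V) : HasCoend T := by
  refine ⟨coequalizer (coendMaps T true) (coendMaps T false),
    ⟨fun c => elt (coendι T c), fun c c' => ?_⟩, fun U Y φ => ?_⟩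
  · refine (gcomp_unit_right _ _).trans (Eq.trans ?_ (gcomp_unit_right _ _).symm)
    refine congrArg _ (unc_injective ?_)
    refine (unc_post _ _).trans (Eq.trans ?_ (unc_post _ _).symm)
    exact (congrArg (fun t => _ ≫ t) (mor_elt _)).trans ((coendι_condition T c c').trans
      (congrArg (fun t => _ ≫ t) (mor_elt _)).symm)
  · have key (g : U ⟶ EnrichedCategory.Hom (coequalizer (coendMaps T true) (coendMaps T false)) Y) (c : C) :
        (λ_ U).inv ≫ gcomp (elt (coendι T c)) g = φ.app c ↔
          coendι T c ≫ cur ((β_ _ _).hom ≫ unc g) = cur ((β_ _ _).hom ≫ unc (φ.app c)) := by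
      rw [← comp_pre, comp_cur, BraidedCategory.braiding_naturality_right_assoc]
      constructor
      · intro h
        rw [← h, unc_pre, mor_elt]
      · intro h
        have h := congrArg unc h
        rw [unc_cur, unc_cur, cancel_epi] at h
        exact unc_injective (by rw [unc_pre, mor_elt, h])
    have hext {Z : V} {a b : coequalizer (coendMaps T true) (coendMaps T false) ⟶ Z}
        (h : ∀ c, coendι T c ≫ a = coendι T c ≫ b) : a = b := by
      refine coequalizer.hom_ext (Sigma.hom_ext _ _ fun c => ?_)
      simpa [coendι] using h c
    let d : coequalizer (coendMaps T true) (coendMaps T false) ⟶ EnrichedCategory.Hom U Y :=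
      coequalizer.desc (Sigma.desc fun c => cur ((β_ _ _).hom ≫ unc (φ.app c))) (by
        refine Sigma.hom_ext _ _ fun p => ?_
        have : coendLeft T p.1 p.2 ≫ cur ((β_ _ _).hom ≫ unc (φ.app p.2)) =
            coendRight T p.1 p.2 ≫ cur ((β_ _ _).hom ≫ unc (φ.app p.1)) :=
          sq_unc_aux _ _ _ _ (φ.condition p.1 p.2)
        simpa [coendMaps] using this)
    have hd (c : C) : coendι T c ≫ d = cur ((β_ _ _).hom ≫ unc (φ.app c)) := by
      simp [coendι, d]
    refine ⟨cur ((β_ _ _).hom ≫ unc d), fun c => ?_, fun g hg => ?_⟩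
    · rw [key]
      simp [hd]
    · refine unc_injective ((cancel_epi (β_ _ _).hom).mp ?_)
      have : cur ((β_ _ _).hom ≫ unc g) = d := hext fun c => by rw [hd, (key g c).mp (hg c)]
      simp [← this]

end coends

/-! ### Formulas for the copower V-functor -/

section copower
variable [SymmetricCategory V] [MonoidalClosed V] {K : Type u₁} [EnrichedCategory V K]
  (P : Copowers V K)

lemma insertRight_aux {W M N Q : V} (f : W ⟶ M) (e : 𝟙_ V ⟶ N) (g : M ⊗ N ⟶ Q) :
    f ≫ ((ρ_ M).inv ≫ (𝟙 M ⊗ₘ e)) ≫ g = (ρ_ W).inv ≫ (f ⊗ₘ e) ≫ g := by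
  rw [Category.assoc, rightUnitor_inv_naturality_assoc, ← tensorHom_id,
    tensorHom_comp_tensorHom_assoc, Category.id_comp, Category.comp_id]

lemma insertLeft_aux {W M N Q : V} (f : W ⟶ M) (e : 𝟙_ V ⟶ N) (g : N ⊗ M ⟶ Q) :
    f ≫ ((λ_ M).inv ≫ (e ⊗ₘ 𝟙 M)) ≫ g = (λ_ W).inv ≫ (e ⊗ₘ f) ≫ g := by
  rw [Category.assoc, leftUnitor_inv_naturality_assoc, ← id_tensorHom,
    tensorHom_comp_tensorHom_assoc, Category.id_comp, Category.comp_id]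

lemma unc_fixRight_self_aux {v v' w W : V} {g : (v ⊗ w) ⊗ W ⟶ v' ⊗ w} {f : v ⊗ W ⟶ v'}
    (h : (α_ _ _ _).inv ≫ (β_ w v).hom ▷ W ≫ g = w ◁ f ≫ (β_ w v').hom) :
    g = (α_ _ _ _).hom ≫ v ◁ (β_ _ _).hom ≫ (α_ _ _ _).inv ≫ f ▷ w := by
  rw [← cancel_epi ((β_ w v).hom ▷ W), ← cancel_epi (α_ w v W).inv, h,
    BraidedCategory.braiding_naturality_right]
  simp

lemma unc_fixLeft_self_aux {v w w' W : V} {g : (v ⊗ w) ⊗ W ⟶ v ⊗ w'} {f : w ⊗ W ⟶ w'}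
    (h : (α_ _ _ _).inv ≫ (β_ w v).hom ▷ W ≫ g =
      w ◁ (β_ v W).hom ≫ (α_ _ _ _).inv ≫ f ▷ v ≫ (β_ w' v).hom) :
    g = (α_ _ _ _).hom ≫ v ◁ f := by
  rw [← cancel_epi ((β_ w v).hom ▷ W), ← cancel_epi (α_ w v W).inv, h,
    BraidedCategory.braiding_naturality_left, BraidedCategory.braiding_tensor_left_hom]
  simp only [Category.assoc, Iso.inv_hom_id_assoc]
  rw [← MonoidalCategory.whiskerLeft_comp_assoc, SymmetricCategory.symmetry,
    MonoidalCategory.whiskerLeft_id, Category.id_comp]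

namespace Copowers

/-- The action of `P.functor` on hom-objects is known only through the choice made by `desc`.
Composing with the copower unit removes that choice, and by `hom_ext` nothing is lost. -/
lemma unit_functor_map {W W' v v' : V} {k k' : K} (f : W ⟶ EnrichedCategory.Hom v v')
    (g : W' ⟶ (k ⟶[V] k')) :
    gcomp (P.unit v k) ((f ⊗ₘ g) ≫ P.functor.map ⟨v, k⟩ ⟨v', k'⟩ :
        W ⊗ W' ⟶ (P.obj v k ⟶[V] P.obj v' k')) =
      (α_ _ _ _).inv ≫ unc f ▷ W' ≫ (β_ _ _).hom ≫ gcomp g (P.unit v' k') := by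
  refine (whisker_gcomp _ _ _).symm.trans ?_
  refine (congrArg (fun t => _ ≫ t) (P.unit_desc _)).trans ?_
  exact P.mapAux_comp f g

lemma unit_fixRight_map {W v v' : V} {k : K} (f : W ⟶ EnrichedCategory.Hom v v') :
    gcomp (P.unit v k) (f ≫ (fixRight P.functor k).map v v' :
      W ⟶ (P.obj v k ⟶[V] P.obj v' k)) = unc f ≫ P.unit v' k := by
  refine (congrArg (gcomp (P.unit v k)) (insertRight_aux f (eId V k)
    (P.functor.map ⟨v, k⟩ ⟨v', k⟩))).trans ?_
  refine (whisker_gcomp _ _ _).symm.trans ?_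
  refine (congrArg (fun t => _ ≫ t) (P.unit_functor_map f (eId V k))).trans ?_
  rw [eId_gcomp, braiding_leftUnitor_assoc]
  simp

lemma unit_fixLeft_map {W v : V} {k k' : K} (f : W ⟶ (k ⟶[V] k')) :
    gcomp (P.unit v k) (f ≫ (fixLeft P.functor v).map k k' :
      W ⟶ (P.obj v k ⟶[V] P.obj v k')) = (β_ _ _).hom ≫ gcomp f (P.unit v k') := by
  refine (congrArg (gcomp (P.unit v k)) (insertLeft_aux f (eId V v)
    (P.functor.map ⟨v, k⟩ ⟨v, k'⟩))).trans ?_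
  refine (whisker_gcomp _ _ _).symm.trans ?_
  refine (congrArg (fun t => _ ≫ t) (P.unit_functor_map (eId V v) f)).trans ?_
  rw [unc_eId, triangle_assoc_comp_right_assoc, ← MonoidalCategory.whiskerLeft_comp_assoc,
    Iso.inv_hom_id, MonoidalCategory.whiskerLeft_id, Category.id_comp]

lemma exists_transpose {v : V} {k y : K} (t : v ⟶ (k ⟶[V] y)) :
    ∃ φ : 𝟙_ V ⟶ (P.obj v k ⟶[V] y), P.unit v k ≫ post φ = t :=
  ⟨P.desc ((ρ_ v).hom ≫ t), by rw [comp_post, P.unit_desc, Iso.inv_hom_id_assoc]⟩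

end Copowers

/-- The unit of `selfCopowers` is the transpose of the symmetry, so the general formula carries a
braiding at either end; cancelling these leaves the expected v ⊗ f. -/
lemma unc_fixLeft_self {W w w' : V} (v : V) (f : W ⟶ EnrichedCategory.Hom w w') :
    unc (f ≫ (fixLeft (selfCopowers V).functor v).map w w' :
      W ⟶ EnrichedCategory.Hom (v ⊗ w) (v ⊗ w')) = (α_ _ _ _).hom ≫ v ◁ unc f := by
  have hu (v k : V) : unc ((selfCopowers V).unit v k) = (β_ k v).hom :=
    MonoidalClosed.uncurry_curry _
  have h := (unc_gcomp _ _).symm.trans (congrArg unc ((selfCopowers V).unit_fixLeft_map (v := v) f))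
  rw [hu, unc_comp, unc_gcomp, hu] at h
  exact unc_fixLeft_self_aux h

lemma unc_fixRight_self {W v v' : V} (w : V) (f : W ⟶ EnrichedCategory.Hom v v') :
    unc (f ≫ (fixRight (selfCopowers V).functor w).map v v' :
      W ⟶ EnrichedCategory.Hom (v ⊗ w) (v' ⊗ w)) =
      (α_ _ _ _).hom ≫ v ◁ (β_ _ _).hom ≫ (α_ _ _ _).inv ≫ unc f ▷ w := by
  have hu (v k : V) : unc ((selfCopowers V).unit v k) = (β_ k v).hom :=
    MonoidalClosed.uncurry_curry _
  have h := (unc_gcomp _ _).symm.trans (congrArg unc ((selfCopowers V).unit_fixRight_map (k := w) f))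
  rw [hu, unc_comp, hu] at h
  exact unc_fixRight_self_aux h

end copower

/-! ### Bilinear families -/

section convolution
variable [SymmetricCategory V] [MonoidalClosed V] [HasLimits V]
variable {A : Type w} [EnrichedCategory V A] (m : MonoidalStructure V A)
variable {K : Type u₁} [EnrichedCategory V K]

/-- The action of `A` on the values of a `V`-functor `A ⟶ V`. -/
def actR (F : EnrichedFunctor V A V) (a a' : A) : F.obj a ⊗ (a ⟶[V] a') ⟶ F.obj a' :=
  unc (F.map a a')

/-- The action of `Y(m(-, b))` on hom-objects. -/
def mapL (Y : EnrichedFunctor V A K) (a a' b : A) :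
    (a ⟶[V] a') ⟶ (Y.obj (m.tensor.obj ⟨a, b⟩) ⟶[V] Y.obj (m.tensor.obj ⟨a', b⟩)) :=
  (fixRight (m.tensor.comp V Y) b).map a a'

/-- The action of `Y(m(a, -))` on hom-objects. -/
def mapR (Y : EnrichedFunctor V A K) (a b b' : A) :
    (b ⟶[V] b') ⟶ (Y.obj (m.tensor.obj ⟨a, b⟩) ⟶[V] Y.obj (m.tensor.obj ⟨a, b'⟩)) :=
  (fixLeft (m.tensor.comp V Y) a).map b b'

/-- The action of `Y(m(-, -))` on hom-objects. -/
def mapB (Y : EnrichedFunctor V A K) (a a' b b' : A) :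
    (a ⟶[V] a') ⊗ (b ⟶[V] b') ⟶
      (Y.obj (m.tensor.obj ⟨a, b⟩) ⟶[V] Y.obj (m.tensor.obj ⟨a', b'⟩)) :=
  (m.tensor.comp V Y).map ⟨a, b⟩ ⟨a', b'⟩

lemma mapB_eq (Y : EnrichedFunctor V A K) (a a' b b' : A) :
    mapB m Y a a' b b' = gcomp (mapL m Y a a' b) (mapR m Y a' b b') :=
  tensor_map_eq _ _ _ _ _

lemma mapL_eq (Y : EnrichedFunctor V A K) (a a' b : A) :
    mapL m Y a a' b = (ρ_ _).inv ≫ _ ◁ eId V b ≫ mapB m Y a a' b b := by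
  rw [← id_tensorHom, ← Category.assoc]
  rfl

lemma mapR_eq (Y : EnrichedFunctor V A K) (a b b' : A) :
    mapR m Y a b b' = (λ_ _).inv ≫ eId V a ▷ _ ≫ mapB m Y a a b b' := by
  rw [← tensorHom_id, ← Category.assoc]
  rfl

/-- A family of morphisms `F(a) ⟶ K(X(b), Y(m(a, b)))` that is `V`-natural in `a` and `b`. -/
structure IsBilinear (F : EnrichedFunctor V A V) (X Y : EnrichedFunctor V A K)
    (t : ∀ a b, F.obj a ⟶ (X.obj b ⟶[V] Y.obj (m.tensor.obj ⟨a, b⟩))) : Prop where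
  left (a a' b : A) : gcomp (t a b) (mapL m Y a a' b) = actR F a a' ≫ t a' b
  right (a b b' : A) : Sq (X.map b b') (t a b') (t a b) (mapR m Y a b b')

variable {m}

/-- The action of Y(m(-,-)) on a pair is the action in the first variable followed by that in the
second, so the two conditions combine. The joint form matches the cowedge condition, whose index
category is A ⊗ A. -/
lemma IsBilinear.joint {F : EnrichedFunctor V A V} {X Y : EnrichedFunctor V A K}
    {t : ∀ a b, F.obj a ⟶ (X.obj b ⟶[V] Y.obj (m.tensor.obj ⟨a, b⟩))}
    (h : IsBilinear m F X Y t) (a a' b b' : A) :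
    gcomp (t a b) (mapB m Y a a' b b') = ((α_ _ _ _).inv ≫ actR F a a' ▷ _ ≫ (β_ _ _).hom) ≫
      gcomp (X.map b b') (t a' b') := by
  have h₁ : gcomp (t a b) (gcomp (mapL m Y a a' b) (mapR m Y a' b b')) =
      (α_ _ _ _).inv ≫ gcomp (gcomp (t a b) (mapL m Y a a' b)) (mapR m Y a' b b') := by
    rw [gcomp_assoc, Iso.inv_hom_id_assoc]
  rw [mapB_eq, h₁, h.left, ← gcomp_whisker, h.right a' b b']
  simp only [Category.assoc, SymmetricCategory.symmetry_assoc]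

/-- Specializing one of the two hom-objects of A to an identity recovers each partial condition from
the joint one. -/
lemma isBilinear_of_joint {F : EnrichedFunctor V A V} {X Y : EnrichedFunctor V A K}
    {t : ∀ a b, F.obj a ⟶ (X.obj b ⟶[V] Y.obj (m.tensor.obj ⟨a, b⟩))}
    (h : ∀ a a' b b', gcomp (t a b) (mapB m Y a a' b b') =
      ((α_ _ _ _).inv ≫ actR F a a' ▷ _ ≫ (β_ _ _).hom) ≫ gcomp (X.map b b') (t a' b')) :
    IsBilinear m F X Y t where
  left a a' b := by
    have : gcomp (t a b) (mapL m Y a a' b) = F.obj a ◁ (ρ_ _).inv ≫ F.obj a ◁ _ ◁ eId V b ≫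
        gcomp (t a b) (mapB m Y a a' b b) := by
      rw [whisker_gcomp, whisker_gcomp, mapL_eq]
    rw [this, h]
    have e : eId V b ▷ F.obj a' ≫ gcomp (X.map b b) (t a' b) = (λ_ _).hom ≫ t a' b := by
      rw [gcomp_whisker, X.map_id, eId_gcomp]
    simp only [Category.assoc]
    rw [associator_inv_naturality_right_assoc, whisker_exchange_assoc,
      BraidedCategory.braiding_naturality_right_assoc, e]
    simp
  right a b b' := by
    have : gcomp (t a b) (mapR m Y a b b') = F.obj a ◁ (λ_ _).inv ≫ F.obj a ◁ eId V a ▷ _ ≫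
        gcomp (t a b) (mapB m Y a a b b') := by
      rw [whisker_gcomp, whisker_gcomp, mapR_eq]
    have e : F.obj a ◁ eId V a ≫ actR F a a = (ρ_ _).hom := by
      rw [actR, ← unc_comp, F.map_id, unc_eId]
    rw [Sq, this, h]
    simp only [Category.assoc]
    rw [associator_inv_naturality_middle_assoc, ← comp_whiskerRight_assoc, e,
      triangle_assoc_comp_right_assoc, ← MonoidalCategory.whiskerLeft_comp_assoc,
      Iso.inv_hom_id, MonoidalCategory.whiskerLeft_id, Category.id_comp,
      SymmetricCategory.symmetry_assoc]

lemma map_eComp_eq (Y : EnrichedFunctor V A K) (x y z : A) :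
    eComp V x y z ≫ Y.map x z = gcomp (Y.map x y) (Y.map y z) := Y.map_comp x y z

end convolution

/-! ### The cowedge condition in terms of bilinear families -/

section convolution
variable [SymmetricCategory V] [MonoidalClosed V] [HasLimits V]
variable {A : Type w} [EnrichedCategory V A] {m : MonoidalStructure V A}
variable {K : Type u₁} [EnrichedCategory V K] {P : Copowers V K}

lemma perm_right_aux (v f C : V) :
    (α_ v f C).hom ≫ v ◁ (β_ f C).hom ≫ (α_ v C f).inv ≫ (β_ (v ⊗ C) f).hom ≫
      f ◁ (β_ v C).hom ≫ (α_ f C v).inv = (α_ v f C).hom ≫ (β_ v (f ⊗ C)).hom := by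
  rw [BraidedCategory.braiding_tensor_left_hom, BraidedCategory.braiding_tensor_right_hom]
  simp only [Category.assoc, Iso.inv_hom_id_assoc]
  rw [← MonoidalCategory.whiskerLeft_comp_assoc, SymmetricCategory.symmetry,
    MonoidalCategory.whiskerLeft_id, Category.id_comp]

lemma perm_left_aux {v f f' M N : V} (h : f ⊗ M ⟶ f') :
    (α_ (v ⊗ f) M N).inv ≫ ((α_ v f M).hom ≫ v ◁ h) ▷ N ≫ (β_ (v ⊗ f') N).hom ≫
      N ◁ (β_ v f').hom ≫ (α_ N f' v).inv =
    (α_ v f (M ⊗ N)).hom ≫ v ◁ ((α_ _ _ _).inv ≫ h ▷ N ≫ (β_ _ _).hom) ≫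
      (β_ v (N ⊗ f')).hom := by
  rw [BraidedCategory.braiding_tensor_left_hom, BraidedCategory.braiding_tensor_right_hom]
  monoidal

variable (m P) in
/-- The covariant action of the integrand of the convolution. -/
lemma unit_fixLeft_integrand_map (F : EnrichedFunctor V A V) (X : EnrichedFunctor V A K) (x : A)
    (a a' b b' : A) (p : TensorObj A A) :
    gcomp (P.unit ((m.tensor.obj p ⟶[V] x) ⊗ F.obj a) (X.obj b))
      ((fixLeft (integrand m P F X x) (op p)).map ⟨a, b⟩ ⟨a', b'⟩) =
      (α_ _ _ _).inv ≫ ((α_ _ _ _).hom ≫ _ ◁ actR F a a') ▷ (b ⟶[V] b') ≫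
        (β_ _ _).hom ≫ gcomp (X.map b b')
          (P.unit ((m.tensor.obj p ⟶[V] x) ⊗ F.obj a') (X.obj b')) := by
  let v : V := (m.tensor.obj p ⟶[V] x)
  let φ : (a ⟶[V] a') ⟶ EnrichedCategory.Hom (v ⊗ F.obj a) (v ⊗ F.obj a') :=
    F.map a a' ≫ (fixLeft (selfCopowers V).functor v).map (F.obj a) (F.obj a')
  have hφ : unc φ = (α_ _ _ _).hom ≫ v ◁ actR F a a' := unc_fixLeft_self v (F.map a a')
  have h := P.unit_functor_map φ (X.map b b')
  rw [hφ] at h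
  refine Eq.trans (congrArg (gcomp _) ?_) h
  refine Eq.trans (integrandFunctor₂_aux _ _ _
    (((opFunctor m.tensor).comp V (rep x)).map_id (op p)) (F.map a a') (X.map b b')
    ((selfCopowers V).functor.map ⟨v, F.obj a⟩ ⟨v, F.obj a'⟩)
    (P.functor.map ⟨v ⊗ F.obj a, X.obj b⟩ ⟨v ⊗ F.obj a', X.obj b'⟩)).symm ?_
  exact (tensorHom_comp_tensorHom_assoc _ _ _ _ _).trans (congrArg (fun t => (φ ⊗ₘ t) ≫ _)
    (Category.comp_id (X.map b b')))

variable (m P) in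
/-- The contravariant action of the integrand of the convolution. -/
lemma unit_fixRight_integrand_map (F : EnrichedFunctor V A V) (X : EnrichedFunctor V A K) (x : A)
    (a b : A) (p p' : TensorObj A A) :
    gcomp (P.unit ((m.tensor.obj p' ⟶[V] x) ⊗ F.obj a) (X.obj b))
      ((fixRight (integrand m P F X x) ⟨a, b⟩).map (op p') (op p)) =
      (α_ _ _ _).hom ≫ _ ◁ (β_ _ _).hom ≫ (α_ _ _ _).inv ≫
        (_ ◁ m.tensor.map p p' ≫ (β_ _ _).hom ≫ eComp V _ _ _) ▷ F.obj a ≫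
          P.unit ((m.tensor.obj p ⟶[V] x) ⊗ F.obj a) (X.obj b) := by
  let v : V := (m.tensor.obj p ⟶[V] x)
  let v' : V := (m.tensor.obj p' ⟶[V] x)
  let χ : (p ⟶[V] p') ⟶ EnrichedCategory.Hom v' v :=
    ((opFunctor m.tensor).comp V (rep x)).map (op p') (op p)
  have hχ : unc χ = v' ◁ m.tensor.map p p' ≫ (β_ _ _).hom ≫ eComp V _ _ _ :=
    (unc_comp _ _).trans (congrArg (fun t => _ ≫ t) (unc_cur _))
  let φ : (p ⟶[V] p') ⟶ EnrichedCategory.Hom (v' ⊗ F.obj a) (v ⊗ F.obj a) :=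
    χ ≫ (fixRight (selfCopowers V).functor (F.obj a)).map v' v
  have hφ : unc φ = (α_ _ _ _).hom ≫ v' ◁ (β_ _ _).hom ≫ (α_ _ _ _).inv ≫ unc χ ▷ F.obj a :=
    unc_fixRight_self (F.obj a) χ
  have h := P.unit_fixRight_map (k := X.obj b) φ
  rw [hφ, hχ] at h
  refine Eq.trans (congrArg (gcomp _) ?_) (h.trans ?_)
  · refine Eq.trans (integrandFunctor_aux χ _ _ (eId V a) (eId V b) (F.map a a) (X.map b b)
      (F.map_id a) (X.map_id b)
      ((selfCopowers V).functor.map ⟨v', F.obj a⟩ ⟨v, F.obj a⟩)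
      (P.functor.map ⟨v' ⊗ F.obj a, X.obj b⟩ ⟨v ⊗ F.obj a, X.obj b⟩)).symm ?_
    exact (Category.assoc _ _ _).symm
  · simp only [Category.assoc]
    rfl

/-- The action on `F(a)` of a morphism `a ⟶ a'`, interchanged with a morphism `b ⟶ b'`. -/
def actSwap (F : EnrichedFunctor V A V) (a a' b b' : A) :
    F.obj a ⊗ ((a ⟶[V] a') ⊗ (b ⟶[V] b')) ⟶ (b ⟶[V] b') ⊗ F.obj a' :=
  (α_ _ _ _).inv ≫ actR F a a' ▷ _ ≫ (β_ _ _).hom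

/-- The condition on a family of cowedge components, in terms of the corresponding family of
morphisms `F(a) ⟶ K(X(b), Y(m(a, b)))`. -/
lemma cowedge_condition_iff {F : EnrichedFunctor V A V} {X Y : EnrichedFunctor V A K} {x : A}
    {t : ∀ a b, F.obj a ⟶ (X.obj b ⟶[V] Y.obj (m.tensor.obj ⟨a, b⟩))}
    {φ : ∀ p : TensorObj A A, 𝟙_ V ⟶ (P.obj ((m.tensor.obj p ⟶[V] x) ⊗ F.obj p.fst) (X.obj p.snd)
      ⟶[V] Y.obj x)}
    (hφ : ∀ p, P.unit _ _ ≫ post (φ p) =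
      (β_ _ _).hom ≫ gcomp (t p.fst p.snd) (Y.map (m.tensor.obj p) x))
    (a a' b b' : A) :
    gcomp ((fixLeft (integrand m P F X x) (op ⟨a', b'⟩)).map ⟨a, b⟩ ⟨a', b'⟩) (φ ⟨a', b'⟩) =
      gcomp ((fixRight (integrand m P F X x) ⟨a, b⟩).map (op ⟨a', b'⟩) (op ⟨a, b⟩)) (φ ⟨a, b⟩) ↔
    gcomp (gcomp (t a b) (mapB m Y a a' b b')) (Y.map (m.tensor.obj ⟨a', b'⟩) x) =
      gcomp (actSwap F a a' b b' ≫ gcomp (X.map b b') (t a' b'))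
        (Y.map (m.tensor.obj ⟨a', b'⟩) x) := by
  -- Both sides of the cowedge condition are composed with the copower unit. On this side A acts on
  -- F and X, in `hR` it acts on A(m(-,-), x). The same permutation of tensor factors appears in
  -- front of both results, and being invertible it can be cancelled at the end.
  have hL : gcomp (P.unit _ _)
      ((fixLeft (integrand m P F X x) (op ⟨a', b'⟩)).map ⟨a, b⟩ ⟨a', b'⟩ ≫ post (φ ⟨a', b'⟩)) =
      ((α_ _ _ _).hom ≫ (β_ _ _).hom) ≫ gcomp (actSwap F a a' b b' ≫ gcomp (X.map b b') (t a' b'))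
        (Y.map (m.tensor.obj ⟨a', b'⟩) x) := by
    refine (gcomp_post _ _ _).trans ?_
    refine (congrArg (fun s => s ≫ post (φ ⟨a', b'⟩))
      (unit_fixLeft_integrand_map m P F X x a a' b b' ⟨a', b'⟩)).trans ?_
    have h := hφ ⟨a', b'⟩
    dsimp only at h ⊢
    simp only [Category.assoc]
    rw [← gcomp_post, h]
    have h₂ := perm_left_aux (v := (m.tensor.obj ⟨a', b'⟩ ⟶[V] x)) (N := (b ⟶[V] b'))
      (actR F a a')
    have h₃ : gcomp (X.map b b') (gcomp (t a' b') (Y.map (m.tensor.obj ⟨a', b'⟩) x)) =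
        (α_ _ _ _).inv ≫ gcomp (gcomp (X.map b b') (t a' b'))
          (Y.map (m.tensor.obj ⟨a', b'⟩) x) := by
      rw [gcomp_assoc, Iso.inv_hom_id_assoc]
    rw [← whisker_gcomp, h₃, ← gcomp_whisker, ← BraidedCategory.braiding_naturality_right_assoc]
    have h₄ := congrArg (fun s => s ≫ gcomp (gcomp (X.map b b') (t a' b'))
      (Y.map (m.tensor.obj ⟨a', b'⟩) x)) h₂
    simp only [Category.assoc] at h₄ ⊢
    exact h₄
  have hR : gcomp (P.unit _ _)
      ((fixRight (integrand m P F X x) ⟨a, b⟩).map (op ⟨a', b'⟩) (op ⟨a, b⟩) ≫ post (φ ⟨a, b⟩)) =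
      ((α_ _ _ _).hom ≫ (β_ _ _).hom) ≫ gcomp (gcomp (t a b) (mapB m Y a a' b b'))
        (Y.map (m.tensor.obj ⟨a', b'⟩) x) := by
    refine (gcomp_post _ _ _).trans ?_
    refine (congrArg (fun s => s ≫ post (φ ⟨a, b⟩))
      (unit_fixRight_integrand_map m P F X x a b ⟨a, b⟩ ⟨a', b'⟩)).trans ?_
    have h := hφ ⟨a, b⟩
    dsimp only at h ⊢
    have key : (_ ◁ m.tensor.map ⟨a, b⟩ ⟨a', b'⟩ ≫ (β_ _ _).hom ≫ eComp V _ _ x) ≫ Y.map _ _ =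
        (β_ _ _).hom ≫ gcomp (mapB m Y a a' b b') (Y.map (m.tensor.obj ⟨a', b'⟩) x) := by
      simp only [Category.assoc]
      rw [map_eComp_eq, BraidedCategory.braiding_naturality_right_assoc, gcomp_whisker]
      rfl
    have h₃ : gcomp (t a b) (gcomp (mapB m Y a a' b b') (Y.map (m.tensor.obj ⟨a', b'⟩) x)) =
        (α_ _ _ _).inv ≫ gcomp (gcomp (t a b) (mapB m Y a a' b b'))
          (Y.map (m.tensor.obj ⟨a', b'⟩) x) := by
      rw [gcomp_assoc, Iso.inv_hom_id_assoc]
    simp only [Category.assoc _ _ (post (φ ⟨a, b⟩))]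
    rw [h, BraidedCategory.braiding_naturality_left_assoc, whisker_gcomp, key, ← whisker_gcomp,
      h₃]
    have h₄ := congrArg (fun s => s ≫ gcomp (gcomp (t a b)
      (mapB m Y a a' b b')) (Y.map (m.tensor.obj ⟨a', b'⟩) x)) (perm_right_aux
        (m.tensor.obj ⟨a', b'⟩ ⟶[V] x) (F.obj a) ((a ⟶[V] a') ⊗ (b ⟶[V] b')))
    simp only [Category.assoc] at h₄ ⊢
    exact h₄
  refine Iff.trans (Eq.congr (gcomp_unit_right _ _) (gcomp_unit_right _ _)) ?_
  refine (cancel_epi _).trans ⟨fun h => ?_, fun h => P.hom_ext ?_⟩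
  · exact (cancel_epi _).mp (hR.symm.trans ((congrArg (gcomp (P.unit _ _)) h.symm).trans hL))
  · exact hL.trans ((congrArg (fun s => _ ≫ s) h.symm).trans hR.symm)

end convolution

/-! ### The universal bilinear family of a convolution -/

section convolution
variable [SymmetricCategory V] [MonoidalClosed V] [HasLimits V]
variable {A : Type w} [EnrichedCategory V A] {m : MonoidalStructure V A}
variable {K : Type u₁} [EnrichedCategory V K] {P : Copowers V K}

/-- The monoidal part of the Yoneda reductions below: inserting an element that acts as an identity
leaves nothing but the symmetry. It is applied with e an identity of A and c the composition of A.
-/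
lemma braiding_elt_aux {v w f : V} (e : 𝟙_ V ⟶ v) (c : v ⊗ w ⟶ w)
    (h : e ▷ w ≫ c = (λ_ w).hom) :
    ((λ_ f).inv ≫ e ▷ f) ▷ w ≫ (α_ v f w).hom ≫ v ◁ (β_ f w).hom ≫ (α_ v w f).inv ≫ c ▷ f =
      (β_ f w).hom := by
  rw [comp_whiskerRight, Category.assoc, associator_naturality_left_assoc,
    ← whisker_exchange_assoc, associator_inv_naturality_left_assoc, ← comp_whiskerRight, h]
  simp

lemma perm_natural_aux (v f w : V) :
    (α_ v f w).hom ≫ v ◁ (β_ f w).hom ≫ (α_ v w f).inv ≫ (β_ (v ⊗ w) f).hom =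
      (β_ v f).hom ▷ w ≫ (α_ f v w).hom := by
  rw [BraidedCategory.braiding_tensor_left_hom]
  simp only [Iso.inv_hom_id_assoc]
  rw [← MonoidalCategory.whiskerLeft_comp_assoc, SymmetricCategory.symmetry,
    MonoidalCategory.whiskerLeft_id, Category.id_comp, Iso.hom_inv_id_assoc]

namespace Convolution
variable {act : EnrichedFunctor V (TensorObj (EnrichedFunctor V A V) (EnrichedFunctor V A K))
    (EnrichedFunctor V A K)} (κ : Convolution m P act)

/-- The components of the universal cowedges. -/
def ιApp (F : EnrichedFunctor V A V) (X : EnrichedFunctor V A K) (x a b : A) :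
    𝟙_ V ⟶ (P.obj ((m.tensor.obj ⟨a, b⟩ ⟶[V] x) ⊗ F.obj a) (X.obj b) ⟶[V]
      (act.obj ⟨F, X⟩).obj x) :=
  (κ.ι F X x).app ⟨a, b⟩

/-- The transpose of a component of the universal cowedge. -/
def transpose (F : EnrichedFunctor V A V) (X : EnrichedFunctor V A K) (x a b : A) :
    (m.tensor.obj ⟨a, b⟩ ⟶[V] x) ⊗ F.obj a ⟶ (X.obj b ⟶[V] (act.obj ⟨F, X⟩).obj x) :=
  P.unit ((m.tensor.obj ⟨a, b⟩ ⟶[V] x) ⊗ F.obj a) (X.obj b) ≫ post (κ.ιApp F X x a b)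

lemma coproj_eq (F : EnrichedFunctor V A V) (X : EnrichedFunctor V A K) (a b : A) :
    κ.coproj F X a b = ((λ_ _).inv ≫ eId V (m.tensor.obj ⟨a, b⟩) ▷ F.obj a) ≫
      κ.transpose F X (m.tensor.obj ⟨a, b⟩) a b := by
  rw [transpose, ← postComp_eq, Category.assoc]
  rfl

/-- This is the naturality of the universal cowedge in x, transposed along the copower: F * X acts
on the component through composition in A(m(a,b), -), while F(a) and X(b) are untouched. -/
lemma transpose_gcomp_map (F : EnrichedFunctor V A V) (X : EnrichedFunctor V A K) (x x' a b : A) :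
    gcomp (κ.transpose F X x a b) ((act.obj ⟨F, X⟩).map x x') =
      ((α_ _ _ _).hom ≫ _ ◁ (β_ _ _).hom ≫ (α_ _ _ _).inv ≫ eComp V _ _ _ ▷ F.obj a) ≫
        κ.transpose F X x' a b := by
  let w : V := (m.tensor.obj ⟨a, b⟩ ⟶[V] x)
  let w' : V := (m.tensor.obj ⟨a, b⟩ ⟶[V] x')
  let φ : (x ⟶[V] x') ⟶ EnrichedCategory.Hom (w ⊗ F.obj a) (w' ⊗ F.obj a) :=
    (corep (m.tensor.obj ⟨a, b⟩)).map x x' ≫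
      (fixRight (selfCopowers V).functor (F.obj a)).map w w'
  have hφ : unc φ = (α_ _ _ _).hom ≫ w ◁ (β_ _ _).hom ≫ (α_ _ _ _).inv ≫
      eComp V _ _ _ ▷ F.obj a :=
    (unc_fixRight_self (F.obj a) _).trans (congrArg (fun t => (α_ _ _ _).hom ≫ w ◁ (β_ _ _).hom ≫
      (α_ _ _ _).inv ≫ t ▷ F.obj a) (unc_cur _))
  have h₁ : φ ≫ (fixRight P.functor (X.obj b)).map _ _ ≫ post (κ.ιApp F X x' a b) =
      (act.obj ⟨F, X⟩).map x x' ≫ pre (κ.ιApp F X x a b) :=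
    Eq.trans ((Category.assoc _ _ _).trans (congrArg (fun t => _ ≫ t)
      (Category.assoc _ _ _).symm) |>.trans (Category.assoc _ _ _).symm) (isNatural_unit_iff.mp (κ.natural F X a b) x x')
  have h₂ := P.unit_fixRight_map (k := X.obj b) φ
  rw [hφ] at h₂
  rw [transpose, gcomp_post_left]
  refine (congrArg (gcomp _) h₁.symm).trans ?_
  refine (congrArg (gcomp _) (Category.assoc _ _ _).symm).trans ?_
  refine (gcomp_post _ _ _).trans ?_
  refine (congrArg (fun t => t ≫ post (κ.ιApp F X x' a b)) h₂).trans ?_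
  exact Category.assoc _ _ _

/-- The Yoneda step. By naturality in x, the component of the cowedge at x is recovered from its
value at m(a,b) on the identity, which is `coproj`. -/
lemma transpose_eq (F : EnrichedFunctor V A V) (X : EnrichedFunctor V A K) (x a b : A) :
    κ.transpose F X x a b = (β_ _ _).hom ≫
      gcomp (κ.coproj F X a b) ((act.obj ⟨F, X⟩).map (m.tensor.obj ⟨a, b⟩) x) := by
  have h : eId V (m.tensor.obj ⟨a, b⟩) ▷ (m.tensor.obj ⟨a, b⟩ ⟶[V] x) ≫ eComp V _ _ _ =
      (λ_ _).hom := by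
    have := e_id_comp V (m.tensor.obj ⟨a, b⟩) x
    rwa [Iso.inv_comp_eq, Category.comp_id] at this
  rw [coproj_eq, ← gcomp_whisker, transpose_gcomp_map, ← Category.assoc (_ ▷ _),
    braiding_elt_aux _ _ h, SymmetricCategory.symmetry_assoc]

/-- Composition of the universal cowedge with a natural family. -/
lemma gcomp_transpose {F : EnrichedFunctor V A V} {X Y : EnrichedFunctor V A K} {U : V}
    {s : ∀ x, U ⟶ ((act.obj ⟨F, X⟩).obj x ⟶[V] Y.obj x)} (hs : IsNatural _ _ s) (x a b : A) :
    gcomp (κ.transpose F X x a b) (s x) = ((β_ _ _).hom ▷ U ≫ (α_ _ _ _).hom ≫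
      _ ◁ (β_ _ _).hom ≫ (α_ _ _ _).inv) ≫
        gcomp (gcomp (κ.coproj F X a b) (s (m.tensor.obj ⟨a, b⟩))) (Y.map _ x) := by
  rw [transpose_eq, ← gcomp_whisker, gcomp_assoc, hs, ← whisker_gcomp, gcomp_assoc]
  simp only [Category.assoc, Iso.inv_hom_id_assoc]

/-- By `gcomp_transpose`, the composites of a natural family with all components of the universal
cowedges depend only on its composites with `coproj`. Universality of the coend and of the copowers
then determines the family. -/
lemma natural_ext {F : EnrichedFunctor V A V} {X Y : EnrichedFunctor V A K} {U : V}
    {s s' : ∀ x, U ⟶ ((act.obj ⟨F, X⟩).obj x ⟶[V] Y.obj x)} (hs : IsNatural _ _ s)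
    (hs' : IsNatural _ _ s') (h : ∀ a b, gcomp (κ.coproj F X a b) (s (m.tensor.obj ⟨a, b⟩)) =
      gcomp (κ.coproj F X a b) (s' (m.tensor.obj ⟨a, b⟩))) (x : A) : s x = s' x := by
  refine (κ.isCoend F X x).hom_ext fun c => P.hom_ext ?_
  refine (gcomp_post_left _ _ _).symm.trans (Eq.trans ?_ (gcomp_post_left _ _ _))
  refine (κ.gcomp_transpose hs x c.fst c.snd).trans
    (Eq.trans ?_ (κ.gcomp_transpose hs' x c.fst c.snd).symm)
  rw [h]

lemma hom_ext {F : EnrichedFunctor V A V} {X Y : EnrichedFunctor V A K} {U : V}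
    {g g' : U ⟶ natObj (act.obj ⟨F, X⟩) Y} (h : ∀ a b,
      gcomp (κ.coproj F X a b) (g ≫ natπ _ _ (m.tensor.obj ⟨a, b⟩)) =
        gcomp (κ.coproj F X a b) (g' ≫ natπ _ _ (m.tensor.obj ⟨a, b⟩))) : g = g' :=
  natObj_hom_ext fun x => κ.natural_ext ((natπ_natural _ _).precomp g)
    ((natπ_natural _ _).precomp g') h x

/-- The cowedge condition for x = m(a',b'), evaluated at the identity of x, is exactly the joint
bilinearity of `coproj`. -/
lemma coproj_isBilinear (F : EnrichedFunctor V A V) (X : EnrichedFunctor V A K) :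
    IsBilinear m F X (act.obj ⟨F, X⟩) (κ.coproj F X) := by
  refine isBilinear_of_joint fun a a' b b' => ?_
  have h := (cowedge_condition_iff (fun p => κ.transpose_eq F X (m.tensor.obj ⟨a', b'⟩) p.fst p.snd)
    a a' b b').mp ((κ.ι F X _).condition ⟨a, b⟩ ⟨a', b'⟩)
  have h := congrArg (fun t => _ ◁ eId V (m.tensor.obj ⟨a', b'⟩) ≫ t) h
  rw [whisker_gcomp, whisker_gcomp, EnrichedFunctor.map_id, gcomp_eId, gcomp_eId, cancel_epi] at h
  exact h

/-- The converse Yoneda construction: a bilinear family t extends to a cowedge at every x by letting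
A(m(a,b), x) act on Y. Only morphisms, i.e. shape 𝟙, are treated here; other shapes follow once the
adjunction is available. -/
lemma exists_of_isBilinear {F : EnrichedFunctor V A V} {X Y : EnrichedFunctor V A K}
    {t : ∀ a b, F.obj a ⟶ (X.obj b ⟶[V] Y.obj (m.tensor.obj ⟨a, b⟩))}
    (ht : IsBilinear m F X Y t) :
    ∃ g : 𝟙_ V ⟶ natObj (act.obj ⟨F, X⟩) Y, ∀ a b,
      κ.coproj F X a b ≫ post (g ≫ natπ _ _ (m.tensor.obj ⟨a, b⟩)) = t a b := by
  choose φ hφ using fun (x : A) (p : TensorObj A A) => P.exists_transpose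
    ((β_ _ _).hom ≫ gcomp (t p.fst p.snd) (Y.map (m.tensor.obj p) x))
  have hc (x : A) (p p' : TensorObj A A) :
      gcomp ((fixLeft (integrand m P F X x) (op p')).map p p') (φ x p') =
        gcomp ((fixRight (integrand m P F X x) p).map (op p') (op p)) (φ x p) :=
    (cowedge_condition_iff (hφ x) p.fst p'.fst p.snd p'.snd).mpr
      (congrArg (fun s => gcomp s _) (ht.joint _ _ _ _))
  choose g hg using fun x => (κ.isCoend F X x).exists_desc ⟨φ x, hc x⟩
  have hg' (x a b : A) : κ.transpose F X x a b ≫ post (g x) =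
      (β_ _ _).hom ≫ gcomp (t a b) (Y.map (m.tensor.obj ⟨a, b⟩) x) := by
    rw [transpose, Category.assoc, post_post, ← pre_unit]
    exact (congrArg (fun s => P.unit _ _ ≫ post s) (hg x ⟨a, b⟩)).trans (hφ x ⟨a, b⟩)
  have hg'' (a b : A) : κ.coproj F X a b ≫ post (g (m.tensor.obj ⟨a, b⟩)) = t a b := by
    rw [coproj_eq, Category.assoc, hg', Category.assoc,
      BraidedCategory.braiding_naturality_left_assoc, whisker_gcomp, EnrichedFunctor.map_id,
      gcomp_eId]
    simp
  -- Tested on the universal cowedge, both sides become t followed by the two successive actions of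
  -- Y, through m(a,b) ⟶ x ⟶ x'; functoriality of Y identifies them.
  have hn : IsNatural (act.obj ⟨F, X⟩) Y g := by
    refine isNatural_unit_iff.mpr fun x x' => (κ.isCoend F X x).hom_ext fun c => P.hom_ext ?_
    refine (gcomp_post_left _ _ _).symm.trans (Eq.trans ?_ (gcomp_post_left _ _ _))
    have h₁ : gcomp (κ.transpose F X x c.fst c.snd)
        ((act.obj ⟨F, X⟩).map x x' ≫ post (g x')) =
        ((β_ _ _).hom ▷ _ ≫ (α_ _ _ _).hom) ≫
          gcomp (t c.fst c.snd) (gcomp (Y.map _ _) (Y.map x x')) := by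
      rw [gcomp_post, transpose_gcomp_map, Category.assoc, hg']
      simp only [Category.assoc]
      rw [BraidedCategory.braiding_naturality_left_assoc, whisker_gcomp, map_eComp_eq]
      have h₂ := congrArg (fun s => s ≫ gcomp (t c.fst c.snd) (gcomp (Y.map _ _) (Y.map x x')))
        (perm_natural_aux (m.tensor.obj c ⟶[V] x) (F.obj c.fst) (x ⟶[V] x'))
      simp only [Category.assoc] at h₂
      exact h₂
    have h₃ : gcomp (κ.transpose F X x c.fst c.snd) (Y.map x x' ≫ pre (g x)) =
        ((β_ _ _).hom ▷ _ ≫ (α_ _ _ _).hom) ≫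
          gcomp (t c.fst c.snd) (gcomp (Y.map _ _) (Y.map x x')) := by
      rw [← gcomp_post_left, hg', ← gcomp_whisker, gcomp_assoc, Category.assoc]
    exact h₁.trans h₃.symm
  exact ⟨natLift _ _ g hn, fun a b => by rw [natLift_π, hg'']⟩

end Convolution

end convolution

/-! ### Naturality of the universal family in F and X -/

section convolution
variable [SymmetricCategory V] [MonoidalClosed V] [HasLimits V]
variable {A : Type w} [EnrichedCategory V A] {m : MonoidalStructure V A}
variable {K : Type u₁} [EnrichedCategory V K] {P : Copowers V K}

lemma joint_left_aux {f f' M N Q : V} (e : 𝟙_ V ⟶ N) (h : f ⊗ M ⟶ f') (g : N ⊗ f' ⟶ Q) :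
    f ◁ ((ρ_ M).inv ≫ (𝟙 M ⊗ₘ e)) ≫ ((α_ _ _ _).inv ≫ h ▷ N ≫ (β_ _ _).hom) ≫ g =
      h ≫ (λ_ _).inv ≫ e ▷ f' ≫ g := by
  rw [id_tensorHom, MonoidalCategory.whiskerLeft_comp]
  simp only [Category.assoc]
  rw [associator_inv_naturality_right_assoc, whisker_exchange_assoc,
    BraidedCategory.braiding_naturality_right_assoc]
  simp

lemma joint_right_aux {f M N Q : V} (e : 𝟙_ V ⟶ M) (h : f ⊗ M ⟶ f) (he : f ◁ e ≫ h = (ρ_ f).hom)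
    (g : N ⊗ f ⟶ Q) :
    f ◁ ((λ_ N).inv ≫ (e ⊗ₘ 𝟙 N)) ≫ ((α_ _ _ _).inv ≫ h ▷ N ≫ (β_ _ _).hom) ≫ g =
      (β_ _ _).hom ≫ g := by
  rw [tensorHom_id, MonoidalCategory.whiskerLeft_comp]
  simp only [Category.assoc]
  rw [associator_inv_naturality_middle_assoc, ← comp_whiskerRight_assoc, he,
      triangle_assoc_comp_right_assoc, ← MonoidalCategory.whiskerLeft_comp_assoc,
      Iso.inv_hom_id, MonoidalCategory.whiskerLeft_id, Category.id_comp]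

lemma joint_unit_aux {v f f' M N : V} (e : 𝟙_ V ⟶ v) (h : f ⊗ M ⟶ f') :
    ((λ_ f).inv ≫ e ▷ f) ▷ (M ⊗ N) ≫ (α_ _ _ _).inv ≫ ((α_ _ _ _).hom ≫ v ◁ h) ▷ N ≫
      (β_ _ _).hom = ((α_ _ _ _).inv ≫ h ▷ N ≫ (β_ _ _).hom) ≫ N ◁ ((λ_ _).inv ≫ e ▷ f') := by
  have key : ((λ_ f).inv ≫ e ▷ f) ▷ M ≫ (α_ _ _ _).hom ≫ v ◁ h = h ≫ (λ_ _).inv ≫ e ▷ f' := by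
    rw [comp_whiskerRight, Category.assoc, associator_naturality_left_assoc, ← whisker_exchange]
    simp
  rw [associator_inv_naturality_left_assoc, ← comp_whiskerRight_assoc, key, comp_whiskerRight,
    Category.assoc, BraidedCategory.braiding_naturality_left]
  simp only [Category.assoc]

namespace Convolution
variable {act : EnrichedFunctor V (TensorObj (EnrichedFunctor V A V) (EnrichedFunctor V A K))
    (EnrichedFunctor V A K)} (κ : Convolution m P act)

lemma transpose_act_map (F F' : EnrichedFunctor V A V) (X X' : EnrichedFunctor V A K)
    (x a b : A) :
    gcomp (κ.transpose F X x a b) (act.map ⟨F, X⟩ ⟨F', X'⟩ ≫ natπ _ _ x) =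
      ((α_ _ _ _).inv ≫ ((α_ _ _ _).hom ≫ _ ◁ unc (natπ F F' a)) ▷ natObj X X' ≫ (β_ _ _).hom) ≫
        gcomp (natπ X X' b) (κ.transpose F' X' x a b) := by
  let v : V := (m.tensor.obj ⟨a, b⟩ ⟶[V] x)
  let φ : natObj F F' ⟶ EnrichedCategory.Hom (v ⊗ F.obj a) (v ⊗ F'.obj a) :=
    natπ F F' a ≫ (fixLeft (selfCopowers V).functor v).map (F.obj a) (F'.obj a)
  have hφ : unc φ = (α_ _ _ _).hom ≫ v ◁ unc (natπ F F' a) := unc_fixLeft_self v _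
  have h₂ := P.unit_functor_map φ (natπ X X' b)
  rw [hφ] at h₂
  have h₁ : ((φ ⊗ₘ natπ X X' b) ≫ P.functor.map ⟨v ⊗ F.obj a, X.obj b⟩ ⟨v ⊗ F'.obj a, X'.obj b⟩) ≫
      post (κ.ιApp F' X' x a b) =
      (act.map ⟨F, X⟩ ⟨F', X'⟩ ≫ natπ _ _ x) ≫ pre (κ.ιApp F X x a b) := by
    refine Eq.trans ?_ (isNatural_unit_iff.mp (κ.natural₂ x a b) ⟨F, X⟩ ⟨F', X'⟩)
    refine congrArg (fun t => t ≫ post (κ.ιApp F' X' x a b)) ?_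
    refine (congrArg (fun t => (φ ⊗ₘ t) ≫ _) (Category.comp_id (natπ X X' b))).symm.trans ?_
    exact (tensorHom_comp_tensorHom_assoc _ _ _ _ _).symm
  rw [transpose, gcomp_post_left]
  refine (congrArg (gcomp _) h₁.symm).trans ?_
  refine (gcomp_post _ _ _).trans ((congrArg (fun t => t ≫ post (κ.ιApp F' X' x a b)) h₂).trans ?_)
  rw [transpose, gcomp_post]
  simp only [Category.assoc]
  rfl

/-- Naturality of the universal cowedge in (F, X), taken at x = m(a,b) and evaluated at the
identity. Together with `hom_ext` it determines the action of the convolution on hom-objects, so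
later arguments need no cowedges. -/
lemma coproj_act_map (F F' : EnrichedFunctor V A V) (X X' : EnrichedFunctor V A K) (a b : A) :
    gcomp (κ.coproj F X a b) (act.map ⟨F, X⟩ ⟨F', X'⟩ ≫ natπ _ _ (m.tensor.obj ⟨a, b⟩)) =
      ((α_ _ _ _).inv ≫ unc (natπ F F' a) ▷ natObj X X' ≫ (β_ _ _).hom) ≫
        gcomp (natπ X X' b) (κ.coproj F' X' a b) := by
  rw [coproj_eq, ← gcomp_whisker, transpose_act_map, coproj_eq, ← whisker_gcomp,
    ← Category.assoc _ (_ ◁ _), ← joint_unit_aux]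
  simp only [Category.assoc]
  rfl

/-- The canonical morphisms are natural in `F`. -/
lemma coproj_fixRight_map (F F' : EnrichedFunctor V A V) (X : EnrichedFunctor V A K) (a b : A) :
    gcomp (κ.coproj F X a b) ((fixRight act X).map F F' ≫ natπ _ _ (m.tensor.obj ⟨a, b⟩)) =
      unc (natπ F F' a) ≫ κ.coproj F' X a b := by
  refine (congrArg (gcomp _) (Category.assoc _ _ _)).trans ?_
  refine (whisker_gcomp _ _ _).symm.trans ?_
  refine (congrArg (fun t => _ ≫ t) (κ.coproj_act_map F F' X X a b)).trans ?_
  refine (joint_left_aux _ _ _).trans ?_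
  rw [gcomp_whisker]
  refine (congrArg (fun t => _ ≫ _ ≫ gcomp t _) (functorCategory_eId_π X b)).trans ?_
  rw [eId_gcomp, Iso.inv_hom_id_assoc]

/-- The canonical morphisms are natural in `X`. -/
lemma coproj_fixLeft_map (F : EnrichedFunctor V A V) (X X' : EnrichedFunctor V A K) (a b : A) :
    gcomp (κ.coproj F X a b) ((fixLeft act F).map X X' ≫ natπ _ _ (m.tensor.obj ⟨a, b⟩)) =
      (β_ _ _).hom ≫ gcomp (natπ X X' b) (κ.coproj F X' a b) := by
  refine (congrArg (gcomp _) (Category.assoc _ _ _)).trans ?_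
  refine (whisker_gcomp _ _ _).symm.trans ?_
  refine (congrArg (fun t => _ ≫ t) (κ.coproj_act_map F F X X' a b)).trans ?_
  refine joint_right_aux _ _ ?_ _
  rw [← unc_comp]
  exact (congrArg unc (functorCategory_eId_π F a)).trans (unc_eId _)

end Convolution

end convolution

/-! ### Components of hom-objects of functor categories -/

section functorCategory
variable [SymmetricCategory V] [MonoidalClosed V] [HasLimits V]
variable {C : Type w} [EnrichedCategory V C] {D : Type u₂} [EnrichedCategory V D]

lemma gcomp_natπ {F G H : EnrichedFunctor V C D} {U U' : V} (f : U ⟶ (F ⟶[V] G))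
    (g : U' ⟶ (G ⟶[V] H)) (c : C) :
    gcomp f g ≫ natπ F H c = gcomp (f ≫ natπ F G c) (g ≫ natπ G H c) :=
  gcomp_map (evalFunctor D c) f g

lemma post_natπ {F G H : EnrichedFunctor V C D} (g : 𝟙_ V ⟶ (G ⟶[V] H)) (c : C) :
    (post g : (F ⟶[V] G) ⟶ _) ≫ natπ F H c = natπ F G c ≫ post (g ≫ natπ G H c) :=
  post_map (evalFunctor D c) g

lemma pre_natπ {F G H : EnrichedFunctor V C D} (g : 𝟙_ V ⟶ (F ⟶[V] G)) (c : C) :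
    (pre g : (G ⟶[V] H) ⟶ _) ≫ natπ F H c = natπ G H c ≫ pre (g ≫ natπ F G c) :=
  pre_map (evalFunctor D c) g

lemma unc_corep_map {E : Type u₁} [EnrichedCategory V E] {U : V} (x : E) {y z : E}
    (f : U ⟶ (y ⟶[V] z)) : unc (f ≫ (corep x).map y z) = gcomp (𝟙 (x ⟶[V] y)) f := by
  refine (unc_comp _ _).trans ((congrArg (fun t => _ ≫ t) (unc_cur _)).trans ?_)
  refine (congrArg (fun t => _ ≫ t) (eComp_eq_gcomp _ _ _)).trans ((whisker_gcomp _ _ _).trans ?_)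
  exact congrArg (gcomp _) (Category.comp_id f)

lemma curryFunctor_map_π {E : Type u₃} [EnrichedCategory V E]
    (B : EnrichedFunctor V (TensorObj E C) D) (e e' : E) (c : C) :
    (curryFunctor B).map e e' ≫ natπ (fixLeft B e) (fixLeft B e') c = (fixRight B c).map e e' :=
  natLift_π _ _ _ (curryApp_natural B e e') c

end functorCategory

/-! ### The V-functor ⟨X, -⟩ -/

section convolution
variable [SymmetricCategory V] [MonoidalClosed V] [HasLimits V]
variable {A : Type w} [EnrichedCategory V A] {m : MonoidalStructure V A}
variable {K : Type u₁} [EnrichedCategory V K] {P : Copowers V K}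

variable (m) in
/-- The `V`-functor `Y(m(a, -))`. -/
def shift (Y : EnrichedFunctor V A K) (a : A) : EnrichedFunctor V A K :=
  fixLeft (m.tensor.comp V Y) a

variable (m) in
/-- The action of `Y ↦ Y(m(a, -))` on hom-objects. -/
def shiftMap (a : A) (Y Y' : EnrichedFunctor V A K) :
    natObj Y Y' ⟶ natObj (shift m Y a) (shift m Y' a) :=
  natLift _ _ (fun b => natπ Y Y' (m.tensor.obj ⟨a, b⟩))
    (((natπ_natural Y Y').whiskerLeft m.tensor).whiskerLeft (insertLeft A a))

lemma shiftMap_π (a : A) (Y Y' : EnrichedFunctor V A K) (b : A) :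
    shiftMap m a Y Y' ≫ natπ (shift m Y a) (shift m Y' a) b = natπ Y Y' (m.tensor.obj ⟨a, b⟩) :=
  natLift_π _ _ _ _ _

variable (m) in
/-- The `V`-functor `Y ↦ Y(m(a, -))`. -/
def shiftFunctor (a : A) : EnrichedFunctor V (EnrichedFunctor V A K) (EnrichedFunctor V A K) where
  obj Y := shift m Y a
  map Y Y' := shiftMap m a Y Y'
  map_id Y := natObj_hom_ext fun b => by
    rw [Category.assoc, shiftMap_π, functorCategory_eId_π]
    exact functorCategory_eId_π Y _
  map_comp Y Y' Y'' := natObj_hom_ext fun b => by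
    refine Eq.trans ?_ (gcomp_natπ (shiftMap m a Y Y') (shiftMap m a Y' Y'') b).symm
    rw [Category.assoc, shiftMap_π, shiftMap_π, shiftMap_π]
    exact functorCategory_eComp_π Y Y' Y'' _

/-- After projection to each b, the claim is naturality of `natπ Y Y'` along m(-, b). This is what
allows the action of [A,K](Y,Y') on [A,K](X, Y(m(a,-))) to be assembled over a into a map of ends.
-/
lemma shiftMap_natural (Y Y' : EnrichedFunctor V A K) :
    IsNatural (curryFunctor (m.tensor.comp V Y)) (curryFunctor (m.tensor.comp V Y'))
      fun a => shiftMap m a Y Y' := by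
  intro a a'
  refine natObj_hom_ext fun b => ?_
  refine (gcomp_natπ _ _ b).trans (Eq.trans ?_ ((Category.assoc _ _ _).trans
    (congrArg (fun t => _ ≫ t) (gcomp_natπ _ _ b))).symm)
  refine Eq.trans (congrArg₂ gcomp (curryFunctor_map_π _ _ _ _) (shiftMap_π _ _ _ _)) ?_
  refine Eq.trans ?_ (congrArg (fun t => _ ≫ t)
    (congrArg₂ gcomp (shiftMap_π _ _ _ _) (curryFunctor_map_π _ _ _ _)).symm)
  exact ((natπ_natural Y Y').whiskerLeft m.tensor).whiskerLeft (insertRight A b) a a'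

variable (m) in
/-- The action of `⟨X, -⟩` on hom-objects. -/
def angleMap (X Y Y' : EnrichedFunctor V A K) :
    natObj Y Y' ⟶ natObj (angle m X Y) (angle m X Y') :=
  natLift (angle m X Y) (angle m X Y') (fun a => ((shiftFunctor m a).comp V (corep X)).map Y Y')
    ((shiftMap_natural Y Y').whiskerRight (corep X))

lemma angleMap_π (X Y Y' : EnrichedFunctor V A K) (a : A) :
    angleMap m X Y Y' ≫ natπ (angle m X Y) (angle m X Y') a =
      ((shiftFunctor m a).comp V (corep X)).map Y Y' :=
  natLift_π _ _ _ ((shiftMap_natural Y Y').whiskerRight (corep X)) a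

variable (m) in
/-- The `V`-functor `⟨X, -⟩`. -/
def angleFunctor (X : EnrichedFunctor V A K) :
    EnrichedFunctor V (EnrichedFunctor V A K) (EnrichedFunctor V A V) where
  obj Y := angle m X Y
  map Y Y' := angleMap m X Y Y'
  map_id Y := natObj_hom_ext fun a => by
    refine (Category.assoc _ _ _).trans ((congrArg (fun t => _ ≫ t) (angleMap_π _ _ _ a)).trans ?_)
    exact (((shiftFunctor m a).comp V (corep X)).map_id Y).trans
      (functorCategory_eId_π (angle m X Y) a).symm
  map_comp Y Y' Y'' := natObj_hom_ext fun a => by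
    refine (Category.assoc _ _ _).trans ((congrArg (fun t => _ ≫ t) (angleMap_π _ _ _ a)).trans ?_)
    refine Eq.trans ?_ (gcomp_natπ _ _ a).symm
    refine (((shiftFunctor m a).comp V (corep X)).map_comp Y Y' Y'').trans ?_
    exact congrArg₂ gcomp (angleMap_π _ _ _ a).symm (angleMap_π _ _ _ a).symm

lemma unc_angleMap_π {U : V} (X Y Y' : EnrichedFunctor V A K) (a b : A) (f : U ⟶ (Y ⟶[V] Y')) :
    unc ((f ≫ angleMap m X Y Y') ≫ natπ (angle m X Y) (angle m X Y') a) ≫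
        natπ X (shift m Y' a) b =
      gcomp (natπ X (shift m Y a) b) (f ≫ natπ Y Y' (m.tensor.obj ⟨a, b⟩)) := by
  have h : (f ≫ angleMap m X Y Y') ≫ natπ (angle m X Y) (angle m X Y') a =
      (f ≫ shiftMap m a Y Y') ≫ (corep X).map (shift m Y a) (shift m Y' a) :=
    (Category.assoc _ _ _).trans ((congrArg (fun t => f ≫ t) (angleMap_π X Y Y' a)).trans
      (Category.assoc _ _ _).symm)
  rw [h]
  refine (congrArg (fun t => t ≫ natπ X (shift m Y' a) b) (unc_corep_map X _)).trans ?_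
  refine (gcomp_natπ _ _ b).trans ?_
  refine congrArg₂ gcomp (Category.id_comp _) ?_
  exact (Category.assoc _ _ _).trans (congrArg (fun t => f ≫ t) (shiftMap_π a Y Y' b))

/-- The component `⟨X, Y⟩(a) ⟶ K(X(b), Y(m(a, b)))`. -/
def angleπ (X Y : EnrichedFunctor V A K) (a b : A) :
    (angle m X Y).obj a ⟶ (X.obj b ⟶[V] Y.obj (m.tensor.obj ⟨a, b⟩)) :=
  natπ X (shift m Y a) b

lemma angle_hom_ext {X Y : EnrichedFunctor V A K} {a : A} {U : V} {f g : U ⟶ (angle m X Y).obj a}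
    (h : ∀ b, f ≫ angleπ X Y a b = g ≫ angleπ X Y a b) : f = g :=
  natObj_hom_ext h

/-- The morphism to `⟨X, Y⟩(a)` corresponding to a family natural in `b`. -/
def IsBilinear.angleLift {F : EnrichedFunctor V A V} {X Y : EnrichedFunctor V A K}
    {t : ∀ a b, F.obj a ⟶ (X.obj b ⟶[V] Y.obj (m.tensor.obj ⟨a, b⟩))}
    (ht : IsBilinear m F X Y t) (a : A) : F.obj a ⟶ (angle m X Y).obj a :=
  natLift X (shift m Y a) (t a) (ht.right a)

lemma IsBilinear.angleLift_π {F : EnrichedFunctor V A V} {X Y : EnrichedFunctor V A K}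
    {t : ∀ a b, F.obj a ⟶ (X.obj b ⟶[V] Y.obj (m.tensor.obj ⟨a, b⟩))}
    (ht : IsBilinear m F X Y t) (a b : A) : ht.angleLift a ≫ angleπ X Y a b = t a b :=
  natLift_π _ _ _ _ _

lemma actR_angle_π (X Y : EnrichedFunctor V A K) (a a' b : A) :
    actR (angle m X Y) a a' ≫ angleπ X Y a' b = gcomp (angleπ X Y a b) (mapL m Y a a' b) := by
  have h : actR (angle m X Y) a a' =
      gcomp (𝟙 (natObj X (shift m Y a))) ((curryFunctor (m.tensor.comp V Y)).map a a') :=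
    unc_corep_map X _
  rw [h]
  refine (gcomp_natπ _ _ b).trans ?_
  exact congrArg₂ gcomp (Category.id_comp _) (curryFunctor_map_π _ _ _ _)

/-- Naturality in a expresses how A acts on ⟨X,Y⟩, and naturality in b is the end condition. These
projections are the universal bilinear family for fixed X and Y, as `coproj` is for fixed F and X.
-/
lemma angleπ_isBilinear (X Y : EnrichedFunctor V A K) :
    IsBilinear m (angle m X Y) X Y (angleπ X Y) where
  left a a' b := (actR_angle_π X Y a a' b).symm
  right a b b' := natπ_natural X (shift m Y a) b b'

lemma exists_of_actR {F G : EnrichedFunctor V A V} (f : ∀ a, F.obj a ⟶ G.obj a)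
    (hf : ∀ a a', actR F a a' ≫ f a' = f a ▷ _ ≫ actR G a a') :
    ∃ φ : 𝟙_ V ⟶ (F ⟶[V] G), ∀ a, mor (φ ≫ natπ F G a) = f a := by
  refine ⟨natLift F G (fun a => elt (f a)) (isNatural_unit_iff.mpr fun a a' => unc_injective ?_),
    fun a => by rw [natLift_π, mor_elt]⟩
  rw [unc_post, unc_pre, mor_elt, mor_elt]
  exact hf a a'

lemma natObj_unit_ext {F G : EnrichedFunctor V A V} {φ ψ : 𝟙_ V ⟶ (F ⟶[V] G)}
    (h : ∀ a, mor (φ ≫ natπ F G a) = mor (ψ ≫ natπ F G a)) : φ = ψ :=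
  natObj_hom_ext fun a => mor_injective (h a)

/-- Naturality in b gives the factorization through the end, and naturality in a, tested on its
projections, makes the resulting maps a morphism of [A,V]. -/
lemma IsBilinear.exists_angle {F : EnrichedFunctor V A V} {X Y : EnrichedFunctor V A K}
    {t : ∀ a b, F.obj a ⟶ (X.obj b ⟶[V] Y.obj (m.tensor.obj ⟨a, b⟩))}
    (ht : IsBilinear m F X Y t) :
    ∃ φ : 𝟙_ V ⟶ (F ⟶[V] angle m X Y),
      ∀ a b, mor (φ ≫ natπ F (angle m X Y) a) ≫ angleπ X Y a b = t a b := by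
  obtain ⟨φ, hφ⟩ := exists_of_actR (G := angle m X Y) ht.angleLift fun a a' =>
    angle_hom_ext fun b => by
      rw [Category.assoc, ht.angleLift_π, Category.assoc, actR_angle_π, gcomp_whisker,
        ht.angleLift_π, ht.left]
  exact ⟨φ, fun a b => by rw [hφ, ht.angleLift_π]⟩

section partialMaps
variable {A₁ : Type u₂} [EnrichedCategory V A₁] {A₂ : Type u₃} [EnrichedCategory V A₂]
  {A₃ : Type u₄} [EnrichedCategory V A₃] (act : EnrichedFunctor V (TensorObj A₁ A₂) A₃)

/-- The action of a `V`-functor of two variables on a generalized element in the first variable. -/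
def mapFst {U : V} {F F' : A₁} (X : A₂) (φ : U ⟶ (F ⟶[V] F')) :
    U ⟶ (act.obj ⟨F, X⟩ ⟶[V] act.obj ⟨F', X⟩) := φ ≫ (fixRight act X).map F F'

/-- The action of a `V`-functor of two variables on a generalized element in the second variable. -/
def mapSnd {U : V} (F : A₁) {X X' : A₂} (ψ : U ⟶ (X ⟶[V] X')) :
    U ⟶ (act.obj ⟨F, X⟩ ⟶[V] act.obj ⟨F, X'⟩) := ψ ≫ (fixLeft act F).map X X'

end partialMaps

namespace Convolution
variable {act : EnrichedFunctor V (TensorObj (EnrichedFunctor V A V) (EnrichedFunctor V A K))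
    (EnrichedFunctor V A K)} (κ : Convolution m P act)

lemma hom_ext_unit {F : EnrichedFunctor V A V} {X Y : EnrichedFunctor V A K}
    {g g' : 𝟙_ V ⟶ (act.obj ⟨F, X⟩ ⟶[V] Y)} (h : ∀ a b,
      κ.coproj F X a b ≫ post (g ≫ natπ _ _ (m.tensor.obj ⟨a, b⟩)) =
        κ.coproj F X a b ≫ post (g' ≫ natπ _ _ (m.tensor.obj ⟨a, b⟩))) : g = g' :=
  κ.hom_ext fun a b => by rw [gcomp_unit_right, gcomp_unit_right, h]

lemma gcomp_coproj_mapFst {U : V} (F F' : EnrichedFunctor V A V) (X : EnrichedFunctor V A K)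
    (a b : A) (φ : U ⟶ (F ⟶[V] F')) :
    gcomp (κ.coproj F X a b)
        (mapFst act X φ ≫ natπ _ _ (m.tensor.obj ⟨a, b⟩)) =
      unc (φ ≫ natπ F F' a) ≫ κ.coproj F' X a b := by
  refine (congrArg (gcomp _) (Category.assoc _ _ _)).trans ?_
  refine (whisker_gcomp _ _ _).symm.trans ?_
  refine (congrArg (fun t => _ ≫ t) (κ.coproj_fixRight_map F F' X a b)).trans ?_
  exact (Category.assoc _ _ _).symm.trans (congrArg (fun t => t ≫ _) (unc_comp _ _).symm)

lemma gcomp_coproj_mapSnd {U : V} (F : EnrichedFunctor V A V) (X X' : EnrichedFunctor V A K)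
    (a b : A) (ψ : U ⟶ (X ⟶[V] X')) :
    gcomp (κ.coproj F X a b)
        (mapSnd act F ψ ≫ natπ _ _ (m.tensor.obj ⟨a, b⟩)) =
      (β_ _ _).hom ≫ gcomp (ψ ≫ natπ X X' b) (κ.coproj F X' a b) := by
  refine (congrArg (gcomp _) (Category.assoc _ _ _)).trans ?_
  refine (whisker_gcomp _ _ _).symm.trans ?_
  refine (congrArg (fun t => _ ≫ t) (κ.coproj_fixLeft_map F X X' a b)).trans ?_
  refine (BraidedCategory.braiding_naturality_right_assoc _ _ _).trans ?_
  exact congrArg (fun t => _ ≫ t) (gcomp_whisker _ _ _)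

lemma coproj_mapFst (F F' : EnrichedFunctor V A V) (X : EnrichedFunctor V A K) (a b : A)
    (φ : 𝟙_ V ⟶ (F ⟶[V] F')) :
    κ.coproj F X a b ≫ post (mapFst act X φ ≫ natπ _ _ (m.tensor.obj ⟨a, b⟩)) =
      mor (φ ≫ natπ F F' a) ≫ κ.coproj F' X a b := by
  refine (comp_post _ _).trans ((congrArg (fun t => (ρ_ _).inv ≫ t)
    (κ.gcomp_coproj_mapFst F F' X a b φ)).trans ?_)
  rw [mor, Category.assoc]

lemma coproj_mapSnd (F : EnrichedFunctor V A V) (X X' : EnrichedFunctor V A K) (a b : A)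
    (ψ : 𝟙_ V ⟶ (X ⟶[V] X')) :
    κ.coproj F X a b ≫ post (mapSnd act F ψ ≫ natπ _ _ (m.tensor.obj ⟨a, b⟩)) =
      κ.coproj F X' a b ≫ pre (ψ ≫ natπ X X' b) := by
  refine (comp_post _ _).trans ((congrArg (fun t => (ρ_ _).inv ≫ t)
    (κ.gcomp_coproj_mapSnd F X X' a b ψ)).trans ?_)
  rw [gcomp_unit_left, braiding_tensorUnit_right]
  simp

end Convolution

end convolution

/-! ### The adjunction between - * X and ⟨X, -⟩ -/

section convolution
variable [SymmetricCategory V] [MonoidalClosed V] [HasLimits V]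
variable {A : Type w} [EnrichedCategory V A] {m : MonoidalStructure V A}
variable {K : Type u₁} [EnrichedCategory V K] {P : Copowers V K}

lemma mor_angleMap_π (X Y Y' : EnrichedFunctor V A K) (a b : A) (f : 𝟙_ V ⟶ (Y ⟶[V] Y')) :
    mor ((f ≫ angleMap m X Y Y') ≫ natπ (angle m X Y) (angle m X Y') a) ≫ angleπ X Y' a b =
      angleπ X Y a b ≫ post (f ≫ natπ Y Y' (m.tensor.obj ⟨a, b⟩)) := by
  rw [mor, Category.assoc]
  refine (congrArg (fun t => (ρ_ _).inv ≫ t) (unc_angleMap_π X Y Y' a b f)).trans ?_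
  rw [gcomp_unit_right]
  exact Iso.inv_hom_id_assoc _ _

section functorCategory
variable {C : Type w} [EnrichedCategory V C] {D : Type u₂} [EnrichedCategory V D]

lemma comp_post_natπ {F G H : EnrichedFunctor V C D} {U : V} (f : U ⟶ (F ⟶[V] G))
    (g : 𝟙_ V ⟶ (G ⟶[V] H)) (c : C) :
    (f ≫ post g) ≫ natπ F H c = (f ≫ natπ F G c) ≫ post (g ≫ natπ G H c) :=
  (Category.assoc _ _ _).trans ((congrArg (fun t => f ≫ t) (post_natπ g c)).trans
    (Category.assoc _ _ _).symm)

lemma comp_pre_natπ {F G H : EnrichedFunctor V C D} {U : V} (f : U ⟶ (G ⟶[V] H))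
    (g : 𝟙_ V ⟶ (F ⟶[V] G)) (c : C) :
    (f ≫ pre g) ≫ natπ F H c = (f ≫ natπ G H c) ≫ pre (g ≫ natπ F G c) :=
  (Category.assoc _ _ _).trans ((congrArg (fun t => f ≫ t) (pre_natπ g c)).trans
    (Category.assoc _ _ _).symm)

end functorCategory

namespace Convolution
variable {act : EnrichedFunctor V (TensorObj (EnrichedFunctor V A V) (EnrichedFunctor V A K))
    (EnrichedFunctor V A K)} (κ : Convolution m P act)

/-- The unit of the adjunction. -/
def adjUnit (X : EnrichedFunctor V A K) (F : EnrichedFunctor V A V) :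
    𝟙_ V ⟶ (F ⟶[V] angle m X (act.obj ⟨F, X⟩)) :=
  (κ.coproj_isBilinear F X).exists_angle.choose

lemma adjUnit_π (X : EnrichedFunctor V A K) (F : EnrichedFunctor V A V) (a b : A) :
    mor (κ.adjUnit X F ≫ natπ F (angle m X (act.obj ⟨F, X⟩)) a) ≫ angleπ X _ a b =
      κ.coproj F X a b :=
  (κ.coproj_isBilinear F X).exists_angle.choose_spec a b

/-- The counit of the adjunction. -/
def adjCounit (X Y : EnrichedFunctor V A K) : 𝟙_ V ⟶ (act.obj ⟨angle m X Y, X⟩ ⟶[V] Y) :=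
  (κ.exists_of_isBilinear (angleπ_isBilinear X Y)).choose

lemma coproj_adjCounit (X Y : EnrichedFunctor V A K) (a b : A) :
    κ.coproj (angle m X Y) X a b ≫ post (κ.adjCounit X Y ≫ natπ _ _ (m.tensor.obj ⟨a, b⟩)) =
      angleπ X Y a b :=
  (κ.exists_of_isBilinear (angleπ_isBilinear X Y)).choose_spec a b

/-- Evaluated at a and projected to b, both sides reduce to the action of F ⟶ F' at a followed by
`coproj F' X a b`: on the left by definition of the unit, on the right by naturality of `coproj` in
F. -/
lemma adjUnit_natural (X : EnrichedFunctor V A K) (F F' : EnrichedFunctor V A V) :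
    (post (κ.adjUnit X F') : (F ⟶[V] F') ⟶ _) =
      (mapFst act X (𝟙 _) ≫ angleMap m X _ _) ≫ pre (κ.adjUnit X F) := by
  refine natObj_hom_ext fun a => unc_injective (angle_hom_ext fun b => ?_)
  have h₁ : unc ((post (κ.adjUnit X F') : (F ⟶[V] F') ⟶ _) ≫ natπ _ _ a) ≫ angleπ X _ a b =
      unc (natπ F F' a) ≫ κ.coproj F' X a b := by
    rw [← κ.adjUnit_π, ← Category.assoc, ← unc_post]
    exact congrArg (fun t => unc t ≫ _) (post_natπ _ _)
  have h₂ : unc (((mapFst act X (𝟙 (F ⟶[V] F')) ≫ angleMap m X _ _) ≫ pre (κ.adjUnit X F)) ≫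
      natπ _ _ a) ≫ angleπ X _ a b = unc (natπ F F' a) ≫ κ.coproj F' X a b := by
    have h₃ := κ.gcomp_coproj_mapFst F F' X a b (𝟙 _)
    rw [Category.id_comp] at h₃
    refine Eq.trans ?_ h₃
    refine (congrArg (fun t => unc t ≫ _) ((Category.assoc _ _ _).trans
      ((congrArg (fun t => _ ≫ t) (pre_natπ _ _)).trans (Category.assoc _ _ _).symm))).trans ?_
    refine (congrArg (fun t => t ≫ _) (unc_pre _ _)).trans ?_
    refine (Category.assoc _ _ _).trans ((congrArg (fun t => _ ≫ t)
      (unc_angleMap_π X _ _ a b _)).trans ?_)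
    refine (gcomp_whisker _ _ _).trans (congrArg (fun t => gcomp t _) ?_)
    exact κ.adjUnit_π X F a b
  exact h₁.trans h₂.symm

lemma gcomp_coproj_post {F : EnrichedFunctor V A V} {X Y Y' : EnrichedFunctor V A K} {U : V}
    (f : U ⟶ (act.obj ⟨F, X⟩ ⟶[V] Y)) (g : 𝟙_ V ⟶ (Y ⟶[V] Y')) (a b : A) :
    gcomp (κ.coproj F X a b) ((f ≫ post g) ≫ natπ _ _ (m.tensor.obj ⟨a, b⟩)) =
      gcomp (κ.coproj F X a b) (f ≫ natπ _ _ (m.tensor.obj ⟨a, b⟩)) ≫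
        post (g ≫ natπ _ _ (m.tensor.obj ⟨a, b⟩)) :=
  (congrArg (gcomp _) (comp_post_natπ f g _)).trans (gcomp_post _ _ _)

lemma gcomp_coproj_pre {F : EnrichedFunctor V A V} {X Y Y' : EnrichedFunctor V A K} {U : V}
    (f : U ⟶ (Y ⟶[V] Y')) (g : 𝟙_ V ⟶ (act.obj ⟨F, X⟩ ⟶[V] Y)) (a b : A) :
    gcomp (κ.coproj F X a b) ((f ≫ pre g) ≫ natπ _ _ (m.tensor.obj ⟨a, b⟩)) =
      gcomp (κ.coproj F X a b ≫ post (g ≫ natπ _ _ (m.tensor.obj ⟨a, b⟩)))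
        (f ≫ natπ _ _ (m.tensor.obj ⟨a, b⟩)) :=
  (congrArg (gcomp _) (comp_pre_natπ f g _)).trans (gcomp_post_left _ _ _).symm

lemma coproj_post {F : EnrichedFunctor V A V} {X Y Y' : EnrichedFunctor V A K}
    (f : 𝟙_ V ⟶ (act.obj ⟨F, X⟩ ⟶[V] Y)) (g : 𝟙_ V ⟶ (Y ⟶[V] Y')) (a b : A) :
    κ.coproj F X a b ≫ post ((f ≫ post g) ≫ natπ _ _ (m.tensor.obj ⟨a, b⟩)) =
      (κ.coproj F X a b ≫ post (f ≫ natπ _ _ (m.tensor.obj ⟨a, b⟩))) ≫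
        post (g ≫ natπ _ _ (m.tensor.obj ⟨a, b⟩)) := by
  refine (congrArg (fun t => κ.coproj F X a b ≫ post t) (comp_post_natπ f g _)).trans ?_
  rw [← post_post, Category.assoc]

lemma coproj_post_eId (F : EnrichedFunctor V A V) (X : EnrichedFunctor V A K) (a b : A) :
    κ.coproj F X a b ≫ post (eId V (act.obj ⟨F, X⟩) ≫ natπ _ _ (m.tensor.obj ⟨a, b⟩)) =
      κ.coproj F X a b :=
  (congrArg (fun t => κ.coproj F X a b ≫ post t) (functorCategory_eId_π _ _)).trans
    (by rw [post_eId, Category.comp_id])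

lemma adjCounit_natural (X Y Y' : EnrichedFunctor V A K) :
    mapFst act X (angleMap m X Y Y') ≫ post (κ.adjCounit X Y') =
      𝟙 (Y ⟶[V] Y') ≫ pre (κ.adjCounit X Y) := by
  refine κ.hom_ext fun a b => ?_
  refine (κ.gcomp_coproj_post _ _ a b).trans ?_
  refine Eq.trans ?_ (κ.gcomp_coproj_pre _ _ a b).symm
  rw [coproj_adjCounit]
  refine (congrArg (fun t => t ≫ post _) (κ.gcomp_coproj_mapFst _ _ X a b _)).trans ?_
  rw [Category.assoc, coproj_adjCounit]
  have h := unc_angleMap_π (m := m) X Y Y' a b (𝟙 _)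
  rw [Category.id_comp] at h
  exact h

/-- The counit sends `coproj` to `angleπ`, and the unit sends `angleπ` back to `coproj`. Testing on
the universal family therefore gives the identity; the other triangle is the same computation tested
on `angleπ`. -/
lemma adj_left_triangle (X : EnrichedFunctor V A K) (F : EnrichedFunctor V A V) :
    mapFst act X (κ.adjUnit X F) ≫ post (κ.adjCounit X (act.obj ⟨F, X⟩)) =
      eId V (act.obj ⟨F, X⟩) := by
  refine κ.hom_ext_unit fun a b => ?_
  refine (κ.coproj_post _ _ a b).trans ?_
  refine (congrArg (fun t => t ≫ post _) (κ.coproj_mapFst _ _ X a b _)).trans ?_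
  rw [Category.assoc, coproj_adjCounit]
  exact (κ.adjUnit_π X F a b).trans (κ.coproj_post_eId F X a b).symm

lemma adj_right_triangle (X Y : EnrichedFunctor V A K) :
    κ.adjUnit X (angle m X Y) ≫ post (κ.adjCounit X Y ≫ angleMap m X _ Y) =
      eId V (angle m X Y) := by
  refine natObj_unit_ext fun a => angle_hom_ext fun b => ?_
  refine (congrArg (fun t => mor t ≫ angleπ X Y a b) (comp_post_natπ _ _ a)).trans ?_
  rw [mor_comp, Category.assoc]
  refine (congrArg (fun t => mor _ ≫ t) (mor_angleMap_π X _ Y a b _)).trans ?_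
  refine (Category.assoc _ _ _).symm.trans ((congrArg (fun t => t ≫ post _)
    (κ.adjUnit_π X _ a b)).trans ?_)
  refine (κ.coproj_adjCounit X Y a b).trans ?_
  refine Eq.trans ?_ (congrArg (fun t => mor t ≫ angleπ X Y a b) (functorCategory_eId_π _ _)).symm
  rw [mor_eId, Category.id_comp]

/-- The adjunction between `- * X` and `⟨X, -⟩`. -/
def adjunction (X : EnrichedFunctor V A K) : Adjunction (fixRight act X) (angleFunctor m X) where
  unit F := ForgetEnrichment.homOf V (κ.adjUnit X F)
  counit Y := ForgetEnrichment.homOf V (κ.adjCounit X Y)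
  unit_natural := isNatural_unit_iff.mpr fun F F' => by
    refine (Category.id_comp _).trans ((κ.adjUnit_natural X F F').trans ?_)
    exact congrArg (fun t => (t ≫ angleMap m X _ _) ≫ pre (κ.adjUnit X F)) (Category.id_comp _)
  counit_natural := isNatural_unit_iff.mpr fun Y Y' => κ.adjCounit_natural X Y Y'
  left_triangle F := (homTo_comp_eq _ _).trans ((κ.adj_left_triangle X F).trans
    (ForgetEnrichment.homTo_id V (ForgetEnrichment.of V (act.obj ⟨F, X⟩))).symm)
  right_triangle Y := (homTo_comp_eq _ _).trans ((κ.adj_right_triangle X Y).trans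
    (ForgetEnrichment.homTo_id V (ForgetEnrichment.of V (angle m X Y))).symm)

end Convolution

end convolution

/-! ### Partial V-functors of composites in three variables -/

section threeVariables
variable [BraidedCategory V]
variable {A₁ : Type u₁} [EnrichedCategory V A₁] {A₂ : Type u₂} [EnrichedCategory V A₂]
  {A₃ : Type u₃} [EnrichedCategory V A₃] {B : Type u₄} [EnrichedCategory V B]
  {D : Type u₅} [EnrichedCategory V D]

lemma leftNested_aux {M Q N L R : V} (u : M ⟶ Q) (f : Q ⟶ N) (e : 𝟙_ V ⟶ L) (q : N ⊗ L ⟶ R) :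
    u ≫ ((ρ_ Q).inv ≫ (𝟙 Q ⊗ₘ e)) ≫ (f ⊗ₘ 𝟙 L) ≫ q =
      (u ≫ f) ≫ ((ρ_ N).inv ≫ (𝟙 N ⊗ₘ e)) ≫ q := by
  simp only [id_tensorHom, tensorHom_id, Category.assoc]
  rw [whisker_exchange_assoc, rightUnitor_inv_naturality_assoc f]

lemma leftNested_aux' {M Q L R : V} {e : 𝟙_ V ⟶ Q} {e' : 𝟙_ V ⟶ L} {g : Q ⟶ L} (h : e ≫ g = e')
    (q : L ⊗ M ⟶ R) :
    ((λ_ M).inv ≫ (e ⊗ₘ 𝟙 M)) ≫ (g ⊗ₘ 𝟙 M) ≫ q = ((λ_ M).inv ≫ (e' ⊗ₘ 𝟙 M)) ≫ q := by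
  rw [Category.assoc, tensorHom_comp_tensorHom_assoc, h, Category.id_comp, Category.assoc]

lemma rightNested_aux₁ {M N L Q R : V} {e : 𝟙_ V ⟶ N} {e' : 𝟙_ V ⟶ L} {f : N ⊗ L ⟶ Q}
    {e'' : 𝟙_ V ⟶ Q} (h : ((λ_ (𝟙_ V)).inv ≫ (e ⊗ₘ e')) ≫ f = e'') (q : M ⊗ Q ⟶ R) :
    ((ρ_ M).inv ≫ (𝟙 M ⊗ₘ e)) ≫ ((ρ_ _).inv ≫ (𝟙 _ ⊗ₘ e')) ≫ (α_ _ _ _).hom ≫ (𝟙 M ⊗ₘ f) ≫ q =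
      ((ρ_ M).inv ≫ (𝟙 M ⊗ₘ e'')) ≫ q := by
  have h' : (ρ_ M).inv ≫ M ◁ e ≫ (ρ_ _).inv ≫ (M ⊗ N) ◁ e' ≫ (α_ _ _ _).hom =
      (ρ_ M).inv ≫ M ◁ ((λ_ (𝟙_ V)).inv ≫ (e ⊗ₘ e')) := by
    rw [MonoidalCategory.tensorHom_def]
    monoidal
  rw [← h]
  simp only [id_tensorHom, Category.assoc]
  rw [reassoc_of% h']
  simp only [MonoidalCategory.whiskerLeft_comp, Category.assoc]

lemma rightNested_aux₂ {M N L Q R : V} (e : 𝟙_ V ⟶ N) (e' : 𝟙_ V ⟶ L) (f : M ⊗ L ⟶ Q)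
    (q : N ⊗ Q ⟶ R) :
    ((λ_ M).inv ≫ (e ⊗ₘ 𝟙 M)) ≫ ((ρ_ _).inv ≫ (𝟙 _ ⊗ₘ e')) ≫ (α_ _ _ _).hom ≫ (𝟙 N ⊗ₘ f) ≫ q =
      (((ρ_ M).inv ≫ (𝟙 M ⊗ₘ e')) ≫ f) ≫ ((λ_ Q).inv ≫ (e ⊗ₘ 𝟙 Q)) ≫ q := by
  have h : (λ_ M).inv ≫ e ▷ M ≫ (ρ_ _).inv ≫ (N ⊗ M) ◁ e' ≫ (α_ _ _ _).hom =
      (ρ_ M).inv ≫ M ◁ e' ≫ (λ_ _).inv ≫ e ▷ _ := by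
    rw [leftUnitor_inv_naturality_assoc, whisker_exchange]
    monoidal
  simp only [id_tensorHom, tensorHom_id, Category.assoc]
  rw [reassoc_of% h, ← whisker_exchange_assoc, leftUnitor_inv_naturality_assoc f]

lemma rightNested_aux₃ {M N L Q R : V} (e : 𝟙_ V ⟶ N) (e' : 𝟙_ V ⟶ L) (f : L ⊗ M ⟶ Q)
    (q : N ⊗ Q ⟶ R) :
    ((λ_ M).inv ≫ (((λ_ (𝟙_ V)).inv ≫ (e ⊗ₘ e')) ⊗ₘ 𝟙 M)) ≫ (α_ _ _ _).hom ≫ (𝟙 N ⊗ₘ f) ≫ q =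
      (((λ_ M).inv ≫ (e' ⊗ₘ 𝟙 M)) ≫ f) ≫ ((λ_ Q).inv ≫ (e ⊗ₘ 𝟙 Q)) ≫ q := by
  have h : (λ_ M).inv ≫ ((λ_ (𝟙_ V)).inv ≫ (e ⊗ₘ e')) ▷ M ≫ (α_ _ _ _).hom =
      (λ_ M).inv ≫ e' ▷ M ≫ (λ_ _).inv ≫ e ▷ _ := by
    rw [MonoidalCategory.tensorHom_def' e e', leftUnitor_inv_naturality_assoc]
    monoidal
  simp only [id_tensorHom, tensorHom_id, Category.assoc]
  rw [reassoc_of% h, ← whisker_exchange_assoc, leftUnitor_inv_naturality_assoc f]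

section left
variable (B₁ : EnrichedFunctor V (TensorObj A₁ A₂) B) (B₂ : EnrichedFunctor V (TensorObj B A₃) D)

/-- This lemma and the five after it compare the partial functors of a nested composite with the
composites of partial functors. Identities inserted in the fixed variables are absorbed by
coherence, and by `map_id` of the inner functor when they fill both of its variables. -/
lemma leftNested_map₁ (a a' : A₁) (b : A₂) (c : A₃) :
    (fixRight (fixRight ((prodFunctor B₁ (EnrichedFunctor.id V A₃)).comp V B₂) c) b).map a a' =
      (fixRight B₁ b).map a a' ≫ (fixRight B₂ c).map (B₁.obj ⟨a, b⟩) (B₁.obj ⟨a', b⟩) :=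
  leftNested_aux _ _ _ _

lemma leftNested_map₂ (a : A₁) (b b' : A₂) (c : A₃) :
    (fixLeft (fixRight ((prodFunctor B₁ (EnrichedFunctor.id V A₃)).comp V B₂) c) a).map b b' =
      (fixLeft B₁ a).map b b' ≫ (fixRight B₂ c).map (B₁.obj ⟨a, b⟩) (B₁.obj ⟨a, b'⟩) :=
  leftNested_aux _ _ _ _

lemma leftNested_map₃ (a : A₁) (b : A₂) (c c' : A₃) :
    (fixLeft ((prodFunctor B₁ (EnrichedFunctor.id V A₃)).comp V B₂) ⟨a, b⟩).map c c' =
      (fixLeft B₂ (B₁.obj ⟨a, b⟩)).map c c' :=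
  leftNested_aux' (B₁.map_id ⟨a, b⟩) _

end left

section right
variable (B₁ : EnrichedFunctor V (TensorObj A₂ A₃) B) (B₂ : EnrichedFunctor V (TensorObj A₁ B) D)

lemma rightNested_map₁ (a a' : A₁) (b : A₂) (c : A₃) :
    (fixRight (fixRight ((assocFunctor A₁ A₂ A₃).comp V
      ((prodFunctor (EnrichedFunctor.id V A₁) B₁).comp V B₂)) c) b).map a a' =
      (fixRight B₂ (B₁.obj ⟨b, c⟩)).map a a' :=
  rightNested_aux₁ (B₁.map_id ⟨b, c⟩) _

lemma rightNested_map₂ (a : A₁) (b b' : A₂) (c : A₃) :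
    (fixLeft (fixRight ((assocFunctor A₁ A₂ A₃).comp V
      ((prodFunctor (EnrichedFunctor.id V A₁) B₁).comp V B₂)) c) a).map b b' =
      (fixRight B₁ c).map b b' ≫ (fixLeft B₂ a).map (B₁.obj ⟨b, c⟩) (B₁.obj ⟨b', c⟩) :=
  rightNested_aux₂ _ _ _ _

lemma rightNested_map₃ (a : A₁) (b : A₂) (c c' : A₃) :
    (fixLeft ((assocFunctor A₁ A₂ A₃).comp V
      ((prodFunctor (EnrichedFunctor.id V A₁) B₁).comp V B₂)) ⟨a, b⟩).map c c' =
      (fixLeft B₁ b).map c c' ≫ (fixLeft B₂ a).map (B₁.obj ⟨b, c⟩) (B₁.obj ⟨b, c'⟩) :=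
  rightNested_aux₃ _ _ _ _

end right

end threeVariables

/-! ### Generalized bilinear families and trilinear families -/

section convolution
variable [SymmetricCategory V] [MonoidalClosed V] [HasLimits V]
variable {A : Type w} [EnrichedCategory V A] {m : MonoidalStructure V A}
variable {K : Type u₁} [EnrichedCategory V K] {P : Copowers V K}

/-- A family of morphisms `G(b) ⊗ U ⟶ K(X(c), Y(m(b, c)))` that is `V`-natural in `b` and `c`. -/
structure IsBilinearFamily (m : MonoidalStructure V A) (G : EnrichedFunctor V A V)
    (X Y : EnrichedFunctor V A K) {U : V}
    (s : ∀ b c, G.obj b ⊗ U ⟶ (X.obj c ⟶[V] Y.obj (m.tensor.obj ⟨b, c⟩))) : Prop where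
  left (b b' c : A) : (α_ _ _ _).inv ≫ actR G b b' ▷ U ≫ s b' c =
    G.obj b ◁ (β_ _ _).hom ≫ (α_ _ _ _).inv ≫ gcomp (s b c) (mapL m Y b b' c)
  right (b c c' : A) : Sq (X.map c c') (s b c') (s b c) (mapR m Y b c c')

namespace IsBilinearFamily
variable {G : EnrichedFunctor V A V} {X Y : EnrichedFunctor V A K} {U : V}
  {s : ∀ b c, G.obj b ⊗ U ⟶ (X.obj c ⟶[V] Y.obj (m.tensor.obj ⟨b, c⟩))}
  (h : IsBilinearFamily m G X Y s)

/-- The morphisms `G(b) ⊗ U ⟶ ⟨X, Y⟩(b)` corresponding to a family natural in `c`. -/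
def angleLift (b : A) : G.obj b ⊗ U ⟶ (angle m X Y).obj b :=
  natLift X (shift m Y b) (s b) (h.right b)

lemma angleLift_π (b c : A) : h.angleLift b ≫ angleπ X Y b c = s b c :=
  natLift_π _ _ _ _ _

/-- Projected to c, naturality in b is precisely the condition `left`. Thus a bilinear family of
shape U is a single element U ⟶ [A,V](G, ⟨X,Y⟩). -/
lemma angleLift_natural : IsNatural G (angle m X Y) fun b => cur (h.angleLift b) := by
  intro b b'
  refine sq_iff_unc.mpr (angle_hom_ext fun c => ?_)
  rw [unc_cur, unc_cur, Category.assoc, Category.assoc, h.angleLift_π]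
  refine (h.left b b' c).trans ?_
  have e : unc ((angle m X Y).map b b') ≫ angleπ X Y b' c =
      gcomp (angleπ X Y b c) (mapL m Y b b' c) := actR_angle_π X Y b b' c
  simp only [Category.assoc]
  rw [e, gcomp_whisker, h.angleLift_π]

end IsBilinearFamily

namespace Convolution
variable {act : EnrichedFunctor V (TensorObj (EnrichedFunctor V A V) (EnrichedFunctor V A K))
    (EnrichedFunctor V A K)} (κ : Convolution m P act)

/-- The universal property of `G * X`, for generalized elements. -/
lemma exists_of_isBilinearFamily {G : EnrichedFunctor V A V} {X Y : EnrichedFunctor V A K} {U : V}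
    {s : ∀ b c, G.obj b ⊗ U ⟶ (X.obj c ⟶[V] Y.obj (m.tensor.obj ⟨b, c⟩))}
    (h : IsBilinearFamily m G X Y s) :
    ∃ g : U ⟶ (act.obj ⟨G, X⟩ ⟶[V] Y),
      ∀ b c, gcomp (κ.coproj G X b c) (g ≫ natπ _ _ (m.tensor.obj ⟨b, c⟩)) = s b c := by
  -- The element of [A,V](G, ⟨X,Y⟩) of shape U is carried across the adjunction: apply - * X, then
  -- the counit. This reduces arbitrary shapes to the universal property already proved for
  -- morphisms.
  refine ⟨mapFst act X (natLift G (angle m X Y) _ h.angleLift_natural :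
    U ⟶ (G ⟶[V] angle m X Y)) ≫ post (κ.adjCounit X Y), fun b c => ?_⟩
  refine (κ.gcomp_coproj_post _ _ b c).trans ?_
  refine (congrArg (fun t => t ≫ post _) (κ.gcomp_coproj_mapFst _ _ X b c _)).trans ?_
  rw [natLift_π, unc_cur, Category.assoc, coproj_adjCounit, h.angleLift_π]

end Convolution

/-- A family of morphisms `G(b) ⊗ F(a) ⟶ K(X(c), T(a, b, c))` that is `V`-natural in `a`, `b` and
`c`. -/
structure IsTrilinear (F G : EnrichedFunctor V A V) (X : EnrichedFunctor V A K)
    (T : EnrichedFunctor V (TensorObj (TensorObj A A) A) K)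
    (s : ∀ a b c, G.obj b ⊗ F.obj a ⟶ (X.obj c ⟶[V] T.obj ⟨⟨a, b⟩, c⟩)) : Prop where
  fst (a a' b c : A) : gcomp (s a b c) ((fixRight (fixRight T c) b).map a a') =
    ((α_ _ _ _).hom ≫ G.obj b ◁ actR F a a') ≫ s a' b c
  snd (a b b' c : A) : gcomp (s a b c) ((fixLeft (fixRight T c) a).map b b') =
    ((α_ _ _ _).hom ≫ G.obj b ◁ (β_ _ _).hom ≫ (α_ _ _ _).inv ≫ actR G b b' ▷ F.obj a) ≫ s a b' c
  thd (a b c c' : A) : Sq (X.map c c') (s a b c') (s a b c) ((fixLeft T ⟨a, b⟩).map c c')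

lemma IsTrilinear.post {F G : EnrichedFunctor V A V} {X : EnrichedFunctor V A K}
    {T T' : EnrichedFunctor V (TensorObj (TensorObj A A) A) K}
    {s : ∀ a b c, G.obj b ⊗ F.obj a ⟶ (X.obj c ⟶[V] T.obj ⟨⟨a, b⟩, c⟩)}
    (h : IsTrilinear F G X T s) {θ : ∀ p, 𝟙_ V ⟶ (T.obj p ⟶[V] T'.obj p)} (hθ : IsNatural T T' θ) :
    IsTrilinear F G X T' fun a b c => s a b c ≫ post (θ ⟨⟨a, b⟩, c⟩) where
  fst a a' b c := by
    have e := isNatural_unit_iff.mp ((hθ.whiskerLeft (insertRight _ c)).whiskerLeft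
      (insertRight _ b)) a a'
    have e' := congrArg (fun t => t ≫ VCat.post (θ ⟨⟨a', b⟩, c⟩)) (h.fst a a' b c)
    exact (gcomp_post_left _ _ _).trans ((congrArg (gcomp _) e.symm).trans
      ((gcomp_post _ _ _).trans (e'.trans (Category.assoc _ _ _))))
  snd a b b' c := by
    have e := isNatural_unit_iff.mp ((hθ.whiskerLeft (insertRight _ c)).whiskerLeft
      (insertLeft _ a)) b b'
    have e' := congrArg (fun t => t ≫ VCat.post (θ ⟨⟨a, b'⟩, c⟩)) (h.snd a b b' c)
    exact (gcomp_post_left _ _ _).trans ((congrArg (gcomp _) e.symm).trans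
      ((gcomp_post _ _ _).trans (e'.trans (Category.assoc _ _ _))))
  thd a b := IsNatural.post (F := X) (G := fixLeft T ⟨a, b⟩) (H := fixLeft T' ⟨a, b⟩) (h.thd a b)
    (hθ.whiskerLeft (insertLeft _ _))

variable (m) in
/-- The `V`-functor `(a, b, c) ↦ W(m(m(a, b), c))`. -/
def leftNested (W : EnrichedFunctor V A K) :
    EnrichedFunctor V (TensorObj (TensorObj A A) A) K :=
  (prodFunctor m.tensor (EnrichedFunctor.id V A)).comp V (m.tensor.comp V W)

variable (m) in
/-- The `V`-functor `(a, b, c) ↦ W(m(a, m(b, c)))`. -/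
def rightNested (W : EnrichedFunctor V A K) :
    EnrichedFunctor V (TensorObj (TensorObj A A) A) K :=
  (assocFunctor A A A).comp V
    ((prodFunctor (EnrichedFunctor.id V A) m.tensor).comp V (m.tensor.comp V W))

/-- The action of `W` on the associator of `A`. -/
def assocMap (m : MonoidalStructure V A) (W : EnrichedFunctor V A K) (p : TensorObj (TensorObj A A) A) :
    𝟙_ V ⟶ ((leftNested m W).obj p ⟶[V] (rightNested m W).obj p) :=
  mapHom W (m.assoc.iso p).hom

/-- The action of `W` on the inverse of the associator of `A`. -/
def assocMapInv (m : MonoidalStructure V A) (W : EnrichedFunctor V A K) (p : TensorObj (TensorObj A A) A) :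
    𝟙_ V ⟶ ((rightNested m W).obj p ⟶[V] (leftNested m W).obj p) :=
  mapHom W (m.assoc.iso p).inv

lemma mapHom_comp (W : EnrichedFunctor V A K) {a b c : A}
    (f : ForgetEnrichment.of V a ⟶ ForgetEnrichment.of V b)
    (g : ForgetEnrichment.of V b ⟶ ForgetEnrichment.of V c) :
    mapHom W f ≫ VCat.post (mapHom W g) = mapHom W (f ≫ g) := by
  refine (Category.assoc _ _ _).trans ((congrArg (fun t => _ ≫ t) (post_map W _).symm).trans ?_)
  refine (Category.assoc _ _ _).symm.trans ?_
  exact congrArg (fun t => t ≫ W.map a c) (homTo_comp_eq f g).symm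

lemma mapHom_id (W : EnrichedFunctor V A K) (a : A) :
    mapHom W (𝟙 (ForgetEnrichment.of V a)) = eId V (W.obj a) :=
  (congrArg (fun t => t ≫ W.map a a) (ForgetEnrichment.homTo_id V _)).trans (W.map_id a)

lemma assocMap_comp_inv (W : EnrichedFunctor V A K) (p : TensorObj (TensorObj A A) A) :
    assocMap m W p ≫ VCat.post (assocMapInv m W p) = eId V _ :=
  (mapHom_comp W _ _).trans ((congrArg (mapHom W) (m.assoc.iso p).hom_inv_id).trans
    (mapHom_id W _))

lemma assocMapInv_comp (W : EnrichedFunctor V A K) (p : TensorObj (TensorObj A A) A) :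
    assocMapInv m W p ≫ VCat.post (assocMap m W p) = eId V _ :=
  (mapHom_comp W _ _).trans ((congrArg (mapHom W) (m.assoc.iso p).inv_hom_id).trans
    (mapHom_id W _))

/-- Naturality of s is composed with the inverse at both ends; the inverses then cancel because
precomposition and postcomposition commute. -/
lemma isNatural_inv {C : Type u₂} [EnrichedCategory V C] {D : Type u₃} [EnrichedCategory V D]
    {F G : EnrichedFunctor V C D} {s : ∀ c, 𝟙_ V ⟶ (F.obj c ⟶[V] G.obj c)}
    {t : ∀ c, 𝟙_ V ⟶ (G.obj c ⟶[V] F.obj c)} (hst : ∀ c, s c ≫ VCat.post (t c) = eId V _)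
    (hts : ∀ c, t c ≫ VCat.post (s c) = eId V _) (hs : IsNatural F G s) : IsNatural G F t := by
  refine isNatural_unit_iff.mpr fun c c' => ?_
  have h := congrArg (fun u => u ≫ VCat.pre (t c) ≫ VCat.post (t c')) (isNatural_unit_iff.mp hs c c')
  simp only [Category.assoc] at h
  have e₁ : (VCat.pre (s c) : (G.obj c ⟶[V] G.obj c') ⟶ _) ≫ VCat.pre (t c) = 𝟙 _ := by
    rw [pre_pre, hts, pre_eId]
  have e₂ : (VCat.post (s c') : (F.obj c ⟶[V] F.obj c') ⟶ _) ≫ VCat.post (t c') = 𝟙 _ := by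
    rw [post_post, hst, post_eId]
  rw [reassoc_of% e₁, pre_post, reassoc_of% e₂] at h
  exact h.symm

lemma assocMap_natural (W : EnrichedFunctor V A K) :
    IsNatural (leftNested m W) (rightNested m W) (assocMap m W) :=
  (m.assoc.natural.whiskerRight W).congr (fun _ _ => (Category.assoc _ _ _).symm)
    fun _ _ => ((Category.assoc _ _ _).trans (congrArg (fun t => _ ≫ t) (Category.assoc _ _ _))).symm

lemma assocMapInv_natural (W : EnrichedFunctor V A K) :
    IsNatural (rightNested m W) (leftNested m W) (assocMapInv m W) :=
  isNatural_inv (assocMap_comp_inv W) (assocMapInv_comp W) (assocMap_natural W)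

variable (m) in
/-- A family `G(b) ⊗ F(a) ⟶ K(X(c), W(m(m(a, b), c)))` that is `V`-natural in `a`, `b` and `c`. -/
def IsLeftTrilinear (F G : EnrichedFunctor V A V) (X W : EnrichedFunctor V A K)
    (s : ∀ a b c, G.obj b ⊗ F.obj a ⟶
      (X.obj c ⟶[V] W.obj (m.tensor.obj ⟨m.tensor.obj ⟨a, b⟩, c⟩))) : Prop :=
  IsTrilinear F G X (leftNested m W) s

variable (m) in
/-- A family `G(b) ⊗ F(a) ⟶ K(X(c), W(m(a, m(b, c))))` that is `V`-natural in `a`, `b` and `c`. -/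
def IsRightTrilinear (F G : EnrichedFunctor V A V) (X W : EnrichedFunctor V A K)
    (s : ∀ a b c, G.obj b ⊗ F.obj a ⟶
      (X.obj c ⟶[V] W.obj (m.tensor.obj ⟨a, m.tensor.obj ⟨b, c⟩⟩))) : Prop :=
  IsTrilinear F G X (rightNested m W) s

variable (m) in
/-- The associator of `A`. -/
def assocIso (a b c : A) : ForgetEnrichment.of V (m.tensor.obj ⟨m.tensor.obj ⟨a, b⟩, c⟩) ≅
    ForgetEnrichment.of V (m.tensor.obj ⟨a, m.tensor.obj ⟨b, c⟩⟩) :=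
  m.assoc.iso ⟨⟨a, b⟩, c⟩

variable (m) in
/-- The left unitor of `A`. -/
def leftUnitorIso (a : A) : ForgetEnrichment.of V (m.tensor.obj ⟨m.unit, a⟩) ≅
    ForgetEnrichment.of V a :=
  m.leftUnitor.iso a

variable (m) in
/-- The right unitor of `A`. -/
def rightUnitorIso (a : A) : ForgetEnrichment.of V (m.tensor.obj ⟨a, m.unit⟩) ≅
    ForgetEnrichment.of V a :=
  m.rightUnitor.iso a

lemma IsLeftTrilinear.assoc {F G : EnrichedFunctor V A V} {X W : EnrichedFunctor V A K}
    {s : ∀ a b c, G.obj b ⊗ F.obj a ⟶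
      (X.obj c ⟶[V] W.obj (m.tensor.obj ⟨m.tensor.obj ⟨a, b⟩, c⟩))}
    (h : IsLeftTrilinear m F G X W s) : IsRightTrilinear m F G X W fun a b c =>
      s a b c ≫ VCat.post (mapHom W (assocIso m a b c).hom) :=
  IsTrilinear.post h (assocMap_natural W)

lemma IsRightTrilinear.assocInv {F G : EnrichedFunctor V A V} {X W : EnrichedFunctor V A K}
    {s : ∀ a b c, G.obj b ⊗ F.obj a ⟶
      (X.obj c ⟶[V] W.obj (m.tensor.obj ⟨a, m.tensor.obj ⟨b, c⟩⟩))}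
    (h : IsRightTrilinear m F G X W s) : IsLeftTrilinear m F G X W fun a b c =>
      s a b c ≫ VCat.post (mapHom W (assocIso m a b c).inv) :=
  IsTrilinear.post h (assocMapInv_natural W)

section maps

variable (m) in
/-- The action of `m(-, b)` on hom-objects. -/
def tensorMapL (a a' b : A) :
    (a ⟶[V] a') ⟶ (m.tensor.obj ⟨a, b⟩ ⟶[V] m.tensor.obj ⟨a', b⟩) :=
  (fixRight m.tensor b).map a a'

variable (m) in
/-- The action of `m(a, -)` on hom-objects. -/
def tensorMapR (a b b' : A) :
    (b ⟶[V] b') ⟶ (m.tensor.obj ⟨a, b⟩ ⟶[V] m.tensor.obj ⟨a, b'⟩) :=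
  (fixLeft m.tensor a).map b b'

variable (W : EnrichedFunctor V A K)

lemma mapL_eq_comp (a a' b : A) : mapL m W a a' b =
    tensorMapL m a a' b ≫ W.map (m.tensor.obj ⟨a, b⟩) (m.tensor.obj ⟨a', b⟩) :=
  (Category.assoc _ _ _).symm

lemma mapR_eq_comp (a b b' : A) : mapR m W a b b' =
    tensorMapR m a b b' ≫ W.map (m.tensor.obj ⟨a, b⟩) (m.tensor.obj ⟨a, b'⟩) :=
  (Category.assoc _ _ _).symm

lemma mapL_shift (a b b' c : A) : mapL m (shift m W a) b b' c =
    tensorMapL m b b' c ≫ mapR m W a (m.tensor.obj ⟨b, c⟩) (m.tensor.obj ⟨b', c⟩) :=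
  mapL_eq_comp (shift m W a) b b' c

lemma mapR_shift (a b c c' : A) : mapR m (shift m W a) b c c' =
    tensorMapR m b c c' ≫ mapR m W a (m.tensor.obj ⟨b, c⟩) (m.tensor.obj ⟨b, c'⟩) :=
  mapR_eq_comp (shift m W a) b c c'

variable {F G : EnrichedFunctor V A V} {X W : EnrichedFunctor V A K}

/-- The three conditions in `IsTrilinear` refer to partial functors of a nested composite. Here they
are expressed through the one-variable actions of m and of W, the form in which conditions of
bilinear families can be applied. -/
lemma isLeftTrilinear_iff {s : ∀ a b c, G.obj b ⊗ F.obj a ⟶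
      (X.obj c ⟶[V] W.obj (m.tensor.obj ⟨m.tensor.obj ⟨a, b⟩, c⟩))} :
    IsLeftTrilinear m F G X W s ↔
      (∀ a a' b c, gcomp (s a b c) (tensorMapL m a a' b ≫
        mapL m W (m.tensor.obj ⟨a, b⟩) (m.tensor.obj ⟨a', b⟩) c) =
          ((α_ _ _ _).hom ≫ G.obj b ◁ actR F a a') ≫ s a' b c) ∧
      (∀ a b b' c, gcomp (s a b c) (tensorMapR m a b b' ≫
        mapL m W (m.tensor.obj ⟨a, b⟩) (m.tensor.obj ⟨a, b'⟩) c) =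
          ((α_ _ _ _).hom ≫ G.obj b ◁ (β_ _ _).hom ≫ (α_ _ _ _).inv ≫
            actR G b b' ▷ F.obj a) ≫ s a b' c) ∧
      ∀ a b c c', Sq (X.map c c') (s a b c') (s a b c) (mapR m W (m.tensor.obj ⟨a, b⟩) c c') := by
  have e₁ (a a' b c : A) : (fixRight (fixRight (leftNested m W) c) b).map a a' =
      tensorMapL m a a' b ≫ mapL m W (m.tensor.obj ⟨a, b⟩) (m.tensor.obj ⟨a', b⟩) c :=
    leftNested_map₁ _ _ _ _ _ _
  have e₂ (a b b' c : A) : (fixLeft (fixRight (leftNested m W) c) a).map b b' =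
      tensorMapR m a b b' ≫ mapL m W (m.tensor.obj ⟨a, b⟩) (m.tensor.obj ⟨a, b'⟩) c :=
    leftNested_map₂ _ _ _ _ _ _
  have e₃ (a b c c' : A) : (fixLeft (leftNested m W) ⟨a, b⟩).map c c' =
      mapR m W (m.tensor.obj ⟨a, b⟩) c c' := leftNested_map₃ _ _ _ _ _ _
  refine ⟨fun h => ⟨fun a a' b c => ?_, fun a b b' c => ?_, fun a b c c' => ?_⟩,
    fun h => ⟨fun a a' b c => ?_, fun a b b' c => ?_, fun a b c c' => ?_⟩⟩
  · exact (congrArg (gcomp _) (e₁ a a' b c)).symm.trans (h.fst a a' b c)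
  · exact (congrArg (gcomp _) (e₂ a b b' c)).symm.trans (h.snd a b b' c)
  · exact (h.thd a b c c').trans (congrArg (fun t => _ ≫ gcomp _ t) (e₃ a b c c'))
  · exact (congrArg (gcomp _) (e₁ a a' b c)).trans (h.1 a a' b c)
  · exact (congrArg (gcomp _) (e₂ a b b' c)).trans (h.2.1 a b b' c)
  · exact (h.2.2 a b c c').trans (congrArg (fun t => _ ≫ gcomp _ t) (e₃ a b c c').symm)

lemma isRightTrilinear_iff {s : ∀ a b c, G.obj b ⊗ F.obj a ⟶
      (X.obj c ⟶[V] W.obj (m.tensor.obj ⟨a, m.tensor.obj ⟨b, c⟩⟩))} :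
    IsRightTrilinear m F G X W s ↔
      (∀ a a' b c, gcomp (s a b c) (mapL m W a a' (m.tensor.obj ⟨b, c⟩)) =
          ((α_ _ _ _).hom ≫ G.obj b ◁ actR F a a') ≫ s a' b c) ∧
      (∀ a b b' c, gcomp (s a b c) (tensorMapL m b b' c ≫
        mapR m W a (m.tensor.obj ⟨b, c⟩) (m.tensor.obj ⟨b', c⟩)) =
          ((α_ _ _ _).hom ≫ G.obj b ◁ (β_ _ _).hom ≫ (α_ _ _ _).inv ≫
            actR G b b' ▷ F.obj a) ≫ s a b' c) ∧
      ∀ a b c c', Sq (X.map c c') (s a b c') (s a b c) (tensorMapR m b c c' ≫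
        mapR m W a (m.tensor.obj ⟨b, c⟩) (m.tensor.obj ⟨b, c'⟩)) := by
  have e₁ (a a' b c : A) : (fixRight (fixRight (rightNested m W) c) b).map a a' =
      mapL m W a a' (m.tensor.obj ⟨b, c⟩) := rightNested_map₁ _ _ _ _ _ _
  have e₂ (a b b' c : A) : (fixLeft (fixRight (rightNested m W) c) a).map b b' =
      tensorMapL m b b' c ≫ mapR m W a (m.tensor.obj ⟨b, c⟩) (m.tensor.obj ⟨b', c⟩) :=
    rightNested_map₂ _ _ _ _ _ _
  have e₃ (a b c c' : A) : (fixLeft (rightNested m W) ⟨a, b⟩).map c c' =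
      tensorMapR m b c c' ≫ mapR m W a (m.tensor.obj ⟨b, c⟩) (m.tensor.obj ⟨b, c'⟩) :=
    rightNested_map₃ _ _ _ _ _ _
  refine ⟨fun h => ⟨fun a a' b c => ?_, fun a b b' c => ?_, fun a b c c' => ?_⟩,
    fun h => ⟨fun a a' b c => ?_, fun a b b' c => ?_, fun a b c c' => ?_⟩⟩
  · exact (congrArg (gcomp _) (e₁ a a' b c)).symm.trans (h.fst a a' b c)
  · exact (congrArg (gcomp _) (e₂ a b b' c)).symm.trans (h.snd a b b' c)
  · exact (h.thd a b c c').trans (congrArg (fun t => _ ≫ gcomp _ t) (e₃ a b c c'))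
  · exact (congrArg (gcomp _) (e₁ a a' b c)).trans (h.1 a a' b c)
  · exact (congrArg (gcomp _) (e₂ a b b' c)).trans (h.2.1 a b b' c)
  · exact (h.2.2 a b c c').trans (congrArg (fun t => _ ≫ gcomp _ t) (e₃ a b c c').symm)

end maps

end convolution

/-! ### Universal properties of F * (G * X) and (F * G) * X -/

section convolution
variable [SymmetricCategory V] [MonoidalClosed V] [HasLimits V]
variable {A : Type w} [EnrichedCategory V A] {m : MonoidalStructure V A}
variable {K : Type u₁} [EnrichedCategory V K] {P : Copowers V K}

lemma gcomp_assoc_inv {C : Type u₂} [EnrichedCategory V C] {U₁ U₂ U₃ : V} {W X Y Z : C}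
    (f : U₁ ⟶ (W ⟶[V] X)) (g : U₂ ⟶ (X ⟶[V] Y)) (h : U₃ ⟶ (Y ⟶[V] Z)) :
    gcomp f (gcomp g h) = (α_ _ _ _).inv ≫ gcomp (gcomp f g) h := by
  rw [gcomp_assoc, Iso.inv_hom_id_assoc]

/-- Naturality in a comes from q, and naturality in c is a pasting of squares. For b, naturality of
q in its second variable moves the action from W to Y along m(-, c), after which naturality of p in
its first variable moves it to G. -/
lemma IsRightTrilinear.of_gcomp {F G : EnrichedFunctor V A V} {X Y W : EnrichedFunctor V A K}
    {p : ∀ b c, G.obj b ⟶ (X.obj c ⟶[V] Y.obj (m.tensor.obj ⟨b, c⟩))}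
    {q : ∀ a b, F.obj a ⟶ (Y.obj b ⟶[V] W.obj (m.tensor.obj ⟨a, b⟩))}
    (hp : IsBilinear m G X Y p) (hq : IsBilinear m F Y W q) :
    IsRightTrilinear m F G X W fun a b c =>
      gcomp (p b c) (q a (m.tensor.obj ⟨b, c⟩)) := by
  refine isRightTrilinear_iff.mpr ⟨fun a a' b c => ?_, fun a b b' c => ?_,
    fun a b c c' => ?_⟩
  · rw [gcomp_assoc, hq.left, ← whisker_gcomp, Category.assoc]
  · have h := Sq.precomp (hq.right a (m.tensor.obj ⟨b, c⟩) (m.tensor.obj ⟨b', c⟩)) (𝟙 _)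
      (tensorMapL m b b' c)
    rw [Category.id_comp, Category.id_comp, ← mapL_eq_comp, Sq] at h
    have h' := congrArg (fun t => (β_ _ _).hom ≫ t) h
    simp only [SymmetricCategory.symmetry_assoc] at h'
    rw [gcomp_assoc, ← h', ← whisker_gcomp, gcomp_assoc_inv, hp.left, ← gcomp_whisker]
    simp only [Category.assoc]
  · have := Sq.precomp (hq.right a (m.tensor.obj ⟨b, c⟩) (m.tensor.obj ⟨b, c'⟩)) (𝟙 _)
      (tensorMapR m b c c')
    rw [Category.id_comp, Category.id_comp, ← mapR_eq_comp] at this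
    exact (hp.right b c c').vcomp this

lemma unc_mapL_of_isBilinear {F G H : EnrichedFunctor V A V}
    {t : ∀ a b, F.obj a ⟶ EnrichedCategory.Hom (G.obj b) (H.obj (m.tensor.obj ⟨a, b⟩))}
    (ht : IsBilinear m F G H t) (a a' b : A) :
    unc (t a b) ▷ (a ⟶[V] a') ≫ unc (mapL m H a a' b) =
      (α_ _ _ _).hom ≫ G.obj b ◁ actR F a a' ≫ unc (t a' b) := by
  rw [← unc_comp, ← ht.left, unc_gcomp, Iso.hom_inv_id_assoc]

lemma unc_mapR_of_isBilinear {F G H : EnrichedFunctor V A V}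
    {t : ∀ a b, F.obj a ⟶ EnrichedCategory.Hom (G.obj b) (H.obj (m.tensor.obj ⟨a, b⟩))}
    (ht : IsBilinear m F G H t) (a b b' : A) :
    unc (t a b) ▷ (b ⟶[V] b') ≫ unc (mapR m H a b b') =
      (α_ _ _ _).hom ≫ G.obj b ◁ (β_ _ _).hom ≫ (α_ _ _ _).inv ≫ actR G b b' ▷ F.obj a ≫
        unc (t a b') := by
  have h := sq_iff_unc.mp (ht.right a b b')
  rw [actR, h, ← MonoidalCategory.whiskerLeft_comp_assoc, SymmetricCategory.symmetry,
    MonoidalCategory.whiskerLeft_id, Category.id_comp, Iso.hom_inv_id_assoc]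

lemma unc_mapL_eq (H : EnrichedFunctor V A V) (a a' b : A) :
    unc (mapL m H a a' b) = H.obj (m.tensor.obj ⟨a, b⟩) ◁ tensorMapL m a a' b ≫
      actR H (m.tensor.obj ⟨a, b⟩) (m.tensor.obj ⟨a', b⟩) := by
  rw [mapL_eq_comp]
  exact unc_comp _ _

lemma unc_mapR_eq (H : EnrichedFunctor V A V) (a b b' : A) :
    unc (mapR m H a b b') = H.obj (m.tensor.obj ⟨a, b⟩) ◁ tensorMapR m a b b' ≫
      actR H (m.tensor.obj ⟨a, b⟩) (m.tensor.obj ⟨a, b'⟩) := by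
  rw [mapR_eq_comp]
  exact unc_comp _ _

/-- For a and b, naturality of q in its first variable moves the action from W to H along m, and the
bilinearity of t moves it on to F or G. Naturality in c is that of q. -/
lemma IsLeftTrilinear.of_unc {F G H : EnrichedFunctor V A V} {X W : EnrichedFunctor V A K}
    {t : ∀ a b, F.obj a ⟶ EnrichedCategory.Hom (G.obj b) (H.obj (m.tensor.obj ⟨a, b⟩))}
    {q : ∀ x c, H.obj x ⟶ (X.obj c ⟶[V] W.obj (m.tensor.obj ⟨x, c⟩))}
    (ht : IsBilinear m F G H t) (hq : IsBilinear m H X W q) :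
    IsLeftTrilinear m F G X W fun a b c =>
      unc (t a b) ≫ q (m.tensor.obj ⟨a, b⟩) c := by
  refine isLeftTrilinear_iff.mpr ⟨fun a a' b c => ?_, fun a b b' c => ?_,
    fun a b c c' => ?_⟩
  · rw [← whisker_gcomp, ← gcomp_whisker, hq.left, whisker_exchange_assoc,
      ← Category.assoc (_ ◁ _), ← unc_mapL_eq, ← Category.assoc, unc_mapL_of_isBilinear ht]
    simp only [Category.assoc]
  · rw [← whisker_gcomp, ← gcomp_whisker, hq.left, whisker_exchange_assoc,
      ← Category.assoc (_ ◁ _), ← unc_mapR_eq, ← Category.assoc, unc_mapR_of_isBilinear ht]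
    simp only [Category.assoc]
  · have := Sq.precomp (hq.right (m.tensor.obj ⟨a, b⟩) c c') (unc (t a b)) (𝟙 _)
    rwa [Category.id_comp, Category.id_comp] at this

namespace IsRightTrilinear
variable {F G : EnrichedFunctor V A V} {X W : EnrichedFunctor V A K}

lemma isBilinearFamily {s : ∀ a b c, G.obj b ⊗ F.obj a ⟶
      (X.obj c ⟶[V] W.obj (m.tensor.obj ⟨a, m.tensor.obj ⟨b, c⟩⟩))}
    (h : IsRightTrilinear m F G X W s) (a : A) :
    IsBilinearFamily m G X (shift m W a) (s a) where
  left b b' c := by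
    rw [mapL_shift]
    refine Eq.trans ?_ (congrArg (fun t => _ ≫ _ ≫ t)
      ((isRightTrilinear_iff.mp h).2.1 a b b' c)).symm
    simp only [Category.assoc]
    rw [Iso.inv_hom_id_assoc, ← MonoidalCategory.whiskerLeft_comp_assoc,
      SymmetricCategory.symmetry, MonoidalCategory.whiskerLeft_id, Category.id_comp]
    rfl
  right b c c' := by
    rw [mapR_shift]
    exact (isRightTrilinear_iff.mp h).2.2 a b c c'

/-- For each fixed a the variables b and c have been absorbed into `g a`, so naturality in x is
automatic. Naturality in a may be tested after composing with p, and there it is the first condition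
on the trilinear family. The hypothesis `ext` is supplied by `natural_ext`. -/
lemma isBilinear_of_family {Y : EnrichedFunctor V A K} {s : ∀ a b c, G.obj b ⊗ F.obj a ⟶
      (X.obj c ⟶[V] W.obj (m.tensor.obj ⟨a, m.tensor.obj ⟨b, c⟩⟩))}
    (h : IsRightTrilinear m F G X W s)
    {p : ∀ b c, G.obj b ⟶ (X.obj c ⟶[V] Y.obj (m.tensor.obj ⟨b, c⟩))}
    {g : ∀ a, F.obj a ⟶ (Y ⟶[V] shift m W a)}
    (hg : ∀ a b c, gcomp (p b c) (g a ≫ natπ _ _ (m.tensor.obj ⟨b, c⟩)) = s a b c)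
    (ext : ∀ {Z : EnrichedFunctor V A K} {U : V} {f f' : ∀ x, U ⟶ (Y.obj x ⟶[V] Z.obj x)},
      IsNatural _ _ f → IsNatural _ _ f' → (∀ b c, gcomp (p b c) (f (m.tensor.obj ⟨b, c⟩)) =
        gcomp (p b c) (f' (m.tensor.obj ⟨b, c⟩))) → ∀ x, f x = f' x) :
    IsBilinear m F Y W fun a x => g a ≫ natπ Y (shift m W a) x where
  left a a' x := by
    have n₁ (a : A) := (natπ_natural Y (shift m W a)).precomp (g a)
    have n₂ := IsNatural.comp (n₁ a) (curryApp_natural (m.tensor.comp V W) a a')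
    refine ext (Z := shift m W a') n₂ ((n₁ a').precomp (actR F a a')) (fun b c => ?_) x
    have e : gcomp (p b c) (g a ≫ natπ Y (shift m W a) (m.tensor.obj ⟨b, c⟩)) = s a b c := hg a b c
    have e' : gcomp (p b c) (g a' ≫ natπ Y (shift m W a') (m.tensor.obj ⟨b, c⟩)) = s a' b c :=
      hg a' b c
    refine (gcomp_assoc_inv _ _ _).trans ?_
    refine (congrArg (fun t => _ ≫ gcomp t _) e).trans ?_
    refine Eq.trans ?_ (whisker_gcomp _ _ _)
    refine Eq.trans ?_ (congrArg (fun t => _ ≫ t) e').symm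
    rw [Iso.inv_comp_eq]
    exact ((isRightTrilinear_iff.mp h).1 a a' b c).trans (Category.assoc _ _ _)
  right a x x' := ((natπ_natural Y (shift m W a)).precomp (g a)) x x'

end IsRightTrilinear

namespace IsLeftTrilinear
variable {F G : EnrichedFunctor V A V} {X W : EnrichedFunctor V A K}
variable {s : ∀ a b c, G.obj b ⊗ F.obj a ⟶
    (X.obj c ⟶[V] W.obj (m.tensor.obj ⟨m.tensor.obj ⟨a, b⟩, c⟩))}
  (h : IsLeftTrilinear m F G X W s)

/-- The morphisms `G(b) ⊗ F(a) ⟶ ⟨X, W⟩(m(a, b))` corresponding to a family natural in `c`. -/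
def angleLift (a b : A) : G.obj b ⊗ F.obj a ⟶ (angle m X W).obj (m.tensor.obj ⟨a, b⟩) :=
  natLift X (shift m W (m.tensor.obj ⟨a, b⟩)) (s a b) fun c c' =>
    (isLeftTrilinear_iff.mp h).2.2 a b c c'

lemma angleLift_π (a b c : A) :
    h.angleLift a b ≫ angleπ X W (m.tensor.obj ⟨a, b⟩) c = s a b c :=
  natLift_π _ _ _ _ _

/-- Absorbing c into the end ⟨X,W⟩ leaves a family in a and b; its bilinearity is checked on the
projections of that end. -/
lemma angleLift_isBilinear :
    IsBilinear m F G (angle m X W) fun a b => cur (h.angleLift a b) where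
  left a a' b := unc_injective (angle_hom_ext fun c => by
    rw [unc_gcomp, unc_cur, unc_mapL_eq, unc_comp, unc_cur]
    simp only [Category.assoc]
    rw [h.angleLift_π, actR_angle_π, ← whisker_exchange_assoc, gcomp_whisker, h.angleLift_π,
      whisker_gcomp, (isLeftTrilinear_iff.mp h).1, Category.assoc, Iso.inv_hom_id_assoc])
  right a b b' := sq_iff_unc.mpr (angle_hom_ext fun c => by
    rw [unc_cur, unc_cur, unc_mapR_eq]
    simp only [Category.assoc]
    rw [h.angleLift_π, actR_angle_π, ← whisker_exchange_assoc, gcomp_whisker, h.angleLift_π,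
      whisker_gcomp, (isLeftTrilinear_iff.mp h).2.1]
    simp only [Category.assoc]
    rw [Iso.inv_hom_id_assoc, ← MonoidalCategory.whiskerLeft_comp_assoc, SymmetricCategory.symmetry,
      MonoidalCategory.whiskerLeft_id, Category.id_comp]
    rfl)

end IsLeftTrilinear

namespace Convolution
variable {act : EnrichedFunctor V (TensorObj (EnrichedFunctor V A V) (EnrichedFunctor V A K))
    (EnrichedFunctor V A K)}
  {tens : EnrichedFunctor V (TensorObj (EnrichedFunctor V A V) (EnrichedFunctor V A V))
    (EnrichedFunctor V A V)}
  (δ : Convolution m (selfCopowers V) tens) (κ : Convolution m P act)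

section
variable (F G : EnrichedFunctor V A V) (X : EnrichedFunctor V A K)

/-- The canonical morphism `G(b) ⊗ F(a) ⟶ (F * G)(m(a, b))`. -/
def τ (a b : A) : G.obj b ⊗ F.obj a ⟶ (tens.obj ⟨F, G⟩).obj (m.tensor.obj ⟨a, b⟩) :=
  unc (δ.coproj F G a b)

/-- The universal family for morphisms out of `F * (G * X)`. -/
def rightCoproj (a b c : A) : G.obj b ⊗ F.obj a ⟶ (X.obj c ⟶[V]
    (act.obj ⟨F, act.obj ⟨G, X⟩⟩).obj (m.tensor.obj ⟨a, m.tensor.obj ⟨b, c⟩⟩)) :=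
  gcomp (κ.coproj G X b c) (κ.coproj F (act.obj ⟨G, X⟩) a (m.tensor.obj ⟨b, c⟩))

/-- The universal family for morphisms out of `(F * G) * X`. -/
def leftCoproj (a b c : A) : G.obj b ⊗ F.obj a ⟶ (X.obj c ⟶[V]
    (act.obj ⟨tens.obj ⟨F, G⟩, X⟩).obj (m.tensor.obj ⟨m.tensor.obj ⟨a, b⟩, c⟩)) :=
  δ.τ F G a b ≫ κ.coproj (tens.obj ⟨F, G⟩) X (m.tensor.obj ⟨a, b⟩) c

lemma rightCoproj_isTrilinear :
    IsRightTrilinear m F G X _ (κ.rightCoproj F G X) :=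
  .of_gcomp (κ.coproj_isBilinear G X) (κ.coproj_isBilinear F _)

lemma leftCoproj_isTrilinear :
    IsLeftTrilinear m F G X _ (leftCoproj δ κ F G X) :=
  .of_unc (δ.coproj_isBilinear F G) (κ.coproj_isBilinear _ X)

end

variable {F G : EnrichedFunctor V A V} {X W : EnrichedFunctor V A K}

/-- For fixed a, the universal property of G * X in shape F(a) absorbs b and c. The result is
bilinear in the remaining variables, so the universal property of F * (G * X) applies. -/
lemma exists_of_rightNested {s : ∀ a b c, G.obj b ⊗ F.obj a ⟶
      (X.obj c ⟶[V] W.obj (m.tensor.obj ⟨a, m.tensor.obj ⟨b, c⟩⟩))}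
    (h : IsRightTrilinear m F G X W s) :
    ∃ φ : 𝟙_ V ⟶ (act.obj ⟨F, act.obj ⟨G, X⟩⟩ ⟶[V] W), ∀ a b c,
      κ.rightCoproj F G X a b c ≫ post (φ ≫ natπ _ _ (m.tensor.obj ⟨a, m.tensor.obj ⟨b, c⟩⟩)) =
        s a b c := by
  choose g hg using fun a => κ.exists_of_isBilinearFamily (h.isBilinearFamily a)
  obtain ⟨φ, hφ⟩ := κ.exists_of_isBilinear (h.isBilinear_of_family hg κ.natural_ext)
  refine ⟨φ, fun a b c => ?_⟩
  refine (gcomp_post _ _ _).symm.trans ?_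
  exact (congrArg (gcomp _) (hφ a (m.tensor.obj ⟨b, c⟩))).trans (hg a b c)

/-- Extensionality is used twice, first for F * (G * X) and then for G * X. The second use needs the
composite with the outer `coproj` to be natural in the object p of A that replaces m(b,c). -/
lemma rightNested_ext {U : V} {g g' : U ⟶ (act.obj ⟨F, act.obj ⟨G, X⟩⟩ ⟶[V] W)}
    (h : ∀ a b c,
      gcomp (κ.rightCoproj F G X a b c) (g ≫ natπ _ _ (m.tensor.obj ⟨a, m.tensor.obj ⟨b, c⟩⟩)) =
        gcomp (κ.rightCoproj F G X a b c)
          (g' ≫ natπ _ _ (m.tensor.obj ⟨a, m.tensor.obj ⟨b, c⟩⟩))) : g = g' := by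
  refine κ.hom_ext fun a p => ?_
  have n (g : U ⟶ (act.obj ⟨F, act.obj ⟨G, X⟩⟩ ⟶[V] W)) :
      IsNatural (act.obj ⟨G, X⟩) (shift m W a) fun p =>
        gcomp (κ.coproj F (act.obj ⟨G, X⟩) a p) (g ≫ natπ _ _ (m.tensor.obj ⟨a, p⟩)) :=
    IsNatural.comp (G := shift m _ a) ((κ.coproj_isBilinear F (act.obj ⟨G, X⟩)).right a)
      ((((natπ_natural _ W).precomp g).whiskerLeft m.tensor).whiskerLeft (insertLeft A a))
  refine κ.natural_ext (n g) (n g') (fun b c => ?_) p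
  refine (gcomp_assoc_inv _ _ _).trans (Eq.trans ?_ (gcomp_assoc_inv _ _ _).symm)
  exact congrArg (fun t => _ ≫ t) (h a b c)

lemma rightNested_ext_unit {g g' : 𝟙_ V ⟶ (act.obj ⟨F, act.obj ⟨G, X⟩⟩ ⟶[V] W)}
    (h : ∀ a b c,
      κ.rightCoproj F G X a b c ≫ post (g ≫ natπ _ _ (m.tensor.obj ⟨a, m.tensor.obj ⟨b, c⟩⟩)) =
        κ.rightCoproj F G X a b c ≫
          post (g' ≫ natπ _ _ (m.tensor.obj ⟨a, m.tensor.obj ⟨b, c⟩⟩))) : g = g' :=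
  κ.rightNested_ext fun a b c => by rw [gcomp_unit_right, gcomp_unit_right, h]

lemma τ_mor {H : EnrichedFunctor V A V} (φ : 𝟙_ V ⟶ (tens.obj ⟨F, G⟩ ⟶[V] H)) (a b : A) :
    δ.τ F G a b ≫ mor (φ ≫ natπ _ _ (m.tensor.obj ⟨a, b⟩)) =
      unc (δ.coproj F G a b ≫ post (φ ≫ natπ _ _ (m.tensor.obj ⟨a, b⟩))) :=
  (unc_post _ _).symm

/-- With c absorbed, the family is bilinear from F and G to ⟨X,W⟩ and factors through the Day
convolution F * G. The adjunction turns the resulting F * G ⟶ ⟨X,W⟩ into the required morphism. -/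
lemma exists_of_leftNested {s : ∀ a b c, G.obj b ⊗ F.obj a ⟶
      (X.obj c ⟶[V] W.obj (m.tensor.obj ⟨m.tensor.obj ⟨a, b⟩, c⟩))}
    (h : IsLeftTrilinear m F G X W s) :
    ∃ φ : 𝟙_ V ⟶ (act.obj ⟨tens.obj ⟨F, G⟩, X⟩ ⟶[V] W), ∀ a b c,
      leftCoproj δ κ F G X a b c ≫
        post (φ ≫ natπ _ _ (m.tensor.obj ⟨m.tensor.obj ⟨a, b⟩, c⟩)) = s a b c := by
  obtain ⟨f, hf⟩ := δ.exists_of_isBilinear h.angleLift_isBilinear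
  let f' : 𝟙_ V ⟶ (tens.obj ⟨F, G⟩ ⟶[V] angle m X W) := f
  refine ⟨mapFst act X f' ≫ post (κ.adjCounit X W), fun a b c => ?_⟩
  rw [leftCoproj, Category.assoc]
  refine (congrArg (fun t => _ ≫ t) ((κ.coproj_post _ _ _ c).trans
    (congrArg (fun t => t ≫ _) (κ.coproj_mapFst _ _ X _ c f')))).trans ?_
  rw [Category.assoc, coproj_adjCounit, ← Category.assoc, τ_mor]
  refine (congrArg (fun t => unc t ≫ _) (hf a b)).trans ?_
  rw [unc_cur, h.angleLift_π]

/-- The adjoint transposes F * G ⟶ ⟨X,W⟩ are compared using extensionality for F * G. The identity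
`hf` shows that a transpose determines the original morphism on every `coproj`. -/
lemma leftNested_ext_unit {g g' : 𝟙_ V ⟶ (act.obj ⟨tens.obj ⟨F, G⟩, X⟩ ⟶[V] W)}
    (h : ∀ a b c,
      leftCoproj δ κ F G X a b c ≫
          post (g ≫ natπ _ _ (m.tensor.obj ⟨m.tensor.obj ⟨a, b⟩, c⟩)) =
        leftCoproj δ κ F G X a b c ≫
          post (g' ≫ natπ _ _ (m.tensor.obj ⟨m.tensor.obj ⟨a, b⟩, c⟩))) : g = g' := by
  let f (g : 𝟙_ V ⟶ (act.obj ⟨tens.obj ⟨F, G⟩, X⟩ ⟶[V] W)) :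
      𝟙_ V ⟶ (tens.obj ⟨F, G⟩ ⟶[V] angle m X W) :=
    κ.adjUnit X (tens.obj ⟨F, G⟩) ≫ post (g ≫ angleMap m X _ W)
  have hf (g) (x c : A) : mor (f g ≫ natπ (tens.obj ⟨F, G⟩) (angle m X W) x) ≫ angleπ X W x c =
      κ.coproj (tens.obj ⟨F, G⟩) X x c ≫ post (g ≫ natπ _ _ (m.tensor.obj ⟨x, c⟩)) := by
    refine (congrArg (fun t => mor t ≫ angleπ X W x c) (comp_post_natπ _ _ x)).trans ?_
    rw [mor_comp, Category.assoc]
    refine (congrArg (fun t => mor _ ≫ t) (mor_angleMap_π X _ W x c g)).trans ?_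
    exact (Category.assoc _ _ _).symm.trans (congrArg (fun t => t ≫ post _)
      (κ.adjUnit_π X _ x c))
  clear_value f
  have e : f g = f g' := δ.hom_ext_unit fun a b => unc_injective (angle_hom_ext fun c => by
    rw [← τ_mor, ← τ_mor, Category.assoc, Category.assoc, hf, hf, ← Category.assoc, ← Category.assoc]
    exact h a b c)
  exact κ.hom_ext_unit fun x c => by rw [← hf, ← hf, e]

end Convolution

end convolution

/-! ### The associativity isomorphism -/

section convolution
variable [SymmetricCategory V] [MonoidalClosed V] [HasLimits V]
variable {A : Type w} [EnrichedCategory V A] {m : MonoidalStructure V A}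
variable {K : Type u₁} [EnrichedCategory V K] {P : Copowers V K}

lemma unc_of_gcomp_eq_comp {U U' U'' X Y Z : V} {f : U ⟶ EnrichedCategory.Hom X Y}
    {g : U' ⟶ EnrichedCategory.Hom Y Z} {k : U ⊗ U' ⟶ U''} {f' : U'' ⟶ EnrichedCategory.Hom X Z}
    (h : gcomp f g = k ≫ f') : unc f ▷ U' ≫ unc g = ((α_ _ _ _).hom ≫ X ◁ k) ≫ unc f' := by
  rw [Category.assoc, ← unc_comp, ← h, unc_gcomp, Iso.hom_inv_id_assoc]

lemma unc_of_sq {U U' X Y Y' Z : V} {f : U ⟶ EnrichedCategory.Hom X Y}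
    {g : U' ⟶ EnrichedCategory.Hom Y Z} {k : U' ⟶ EnrichedCategory.Hom X Y'}
    {f' : U ⟶ EnrichedCategory.Hom Y' Z} (h : Sq f g k f') :
    unc f ▷ U' ≫ unc g =
      ((α_ _ _ _).hom ≫ X ◁ (β_ _ _).hom ≫ (α_ _ _ _).inv ≫ unc k ▷ U) ≫ unc f' := by
  have h := sq_iff_unc.mp h
  rw [Iso.inv_comp_eq] at h
  rw [h]
  simp only [Category.assoc]

section partialMaps
variable {A₁ : Type u₂} [EnrichedCategory V A₁] {A₂ : Type u₃} [EnrichedCategory V A₂]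
  {A₃ : Type u₄} [EnrichedCategory V A₃] (act : EnrichedFunctor V (TensorObj A₁ A₂) A₃)

lemma mapFst_id (F F' : A₁) (X : A₂) :
    mapFst act X (𝟙 (F ⟶[V] F')) = (fixRight act X).map F F' := Category.id_comp _

lemma mapSnd_id (F : A₁) (X X' : A₂) :
    mapSnd act F (𝟙 (X ⟶[V] X')) = (fixLeft act F).map X X' := Category.id_comp _

end partialMaps

/-- An isomorphism of the underlying category from mutually inverse elements of hom-objects. -/
def forgetIso {C : Type u₂} [EnrichedCategory V C] {X Y : C} (f : 𝟙_ V ⟶ (X ⟶[V] Y))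
    (g : 𝟙_ V ⟶ (Y ⟶[V] X)) (hfg : f ≫ post g = eId V X) (hgf : g ≫ post f = eId V Y) :
    ForgetEnrichment.of V X ≅ ForgetEnrichment.of V Y where
  hom := ForgetEnrichment.homOf V f
  inv := ForgetEnrichment.homOf V g
  hom_inv_id := (homTo_comp_eq _ _).trans
    (hfg.trans (ForgetEnrichment.homTo_id V (ForgetEnrichment.of V X)).symm)
  inv_hom_id := (homTo_comp_eq _ _).trans
    (hgf.trans (ForgetEnrichment.homTo_id V (ForgetEnrichment.of V Y)).symm)

lemma post_comp_natπ {Z : K} {X Y W : EnrichedFunctor V A K} (f : 𝟙_ V ⟶ (X ⟶[V] Y))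
    (g : 𝟙_ V ⟶ (Y ⟶[V] W)) (x : A) :
    (post ((f ≫ post g) ≫ natπ X W x) : (Z ⟶[V] X.obj x) ⟶ _) =
      post (f ≫ natπ X Y x) ≫ post (g ≫ natπ Y W x) := by
  rw [comp_post_natπ, post_post]

lemma post_eId_natπ {Z : K} (X : EnrichedFunctor V A K) (x : A) :
    (post (eId V X ≫ natπ X X x) : (Z ⟶[V] X.obj x) ⟶ _) = 𝟙 _ :=
  (congrArg post (functorCategory_eId_π X x)).trans post_eId

lemma natπ_pre_mapHom (X Y : EnrichedFunctor V A K) {x y : A}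
    (f : ForgetEnrichment.of V x ⟶ ForgetEnrichment.of V y) :
    natπ X Y y ≫ pre (mapHom X f) = natπ X Y x ≫ post (mapHom Y f) := by
  have h := congrArg (fun t => (λ_ _).inv ≫ ForgetEnrichment.homTo V f ▷ _ ≫ t)
    (natπ_natural X Y x y)
  have h₂ : (λ_ (natObj X Y)).inv ≫ ForgetEnrichment.homTo V f ▷ _ ≫ (β_ _ _).hom =
      (ρ_ _).inv ≫ _ ◁ ForgetEnrichment.homTo V f := by
    rw [BraidedCategory.braiding_naturality_left, braiding_tensorUnit_left]
    simp
  rw [comp_pre, comp_post, mapHom, mapHom, ← gcomp_whisker, ← whisker_gcomp]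
  refine h.trans ?_
  refine Eq.trans ?_ (Category.assoc _ _ _)
  rw [← h₂, Category.assoc, Category.assoc]
  rfl

lemma post_mapHom_natπ {Z : K} {X Y : EnrichedFunctor V A K} (φ : 𝟙_ V ⟶ (X ⟶[V] Y)) {x y : A}
    (f : ForgetEnrichment.of V x ⟶ ForgetEnrichment.of V y) :
    (post (mapHom X f) : (Z ⟶[V] X.obj x) ⟶ _) ≫ post (φ ≫ natπ X Y y) =
      post (φ ≫ natπ X Y x) ≫ post (mapHom Y f) := by
  rw [post_post, post_post, ← pre_unit, Category.assoc, natπ_pre_mapHom, Category.assoc]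

lemma post_mapHom_comp {Z : K} (X : EnrichedFunctor V A K) {x y z : A}
    (f : ForgetEnrichment.of V x ⟶ ForgetEnrichment.of V y)
    (g : ForgetEnrichment.of V y ⟶ ForgetEnrichment.of V z) :
    (post (mapHom X f) : (Z ⟶[V] X.obj x) ⟶ _) ≫ post (mapHom X g) = post (mapHom X (f ≫ g)) := by
  rw [post_post, mapHom_comp]

lemma post_mapHom_id {Z : K} (X : EnrichedFunctor V A K) (x : A) :
    (post (mapHom X (𝟙 (ForgetEnrichment.of V x))) : (Z ⟶[V] X.obj x) ⟶ _) = 𝟙 _ := by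
  rw [mapHom_id, post_eId]

namespace Convolution
variable {act : EnrichedFunctor V (TensorObj (EnrichedFunctor V A V) (EnrichedFunctor V A K))
    (EnrichedFunctor V A K)}
  {tens : EnrichedFunctor V (TensorObj (EnrichedFunctor V A V) (EnrichedFunctor V A V))
    (EnrichedFunctor V A V)}
  (δ : Convolution m (selfCopowers V) tens) (κ : Convolution m P act)

section
variable (F G : EnrichedFunctor V A V) (X : EnrichedFunctor V A K)

/-- The morphism `F * (G * X) ⟶ (F * G) * X`. -/
def assocHom : 𝟙_ V ⟶ (act.obj ⟨F, act.obj ⟨G, X⟩⟩ ⟶[V] act.obj ⟨tens.obj ⟨F, G⟩, X⟩) :=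
  (κ.exists_of_rightNested (leftCoproj_isTrilinear δ κ F G X).assoc).choose

lemma rightCoproj_assocHom (a b c : A) :
    κ.rightCoproj F G X a b c ≫
        post (assocHom δ κ F G X ≫ natπ _ _ (m.tensor.obj ⟨a, m.tensor.obj ⟨b, c⟩⟩)) =
      leftCoproj δ κ F G X a b c ≫ post (mapHom _ (assocIso m a b c).hom) :=
  (κ.exists_of_rightNested (leftCoproj_isTrilinear δ κ F G X).assoc).choose_spec a b c

/-- The morphism `(F * G) * X ⟶ F * (G * X)`. -/
def assocInv : 𝟙_ V ⟶ (act.obj ⟨tens.obj ⟨F, G⟩, X⟩ ⟶[V] act.obj ⟨F, act.obj ⟨G, X⟩⟩) :=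
  (exists_of_leftNested δ κ (κ.rightCoproj_isTrilinear F G X).assocInv).choose

lemma leftCoproj_assocInv (a b c : A) :
    leftCoproj δ κ F G X a b c ≫
        post (assocInv δ κ F G X ≫ natπ _ _ (m.tensor.obj ⟨m.tensor.obj ⟨a, b⟩, c⟩)) =
      κ.rightCoproj F G X a b c ≫ post (mapHom _ (assocIso m a b c).inv) :=
  (exists_of_leftNested δ κ (κ.rightCoproj_isTrilinear F G X).assocInv).choose_spec a b c

/-- On the universal families `assocHom` and `assocInv` act through the associator of A and its
inverse, so the composite fixes the universal family. -/
lemma assocHom_comp_inv : assocHom δ κ F G X ≫ post (assocInv δ κ F G X) = eId V _ := by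
  refine κ.rightNested_ext_unit fun a b c => ?_
  rw [post_eId_natπ, Category.comp_id, post_comp_natπ, ← Category.assoc, rightCoproj_assocHom,
    Category.assoc, post_mapHom_natπ, ← Category.assoc, leftCoproj_assocInv, Category.assoc,
    post_mapHom_comp, Iso.inv_hom_id, post_mapHom_id, Category.comp_id]

lemma assocInv_comp_hom : assocInv δ κ F G X ≫ post (assocHom δ κ F G X) = eId V _ := by
  refine leftNested_ext_unit δ κ fun a b c => ?_
  rw [post_eId_natπ, Category.comp_id, post_comp_natπ, ← Category.assoc, leftCoproj_assocInv,
    Category.assoc, post_mapHom_natπ, ← Category.assoc, rightCoproj_assocHom, Category.assoc,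
    post_mapHom_comp, Iso.hom_inv_id, post_mapHom_id, Category.comp_id]

end

variable {F F' G G' : EnrichedFunctor V A V} {X X' : EnrichedFunctor V A K} {U : V}

/-- Reduces naturality of the associator to the universal families: moving the associator of A past
l uses only that l has components natural in the object of A. -/
lemma assocHom_square {r : U ⟶ (act.obj ⟨F, act.obj ⟨G, X⟩⟩ ⟶[V] act.obj ⟨F', act.obj ⟨G', X'⟩⟩)}
    {l : U ⟶ (act.obj ⟨tens.obj ⟨F, G⟩, X⟩ ⟶[V] act.obj ⟨tens.obj ⟨F', G'⟩, X'⟩)}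
    (h : ∀ a b c,
      gcomp (κ.rightCoproj F G X a b c)
          (r ≫ natπ _ _ (m.tensor.obj ⟨a, m.tensor.obj ⟨b, c⟩⟩)) ≫
          post (assocHom δ κ F' G' X' ≫ natπ _ _ (m.tensor.obj ⟨a, m.tensor.obj ⟨b, c⟩⟩)) =
        gcomp (leftCoproj δ κ F G X a b c)
          (l ≫ natπ _ _ (m.tensor.obj ⟨m.tensor.obj ⟨a, b⟩, c⟩)) ≫
          post (mapHom _ (assocIso m a b c).hom)) :
    r ≫ post (assocHom δ κ F' G' X') = l ≫ pre (assocHom δ κ F G X) := by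
  refine κ.rightNested_ext fun a b c => ?_
  rw [comp_post_natπ, gcomp_post, h, comp_pre_natπ, ← gcomp_post_left, rightCoproj_assocHom,
    gcomp_post_left, Category.assoc, natπ_pre_mapHom, ← Category.assoc, gcomp_post]

lemma rightCoproj_mapFst (φ : U ⟶ (F ⟶[V] F')) (a b c : A) :
    gcomp (κ.rightCoproj F G X a b c)
        (mapFst act (act.obj ⟨G, X⟩) φ ≫ natπ _ _ (m.tensor.obj ⟨a, m.tensor.obj ⟨b, c⟩⟩)) =
      ((α_ _ _ _).hom ≫ G.obj b ◁ unc (φ ≫ natπ F F' a)) ≫ κ.rightCoproj F' G X a b c := by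
  rw [rightCoproj, gcomp_assoc, gcomp_coproj_mapFst, ← whisker_gcomp, ← Category.assoc, rightCoproj]

lemma rightCoproj_mapSnd_mapFst (φ : U ⟶ (G ⟶[V] G')) (a b c : A) :
    gcomp (κ.rightCoproj F G X a b c)
        (mapSnd act F (mapFst act X φ) ≫ natπ _ _ (m.tensor.obj ⟨a, m.tensor.obj ⟨b, c⟩⟩)) =
      ((α_ _ _ _).hom ≫ G.obj b ◁ (β_ _ _).hom ≫ (α_ _ _ _).inv ≫
        unc (φ ≫ natπ G G' b) ▷ F.obj a) ≫ κ.rightCoproj F G' X a b c := by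
  rw [rightCoproj, gcomp_assoc, gcomp_coproj_mapSnd, ← whisker_gcomp, gcomp_assoc_inv,
    gcomp_coproj_mapFst, ← gcomp_whisker, rightCoproj]
  simp only [Category.assoc]

lemma rightCoproj_mapSnd_mapSnd (ψ : U ⟶ (X ⟶[V] X')) (a b c : A) :
    gcomp (κ.rightCoproj F G X a b c)
        (mapSnd act F (mapSnd act G ψ) ≫ natπ _ _ (m.tensor.obj ⟨a, m.tensor.obj ⟨b, c⟩⟩)) =
      (β_ _ _).hom ≫ gcomp (ψ ≫ natπ X X' c) (κ.rightCoproj F G X' a b c) :=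
  Sq.hcomp (κ.gcomp_coproj_mapSnd G X X' b c ψ)
    (κ.gcomp_coproj_mapSnd F _ _ a (m.tensor.obj ⟨b, c⟩) (mapSnd act G ψ))

lemma τ_mapFst (φ : U ⟶ (F ⟶[V] F')) (a b : A) :
    δ.τ F G a b ▷ U ≫ unc (mapFst tens G φ ≫ natπ _ _ (m.tensor.obj ⟨a, b⟩)) =
      ((α_ _ _ _).hom ≫ G.obj b ◁ unc (φ ≫ natπ F F' a)) ≫ δ.τ F' G a b :=
  unc_of_gcomp_eq_comp (δ.gcomp_coproj_mapFst F F' G a b φ)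

lemma τ_mapSnd (φ : U ⟶ (G ⟶[V] G')) (a b : A) :
    δ.τ F G a b ▷ U ≫ unc (mapSnd tens F φ ≫ natπ _ _ (m.tensor.obj ⟨a, b⟩)) =
      ((α_ _ _ _).hom ≫ G.obj b ◁ (β_ _ _).hom ≫ (α_ _ _ _).inv ≫
        unc (φ ≫ natπ G G' b) ▷ F.obj a) ≫ δ.τ F G' a b :=
  unc_of_sq (δ.gcomp_coproj_mapSnd F G G' a b φ)

lemma leftCoproj_mapFst (X : EnrichedFunctor V A K)
    (φ : U ⟶ (tens.obj ⟨F, G⟩ ⟶[V] tens.obj ⟨F', G'⟩)) (a b c : A) :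
    gcomp (leftCoproj δ κ F G X a b c)
        (mapFst act X φ ≫ natπ _ _ (m.tensor.obj ⟨m.tensor.obj ⟨a, b⟩, c⟩)) =
      (δ.τ F G a b ▷ U ≫ unc (φ ≫ natπ _ _ (m.tensor.obj ⟨a, b⟩))) ≫
        κ.coproj _ X (m.tensor.obj ⟨a, b⟩) c := by
  rw [leftCoproj, ← gcomp_whisker, gcomp_coproj_mapFst, Category.assoc]

lemma leftCoproj_mapSnd (ψ : U ⟶ (X ⟶[V] X')) (a b c : A) :
    gcomp (leftCoproj δ κ F G X a b c)
        (mapSnd act (tens.obj ⟨F, G⟩) ψ ≫ natπ _ _ (m.tensor.obj ⟨m.tensor.obj ⟨a, b⟩, c⟩)) =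
      (β_ _ _).hom ≫ gcomp (ψ ≫ natπ X X' c) (leftCoproj δ κ F G X' a b c) := by
  have := Sq.precomp (κ.gcomp_coproj_mapSnd (tens.obj ⟨F, G⟩) X X' (m.tensor.obj ⟨a, b⟩) c ψ)
    (𝟙 _) (δ.τ F G a b)
  rw [Category.id_comp, Category.id_comp] at this
  exact this

lemma assocHom_natural₁ (φ : U ⟶ (F ⟶[V] F')) :
    mapFst act (act.obj ⟨G, X⟩) φ ≫ post (assocHom δ κ F' G X) =
      mapFst act X (mapFst tens G φ) ≫ pre (assocHom δ κ F G X) :=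
  assocHom_square δ κ fun a b c => by
    rw [rightCoproj_mapFst, Category.assoc, rightCoproj_assocHom, leftCoproj_mapFst, τ_mapFst,
      leftCoproj]
    simp only [Category.assoc]

lemma assocHom_natural₂ (φ : U ⟶ (G ⟶[V] G')) :
    mapSnd act F (mapFst act X φ) ≫ post (assocHom δ κ F G' X) =
      mapFst act X (mapSnd tens F φ) ≫ pre (assocHom δ κ F G X) :=
  assocHom_square δ κ fun a b c => by
    rw [rightCoproj_mapSnd_mapFst, Category.assoc, rightCoproj_assocHom, leftCoproj_mapFst,
      τ_mapSnd, leftCoproj]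
    simp only [Category.assoc]

lemma assocHom_natural₃ (ψ : U ⟶ (X ⟶[V] X')) :
    mapSnd act F (mapSnd act G ψ) ≫ post (assocHom δ κ F G X') =
      mapSnd act (tens.obj ⟨F, G⟩) ψ ≫ pre (assocHom δ κ F G X) :=
  assocHom_square δ κ fun a b c => by
    rw [rightCoproj_mapSnd_mapSnd, Category.assoc, ← gcomp_post, rightCoproj_assocHom,
      leftCoproj_mapSnd, Category.assoc, ← gcomp_post]

/-- The associativity isomorphism `F * (G * X) ≅ (F * G) * X`. -/
def associator : NaturalIso
    ((assocFunctor _ _ _).comp V ((prodFunctor (EnrichedFunctor.id V _) act).comp V act))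
    ((prodFunctor tens (EnrichedFunctor.id V _)).comp V act) where
  iso p := forgetIso (assocHom δ κ p.fst.fst p.fst.snd p.snd)
    (assocInv δ κ p.fst.fst p.fst.snd p.snd) (assocHom_comp_inv δ κ _ _ _)
    (assocInv_comp_hom δ κ _ _ _)
  natural := by
    -- Naturality over a triple tensor product of V-categories splits into naturality in F, in G and
    -- in X.
    refine isNatural_of_partial
      (fun X => isNatural_of_partial (fun G => isNatural_unit_iff.mpr fun F F' => ?_)
        fun F => isNatural_unit_iff.mpr fun G G' => ?_)
      fun p => isNatural_unit_iff.mpr fun X X' => ?_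
    · refine (congrArg (fun t => t ≫ post _) (rightNested_map₁ _ _ _ _ _ _)).trans ?_
      refine Eq.trans ?_ (congrArg (fun t => t ≫ pre _) (leftNested_map₁ _ _ _ _ _ _)).symm
      have := assocHom_natural₁ δ κ (G := G) (X := X) (𝟙 (F ⟶[V] F'))
      rw [mapFst_id, mapFst_id] at this
      exact this
    · refine (congrArg (fun t => t ≫ post _) (rightNested_map₂ _ _ _ _ _ _)).trans ?_
      refine Eq.trans ?_ (congrArg (fun t => t ≫ pre _) (leftNested_map₂ _ _ _ _ _ _)).symm
      have := assocHom_natural₂ δ κ (F := F) (X := X) (𝟙 (G ⟶[V] G'))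
      rw [mapFst_id, mapSnd_id] at this
      exact this
    · refine (congrArg (fun t => t ≫ post _) (rightNested_map₃ _ _ _ _ _ _)).trans ?_
      refine Eq.trans ?_ (congrArg (fun t => t ≫ pre _) (leftNested_map₃ _ _ _ _ _ _)).symm
      have := assocHom_natural₃ δ κ (F := p.fst) (G := p.snd) (𝟙 (X ⟶[V] X'))
      rw [mapSnd_id, mapSnd_id] at this
      exact this

/-- `IsAssociator` places F(a) before G(b), whereas the trilinear families place G(b) first, as
uncurrying dictates; the two forms differ by the symmetry. -/
lemma isAssociator_associator : δ.IsAssociator κ fun F G X => (associator δ κ).iso ⟨⟨F, G⟩, X⟩ := by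
  intro F G X a b c
  have h := congrArg (fun t => (β_ _ _).hom ≫ t) (rightCoproj_assocHom δ κ F G X a b c)
  rw [postComp_eq, postComp_eq, Category.assoc, tensorCoproj, Category.assoc, Category.assoc]
  refine Eq.trans ?_ h.symm
  rw [leftCoproj, Category.assoc]
  rfl

end Convolution

end convolution

/-! ### The pentagon -/

section convolution
variable [SymmetricCategory V] [MonoidalClosed V] [HasLimits V]
variable {A : Type w} [EnrichedCategory V A] {m : MonoidalStructure V A}
variable {K : Type u₁} [EnrichedCategory V K] {P : Copowers V K}

lemma Sq.unit {C : Type u₂} [EnrichedCategory V C] {U : V} {W X Y Z : C}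
    {f : 𝟙_ V ⟶ (W ⟶[V] X)} {s' : U ⟶ (X ⟶[V] Z)} {s : U ⟶ (W ⟶[V] Y)} {g : 𝟙_ V ⟶ (Y ⟶[V] Z)}
    (h : Sq f s' s g) : s' ≫ pre f = s ≫ post g := by
  rw [comp_pre, comp_post, h, braiding_tensorUnit_left]
  simp

lemma homTo_mapL (Y : EnrichedFunctor V A K) {a a' : A} (b : A)
    (f : ForgetEnrichment.of V a ⟶ ForgetEnrichment.of V a') :
    ForgetEnrichment.homTo V f ≫ mapL m Y a a' b =
      mapHom Y (map₂ m.tensor f (𝟙 (ForgetEnrichment.of V b))) := by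
  refine Eq.trans ?_ (congrArg (mapHom Y) (fixRight_forget_map m.tensor b f))
  exact (congrArg (fun t => _ ≫ t) (mapL_eq_comp Y a a' b)).trans (Category.assoc _ _ _).symm

lemma homTo_mapR (Y : EnrichedFunctor V A K) (a : A) {b b' : A}
    (f : ForgetEnrichment.of V b ⟶ ForgetEnrichment.of V b') :
    ForgetEnrichment.homTo V f ≫ mapR m Y a b b' =
      mapHom Y (map₂ m.tensor (𝟙 (ForgetEnrichment.of V a)) f) := by
  refine Eq.trans ?_ (congrArg (mapHom Y) (fixLeft_forget_map m.tensor a f))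
  exact (congrArg (fun t => _ ≫ t) (mapR_eq_comp Y a b b')).trans (Category.assoc _ _ _).symm

namespace IsBilinear
variable {F : EnrichedFunctor V A V} {X Y : EnrichedFunctor V A K}
  {t : ∀ a b, F.obj a ⟶ (X.obj b ⟶[V] Y.obj (m.tensor.obj ⟨a, b⟩))}

lemma mapHom_right (ht : IsBilinear m F X Y t) (a : A) {b b' : A}
    (f : ForgetEnrichment.of V b ⟶ ForgetEnrichment.of V b') :
    t a b' ≫ pre (mapHom X f) =
      t a b ≫ post (mapHom Y (map₂ m.tensor (𝟙 (ForgetEnrichment.of V a)) f)) := by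
  rw [← homTo_mapR, mapHom]
  have h := Sq.unit (Sq.precomp (ht.right a b b') (𝟙 _) (ForgetEnrichment.homTo V f))
  rw [Category.id_comp, Category.id_comp] at h
  exact h

lemma mapHom_left (ht : IsBilinear m F X Y t) {a a' : A} (b : A)
    (f : ForgetEnrichment.of V a ⟶ ForgetEnrichment.of V a') :
    mor (mapHom F f) ≫ t a' b =
      t a b ≫ post (mapHom Y (map₂ m.tensor f (𝟙 (ForgetEnrichment.of V b)))) := by
  rw [← homTo_mapL, comp_post]
  have h : mor (mapHom F f) = (ρ_ _).inv ≫ _ ◁ ForgetEnrichment.homTo V f ≫ actR F a a' :=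
    congrArg (fun t => (ρ_ _).inv ≫ t) (unc_comp _ _)
  rw [h, Category.assoc, Category.assoc]
  refine congrArg (fun t => _ ≫ t) ((congrArg (fun t => _ ≫ t) (ht.left a a' b)).symm.trans ?_)
  exact whisker_gcomp _ _ _

end IsBilinear

namespace Convolution
variable {act : EnrichedFunctor V (TensorObj (EnrichedFunctor V A V) (EnrichedFunctor V A K))
    (EnrichedFunctor V A K)}
  {tens : EnrichedFunctor V (TensorObj (EnrichedFunctor V A V) (EnrichedFunctor V A V))
    (EnrichedFunctor V A V)}
  (δ : Convolution m (selfCopowers V) tens) (κ : Convolution m P act)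

section ext
variable {F G H : EnrichedFunctor V A V} {X W : EnrichedFunctor V A K}

/-- Extensionality for F * (G * -) leaves an object p in place of m(c,d). For fixed a and b the
composite is natural in p, so extensionality for H * X finishes. -/
lemma threefold_ext {g g' : 𝟙_ V ⟶ (act.obj ⟨F, act.obj ⟨G, act.obj ⟨H, X⟩⟩⟩ ⟶[V] W)}
    (h : ∀ a b c d,
      gcomp (κ.coproj H X c d) (κ.rightCoproj F G (act.obj ⟨H, X⟩) a b (m.tensor.obj ⟨c, d⟩)) ≫
        post (g ≫ natπ _ _ (m.tensor.obj ⟨a, m.tensor.obj ⟨b, m.tensor.obj ⟨c, d⟩⟩⟩)) =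
      gcomp (κ.coproj H X c d) (κ.rightCoproj F G (act.obj ⟨H, X⟩) a b (m.tensor.obj ⟨c, d⟩)) ≫
        post (g' ≫ natπ _ _ (m.tensor.obj ⟨a, m.tensor.obj ⟨b, m.tensor.obj ⟨c, d⟩⟩⟩))) :
    g = g' := by
  refine κ.rightNested_ext_unit fun a b p => ?_
  have n (g : 𝟙_ V ⟶ (act.obj ⟨F, act.obj ⟨G, act.obj ⟨H, X⟩⟩⟩ ⟶[V] W)) :
      IsNatural (act.obj ⟨H, X⟩) (fixLeft (rightNested m W) ⟨a, b⟩) fun p =>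
        κ.rightCoproj F G (act.obj ⟨H, X⟩) a b p ≫
          post (g ≫ natπ _ _ (m.tensor.obj ⟨a, m.tensor.obj ⟨b, p⟩⟩)) :=
    IsNatural.post (G := fixLeft (rightNested m _) ⟨a, b⟩)
      ((κ.rightCoproj_isTrilinear F G (act.obj ⟨H, X⟩)).thd a b)
      ((((((natπ_natural _ W).precomp g).whiskerLeft m.tensor).whiskerLeft
        (prodFunctor (EnrichedFunctor.id V A) m.tensor)).whiskerLeft
        (assocFunctor A A A)).whiskerLeft (insertLeft A _))
  refine κ.natural_ext (n g) (n g') (fun c d => ?_) p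
  exact (gcomp_post _ _ _).trans ((h a b c d).trans (gcomp_post _ _ _).symm)

end ext

section pentagon
variable (F G H : EnrichedFunctor V A V) (X : EnrichedFunctor V A K)

lemma unc_rightCoproj (a b c : A) :
    unc (δ.rightCoproj F G H a b c) =
      (α_ _ _ _).inv ≫ δ.τ G H b c ▷ F.obj a ≫ δ.τ F (tens.obj ⟨G, H⟩) a (m.tensor.obj ⟨b, c⟩) :=
  unc_gcomp _ _

lemma unc_leftCoproj (a b c : A) :
    unc (leftCoproj δ δ F G H a b c) =
      H.obj c ◁ δ.τ F G a b ≫ δ.τ (tens.obj ⟨F, G⟩) H (m.tensor.obj ⟨a, b⟩) c :=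
  unc_comp _ _

/-- The defining equation of the associator of the Day convolution, uncurried. In this form it can
be placed in front of the universal family for the action on X. -/
lemma τ_assocHom (a b c : A) :
    (α_ _ _ _).inv ≫ δ.τ G H b c ▷ F.obj a ≫ δ.τ F (tens.obj ⟨G, H⟩) a (m.tensor.obj ⟨b, c⟩) ≫
        mor (assocHom δ δ F G H ≫ natπ _ _ (m.tensor.obj ⟨a, m.tensor.obj ⟨b, c⟩⟩)) =
      H.obj c ◁ δ.τ F G a b ≫ δ.τ (tens.obj ⟨F, G⟩) H (m.tensor.obj ⟨a, b⟩) c ≫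
        mor (mapHom _ (assocIso m a b c).hom) := by
  have h := congrArg unc (rightCoproj_assocHom δ δ F G H a b c)
  have h₁ := unc_post (δ.rightCoproj F G H a b c)
    (assocHom δ δ F G H ≫ natπ _ _ (m.tensor.obj ⟨a, m.tensor.obj ⟨b, c⟩⟩))
  have h₂ := unc_post (leftCoproj δ δ F G H a b c)
    (mapHom (tens.obj ⟨tens.obj ⟨F, G⟩, H⟩) (assocIso m a b c).hom)
  rw [unc_rightCoproj] at h₁
  rw [unc_leftCoproj] at h₂
  have := h₁.symm.trans (h.trans h₂)
  simp only [Category.assoc] at this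
  exact this

lemma pentagon_left (a b c d : A) :
    gcomp (κ.coproj H X c d) (κ.rightCoproj F G (act.obj ⟨H, X⟩) a b (m.tensor.obj ⟨c, d⟩)) ≫
        post ((assocHom δ κ F G (act.obj ⟨H, X⟩) ≫ post (assocHom δ κ (tens.obj ⟨F, G⟩) H X)) ≫
          natπ _ _ (m.tensor.obj ⟨a, m.tensor.obj ⟨b, m.tensor.obj ⟨c, d⟩⟩⟩)) =
      (H.obj c ◁ δ.τ F G a b ≫ leftCoproj δ κ (tens.obj ⟨F, G⟩) H X (m.tensor.obj ⟨a, b⟩) c d) ≫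
        post (mapHom _ ((assocIso m (m.tensor.obj ⟨a, b⟩) c d).hom ≫
          (assocIso m a b (m.tensor.obj ⟨c, d⟩)).hom)) := by
  rw [post_comp_natπ, ← Category.assoc, ← gcomp_post, rightCoproj_assocHom, gcomp_post,
    Category.assoc, post_mapHom_natπ, leftCoproj, ← whisker_gcomp, Category.assoc]
  have h := rightCoproj_assocHom δ κ (tens.obj ⟨F, G⟩) H X (m.tensor.obj ⟨a, b⟩) c d
  rw [rightCoproj] at h
  rw [← Category.assoc (gcomp _ _), h, Category.assoc, post_mapHom_comp, Category.assoc]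

/-- Each of the three factors becomes an associator of A acting after the universal family: the
first one gives m(1,α) by naturality of `coproj` in its second variable, the last one gives m(α,1)
by naturality in its first. Together with `pentagon_left` this leaves only the two sides of the
pentagon of A. -/
lemma pentagon_right (a b c d : A) :
    gcomp (κ.coproj H X c d) (κ.rightCoproj F G (act.obj ⟨H, X⟩) a b (m.tensor.obj ⟨c, d⟩)) ≫
        post ((mapSnd act F (assocHom δ κ G H X) ≫
          post (assocHom δ κ F (tens.obj ⟨G, H⟩) X ≫ post (mapFst act X (assocHom δ δ F G H)))) ≫
          natπ _ _ (m.tensor.obj ⟨a, m.tensor.obj ⟨b, m.tensor.obj ⟨c, d⟩⟩⟩)) =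
      (H.obj c ◁ δ.τ F G a b ≫ leftCoproj δ κ (tens.obj ⟨F, G⟩) H X (m.tensor.obj ⟨a, b⟩) c d) ≫
        post (mapHom _ (map₂ m.tensor (assocIso m a b c).hom (𝟙 (ForgetEnrichment.of V d)) ≫
          (assocIso m a (m.tensor.obj ⟨b, c⟩) d).hom ≫
          map₂ m.tensor (𝟙 (ForgetEnrichment.of V a)) (assocIso m b c d).hom)) := by
  have h₁ : gcomp (κ.coproj H X c d)
      (κ.rightCoproj F G (act.obj ⟨H, X⟩) a b (m.tensor.obj ⟨c, d⟩) ≫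
        post (mapSnd act F (assocHom δ κ G H X) ≫
          natπ _ _ (m.tensor.obj ⟨a, m.tensor.obj ⟨b, m.tensor.obj ⟨c, d⟩⟩⟩))) =
      ((α_ _ _ _).inv ≫ δ.τ G H b c ▷ F.obj a ≫
        κ.rightCoproj F (tens.obj ⟨G, H⟩) X a (m.tensor.obj ⟨b, c⟩) d) ≫
        post (mapHom _ (map₂ m.tensor (𝟙 (ForgetEnrichment.of V a)) (assocIso m b c d).hom)) := by
    rw [rightCoproj, ← gcomp_post, coproj_mapSnd, ← gcomp_post_left, gcomp_assoc_inv, gcomp_post]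
    have h := rightCoproj_assocHom δ κ G H X b c d
    rw [rightCoproj] at h
    rw [h, gcomp_post_left, (κ.coproj_isBilinear F _).mapHom_right, gcomp_post, leftCoproj,
      ← gcomp_whisker, rightCoproj]
    simp only [Category.assoc]
  rw [post_comp_natπ, post_comp_natπ, ← Category.assoc, ← gcomp_post, h₁]
  simp only [Category.assoc]
  rw [← Category.assoc (post (mapHom _ _)), post_mapHom_natπ, Category.assoc, post_mapHom_natπ]
  have h₂ := rightCoproj_assocHom δ κ F (tens.obj ⟨G, H⟩) X a (m.tensor.obj ⟨b, c⟩) d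
  rw [← Category.assoc (κ.rightCoproj _ _ _ _ _ _), h₂, Category.assoc,
    ← Category.assoc (post (mapHom _ _)), post_mapHom_natπ, Category.assoc, post_mapHom_comp,
    leftCoproj, Category.assoc, ← Category.assoc (κ.coproj _ _ _ _), coproj_mapFst, Category.assoc]
  -- The associator of F, G and H becomes an associator of A acting on the value of (F * G) * H;
  -- bilinearity then moves this action out to m(α, 1) on the target.
  have h₃ := congrArg (fun t => t ≫
    κ.coproj (tens.obj ⟨tens.obj ⟨F, G⟩, H⟩) X (m.tensor.obj ⟨a, m.tensor.obj ⟨b, c⟩⟩) d)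
    (τ_assocHom δ F G H a b c)
  simp only [Category.assoc] at h₃
  rw [(κ.coproj_isBilinear _ X).mapHom_left] at h₃
  have h₄ := congrArg (fun t => t ≫ post (mapHom _ ((assocIso m a (m.tensor.obj ⟨b, c⟩) d).hom ≫
    map₂ m.tensor (𝟙 (ForgetEnrichment.of V a)) (assocIso m b c d).hom))) h₃
  simp only [Category.assoc] at h₄
  refine h₄.trans ?_
  rw [post_mapHom_comp, leftCoproj]
  simp only [Category.assoc]

lemma assocHom_pentagon :
    assocHom δ κ F G (act.obj ⟨H, X⟩) ≫ post (assocHom δ κ (tens.obj ⟨F, G⟩) H X) =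
      mapSnd act F (assocHom δ κ G H X) ≫
        post (assocHom δ κ F (tens.obj ⟨G, H⟩) X ≫ post (mapFst act X (assocHom δ δ F G H))) := by
  refine κ.threefold_ext fun a b c d => ?_
  rw [pentagon_left, pentagon_right]
  exact congrArg (fun t => _ ≫ post (mapHom _ t)) (m.pentagon a b c d).symm

end pentagon

end Convolution

end convolution

/-! ### The unit isomorphism I * X ≅ X -/

section convolution
variable [SymmetricCategory V] [MonoidalClosed V] [HasLimits V]
variable {A : Type w} [EnrichedCategory V A] {m : MonoidalStructure V A}
variable {K : Type u₁} [EnrichedCategory V K] {P : Copowers V K}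

lemma mapHom_hom_inv (X : EnrichedFunctor V A K) {a b : A}
    (e : ForgetEnrichment.of V a ≅ ForgetEnrichment.of V b) :
    mapHom X e.hom ≫ post (mapHom X e.inv) = eId V _ := by
  rw [mapHom_comp, e.hom_inv_id, mapHom_id]

lemma mapHom_inv_hom (X : EnrichedFunctor V A K) {a b : A}
    (e : ForgetEnrichment.of V a ≅ ForgetEnrichment.of V b) :
    mapHom X e.inv ≫ post (mapHom X e.hom) = eId V _ := by
  rw [mapHom_comp, e.inv_hom_id, mapHom_id]

lemma leftUnitor_mapHom_natural (X : EnrichedFunctor V A K) :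
    IsNatural (shift m X m.unit) X fun b => mapHom X (leftUnitorIso m b).hom :=
  (m.leftUnitor.natural.whiskerRight X).congr (fun _ _ => (Category.assoc _ _ _).symm)
    fun _ _ => (Category.id_comp _).symm

lemma leftUnitor_mapHom_inv_natural (X : EnrichedFunctor V A K) :
    IsNatural X (shift m X m.unit) fun b => mapHom X (leftUnitorIso m b).inv :=
  isNatural_inv (fun _ => mapHom_hom_inv X _) (fun _ => mapHom_inv_hom X _)
    (leftUnitor_mapHom_natural X)

lemma rightUnitor_mapHom_natural (X : EnrichedFunctor V A K) :
    IsNatural (fixRight (m.tensor.comp V X) m.unit) X fun b => mapHom X (rightUnitorIso m b).hom :=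
  (m.rightUnitor.natural.whiskerRight X).congr (fun _ _ => (Category.assoc _ _ _).symm)
    fun _ _ => (Category.id_comp _).symm

lemma rightUnitor_mapHom_inv_natural (X : EnrichedFunctor V A K) :
    IsNatural X (fixRight (m.tensor.comp V X) m.unit) fun b => mapHom X (rightUnitorIso m b).inv :=
  isNatural_inv (fun _ => mapHom_hom_inv X _) (fun _ => mapHom_inv_hom X _)
    (rightUnitor_mapHom_natural X)

lemma eComp_mapL (X : EnrichedFunctor V A K) (a a' a'' b : A) :
    eComp V a a' a'' ≫ mapL m X a a'' b = gcomp (mapL m X a a' b) (mapL m X a' a'' b) :=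
  (fixRight (m.tensor.comp V X) b).map_comp a a' a''

lemma eComp_mapR (X : EnrichedFunctor V A K) (a b b' b'' : A) :
    eComp V b b' b'' ≫ mapR m X a b b'' = gcomp (mapR m X a b b') (mapR m X a b' b'') :=
  (fixLeft (m.tensor.comp V X) a).map_comp b b' b''

lemma eId_mapL (X : EnrichedFunctor V A K) (a b : A) : eId V a ≫ mapL m X a a b = eId V _ :=
  (fixRight (m.tensor.comp V X) b).map_id a

lemma eId_mapR (X : EnrichedFunctor V A K) (a b : A) : eId V b ≫ mapR m X a b b = eId V _ :=
  (fixLeft (m.tensor.comp V X) a).map_id b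

lemma actR_corep (i a a' : A) : actR (corep i) a a' = eComp V i a a' := unc_cur _

lemma mapL_natural {X Y : EnrichedFunctor V A K} {U : V} (φ : U ⟶ (X ⟶[V] Y)) (a a' b : A) :
    Sq (mapL m X a a' b) (φ ≫ natπ X Y (m.tensor.obj ⟨a', b⟩))
      (φ ≫ natπ X Y (m.tensor.obj ⟨a, b⟩)) (mapL m Y a a' b) :=
  ((((natπ_natural X Y).precomp φ).whiskerLeft m.tensor).whiskerLeft (insertRight A b)) a a'

lemma mapR_natural {X Y : EnrichedFunctor V A K} {U : V} (φ : U ⟶ (X ⟶[V] Y)) (a b b' : A) :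
    Sq (mapR m X a b b') (φ ≫ natπ X Y (m.tensor.obj ⟨a, b'⟩))
      (φ ≫ natπ X Y (m.tensor.obj ⟨a, b⟩)) (mapR m Y a b b') :=
  ((((natπ_natural X Y).precomp φ).whiskerLeft m.tensor).whiskerLeft (insertLeft A a)) b b'

lemma Sq.unit' {C : Type u₂} [EnrichedCategory V C] {U : V} {W X Y Z : C}
    {f : U ⟶ (W ⟶[V] X)} {s' : 𝟙_ V ⟶ (X ⟶[V] Z)} {s : 𝟙_ V ⟶ (W ⟶[V] Y)} {g : U ⟶ (Y ⟶[V] Z)}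
    (h : Sq f s' s g) : f ≫ post s' = g ≫ pre s := by
  rw [comp_pre, comp_post, h, braiding_tensorUnit_right]
  simp

lemma natπ_post_mapHom {X Y : EnrichedFunctor V A K} (φ : 𝟙_ V ⟶ (X ⟶[V] Y)) {x y : A}
    (f : ForgetEnrichment.of V x ⟶ ForgetEnrichment.of V y) :
    mapHom X f ≫ post (φ ≫ natπ X Y y) = (φ ≫ natπ X Y x) ≫ post (mapHom Y f) := by
  rw [← pre_unit, Category.assoc, natπ_pre_mapHom, Category.assoc]

/-- The morphisms `A(i, a) ⟶ K(X(b), X(m(a, b)))`. -/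
def unitFamily (m : MonoidalStructure V A) (X : EnrichedFunctor V A K) (a b : A) :
    (m.unit ⟶[V] a) ⟶ (X.obj b ⟶[V] X.obj (m.tensor.obj ⟨a, b⟩)) :=
  mapL m X m.unit a b ≫ pre (mapHom X (leftUnitorIso m b).inv)

lemma gcomp_unitFamily_mapL (X : EnrichedFunctor V A K) (a a' b : A) :
    gcomp (unitFamily m X a b) (mapL m X a a' b) = eComp V m.unit a a' ≫ unitFamily m X a' b := by
  rw [unitFamily, gcomp_pre, ← eComp_mapL, Category.assoc, unitFamily]

/-- Naturality in a is functoriality of X(m(-,b)). In b it combines the interchange of the two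
variables of m with naturality of the left unitor of A. -/
lemma unitFamily_isBilinear (X : EnrichedFunctor V A K) :
    IsBilinear m (corep m.unit) X X (unitFamily m X) where
  left a a' b := (gcomp_unitFamily_mapL X a a' b).trans
    (congrArg (fun t => t ≫ unitFamily m X a' b) (actR_corep m.unit a a').symm)
  right a := IsNatural.pre (G := shift m X m.unit) (H := shift m X a)
    (curryApp_natural (m.tensor.comp V X) m.unit a) (leftUnitor_mapHom_inv_natural X)

lemma unitFamily_natural {X Y : EnrichedFunctor V A K} {U : V} (φ : U ⟶ (X ⟶[V] Y)) (a b : A) :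
    Sq (unitFamily m X a b) (φ ≫ natπ X Y (m.tensor.obj ⟨a, b⟩)) (φ ≫ natπ X Y b)
      (unitFamily m Y a b) := by
  rw [Sq, unitFamily, gcomp_pre, mapL_natural φ m.unit a b, Category.assoc, ← gcomp_pre,
    Category.assoc φ, natπ_pre_mapHom, ← Category.assoc, gcomp_post_left, unitFamily]

lemma eId_unitFamily (X : EnrichedFunctor V A K) (b : A) :
    eId V m.unit ≫ unitFamily m X m.unit b = mapHom X (leftUnitorIso m b).inv := by
  rw [unitFamily, ← Category.assoc]
  refine (congrArg (fun t => t ≫ pre _) (eId_mapL X m.unit b)).trans ?_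
  rw [eId_pre]

namespace Convolution
variable {act : EnrichedFunctor V (TensorObj (EnrichedFunctor V A V) (EnrichedFunctor V A K))
    (EnrichedFunctor V A K)} (κ : Convolution m P act) (X : EnrichedFunctor V A K)

/-- The canonical morphism `A(i, a) ⟶ K(X(b), (I * X)(m(a, b)))`. -/
def unitCoproj (a b : A) :
    (m.unit ⟶[V] a) ⟶ (X.obj b ⟶[V] (act.obj ⟨corep m.unit, X⟩).obj (m.tensor.obj ⟨a, b⟩)) :=
  κ.coproj (corep m.unit) X a b

lemma gcomp_unitCoproj_mapL (a a' b : A) :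
    gcomp (κ.unitCoproj X a b) (mapL m (act.obj ⟨corep m.unit, X⟩) a a' b) =
      eComp V m.unit a a' ≫ κ.unitCoproj X a' b :=
  ((κ.coproj_isBilinear (corep m.unit) X).left a a' b).trans
    (congrArg (fun t => t ≫ κ.unitCoproj X a' b) (actR_corep m.unit a a'))

/-- The morphism `I * X ⟶ X`. -/
def unitorHom : 𝟙_ V ⟶ (act.obj ⟨corep m.unit, X⟩ ⟶[V] X) :=
  (κ.exists_of_isBilinear (unitFamily_isBilinear X)).choose

lemma unitCoproj_unitorHom (a b : A) :
    κ.unitCoproj X a b ≫ post (κ.unitorHom X ≫ natπ _ _ (m.tensor.obj ⟨a, b⟩)) =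
      unitFamily m X a b :=
  (κ.exists_of_isBilinear (unitFamily_isBilinear X)).choose_spec a b

/-- The components of the morphism `X ⟶ I * X`, up to the left unitor of `A`. -/
def unitorInvAux (b : A) :
    𝟙_ V ⟶ (X.obj b ⟶[V] (act.obj ⟨corep m.unit, X⟩).obj (m.tensor.obj ⟨m.unit, b⟩)) :=
  eId V m.unit ≫ κ.unitCoproj X m.unit b

lemma unitorInv_natural : IsNatural X (act.obj ⟨corep m.unit, X⟩)
    fun b => κ.unitorInvAux X b ≫ post (mapHom _ (leftUnitorIso m b).hom) :=
  IsNatural.post (G := shift m _ m.unit)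
    (IsNatural.precomp (G := shift m _ m.unit)
      ((κ.coproj_isBilinear (corep m.unit) X).right m.unit) _)
    (leftUnitor_mapHom_natural _)

/-- The morphism `X ⟶ I * X`. -/
def unitorInv : 𝟙_ V ⟶ (X ⟶[V] act.obj ⟨corep m.unit, X⟩) :=
  natLift _ _ _ (κ.unitorInv_natural X)

lemma unitorInv_π (b : A) : κ.unitorInv X ≫ natπ _ _ b =
    κ.unitorInvAux X b ≫ post (mapHom _ (leftUnitorIso m b).hom) :=
  natLift_π _ _ _ _ _

/-- At the identity of i the family `unitFamily` is the inverse left unitor, which the last factor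
cancels. The same equation is the normalization demanded by `IsLeftUnitor`. -/
lemma unitorInvAux_comp (b : A) :
    (κ.unitorInvAux X b ≫ post (κ.unitorHom X ≫ natπ _ _ (m.tensor.obj ⟨m.unit, b⟩))) ≫
      post (mapHom X (leftUnitorIso m b).hom) = eId V _ := by
  rw [unitorInvAux, Category.assoc (eId V m.unit), unitCoproj_unitorHom, eId_unitFamily, mapHom_inv_hom]

lemma unitorInv_comp_hom : κ.unitorInv X ≫ post (κ.unitorHom X) = eId V X := by
  refine natObj_hom_ext fun b => ?_
  refine (comp_post_natπ _ _ b).trans (Eq.trans ?_ (functorCategory_eId_π X b).symm)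
  rw [unitorInv_π, Category.assoc, post_mapHom_natπ, ← Category.assoc]
  exact κ.unitorInvAux_comp X b

/-- Yoneda for A(i,-): naturality in a recovers the whole family from its value at the identity of
i. This identifies the composite I * X ⟶ X ⟶ I * X on the universal family. -/
lemma mapL_pre_unitorInvAux (a b : A) :
    mapL m (act.obj ⟨corep m.unit, X⟩) m.unit a b ≫ pre (κ.unitorInvAux X b) =
      κ.unitCoproj X a b := by
  rw [comp_pre, unitorInvAux, ← gcomp_whisker, gcomp_unitCoproj_mapL, ← Category.assoc,
    ← Category.assoc, Category.assoc _ (eId V m.unit ▷ _), e_id_comp, Category.id_comp]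

lemma unitCoproj_unitorHom_comp_inv (a b : A) :
    (κ.unitCoproj X a b ≫ post (κ.unitorHom X ≫ natπ _ _ (m.tensor.obj ⟨a, b⟩))) ≫
      post (κ.unitorInv X ≫ natπ _ _ (m.tensor.obj ⟨a, b⟩)) = κ.unitCoproj X a b := by
  rw [unitCoproj_unitorHom,
    unitFamily, Category.assoc, pre_post, ← Category.assoc,
    Sq.unit' (mapL_natural (κ.unitorInv X) m.unit a b), Category.assoc, pre_pre, natπ_post_mapHom,
    unitorInv_π, Category.assoc, post_mapHom_comp, Iso.hom_inv_id, post_mapHom_id, Category.comp_id,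
    mapL_pre_unitorInvAux]

lemma unitorHom_comp_inv : κ.unitorHom X ≫ post (κ.unitorInv X) = eId V _ :=
  κ.hom_ext_unit fun a b => (κ.coproj_post _ _ a b).trans
    ((κ.unitCoproj_unitorHom_comp_inv X a b).trans (κ.coproj_post_eId _ X a b).symm)

lemma unitorHom_natural {X' : EnrichedFunctor V A K} {U : V} (ψ : U ⟶ (X ⟶[V] X')) :
    mapSnd act (corep m.unit) ψ ≫ post (κ.unitorHom X') = ψ ≫ pre (κ.unitorHom X) := by
  refine κ.hom_ext fun a b => ?_
  refine (κ.gcomp_coproj_post _ _ a b).trans (Eq.trans ?_ (κ.gcomp_coproj_pre _ _ a b).symm)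
  rw [gcomp_coproj_mapSnd, Category.assoc, ← gcomp_post]
  exact (congrArg (fun t => (β_ _ _).hom ≫ gcomp _ t) (κ.unitCoproj_unitorHom X' a b)).trans
    ((unitFamily_natural ψ a b).symm.trans
      (congrArg (fun t => gcomp t _) (κ.unitCoproj_unitorHom X a b)).symm)

/-- The unit isomorphism `I * X ≅ X`. -/
def unitor : NaturalIso (fixLeft act (corep m.unit)) (EnrichedFunctor.id V (EnrichedFunctor V A K)) where
  iso X := forgetIso (κ.unitorHom X) (κ.unitorInv X) (κ.unitorHom_comp_inv X)
    (κ.unitorInv_comp_hom X)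
  natural := isNatural_unit_iff.mpr fun X X' => by
    have := κ.unitorHom_natural X (𝟙 (X ⟶[V] X'))
    rw [mapSnd_id] at this
    exact this

lemma isLeftUnitor_unitor : κ.IsLeftUnitor (I := corep m.unit) (eId V m.unit) κ.unitor.iso := by
  intro X b
  rw [postComp_eq, postComp_eq]
  exact κ.unitorInvAux_comp X b

end Convolution

end convolution

/-! ### The right unit isomorphism F * I ≅ F of Day convolution -/

section convolution
variable [SymmetricCategory V] [MonoidalClosed V] [HasLimits V]
variable {A : Type w} [EnrichedCategory V A] {m : MonoidalStructure V A}

lemma Sq.symm {C : Type u₂} [EnrichedCategory V C] {U P : V} {W X Y Z : C} {f : P ⟶ (W ⟶[V] X)}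
    {s' : U ⟶ (X ⟶[V] Z)} {s : U ⟶ (W ⟶[V] Y)} {g : P ⟶ (Y ⟶[V] Z)} (h : Sq f s' s g) :
    Sq s g f s' := by
  rw [Sq, h, SymmetricCategory.symmetry_assoc]

lemma gcomp_swap_of_sq {U P W X Y Z : V} {k : P ⟶ EnrichedCategory.Hom W X}
    {q' : U ⟶ EnrichedCategory.Hom X Z} {q : U ⟶ EnrichedCategory.Hom W Y}
    {g : P ⟶ EnrichedCategory.Hom Y Z} (h : Sq k q' q g) :
    gcomp (cur ((β_ _ _).hom ≫ unc q)) g = unc k ≫ cur ((β_ _ _).hom ≫ unc q') := by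
  have h := sq_iff_unc.mp h
  rw [Iso.inv_comp_eq] at h
  refine unc_injective ?_
  rw [unc_gcomp, unc_comp, unc_cur, unc_cur, BraidedCategory.braiding_naturality_right_assoc, h,
    BraidedCategory.braiding_tensor_right_hom]
  simp only [Category.assoc, Iso.inv_hom_id_assoc, comp_whiskerRight]
  rw [← MonoidalCategory.whiskerLeft_comp_assoc, SymmetricCategory.symmetry,
    MonoidalCategory.whiskerLeft_id, Category.id_comp, Iso.hom_inv_id_assoc]

lemma sq_swap_of_gcomp {U P U' W Y Z : V} {k : P ⟶ EnrichedCategory.Hom U U'}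
    {q' : U' ⟶ EnrichedCategory.Hom W Z} {q : U ⟶ EnrichedCategory.Hom W Y}
    {g : P ⟶ EnrichedCategory.Hom Y Z} (h : gcomp q g = unc k ≫ q') :
    Sq k (cur ((β_ _ _).hom ≫ unc q')) (cur ((β_ _ _).hom ≫ unc q)) g := by
  have h := congrArg unc h
  rw [unc_gcomp, unc_comp, Iso.inv_comp_eq] at h
  refine sq_iff_unc.mpr ?_
  rw [unc_cur, unc_cur, BraidedCategory.braiding_naturality_left_assoc,
    BraidedCategory.braiding_tensor_left_hom]
  simp only [Category.assoc, Iso.inv_hom_id_assoc, comp_whiskerRight]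
  rw [h]

/-- With values in V, the symmetry exchanges the two arguments of a bilinear family and with them
its two naturality conditions. It is needed because Yoneda produces A(i,b) ⟶ [F(a), F(m(a,b))],
while a bilinear family from F and I has source F(a). -/
lemma isBilinear_swap {F G H : EnrichedFunctor V A V}
    {q : ∀ a b, G.obj b ⟶ EnrichedCategory.Hom (F.obj a) (H.obj (m.tensor.obj ⟨a, b⟩))}
    (h₁ : ∀ a a' b, Sq (F.map a a') (q a' b) (q a b) (mapL m H a a' b))
    (h₂ : ∀ a b b', gcomp (q a b) (mapR m H a b b') = actR G b b' ≫ q a b') :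
    IsBilinear m F G H fun a b => cur ((β_ _ _).hom ≫ unc (q a b)) where
  left a a' b := gcomp_swap_of_sq (h₁ a a' b)
  right a b b' := sq_swap_of_gcomp (h₂ a b b')

section
variable {K : Type u₁} [EnrichedCategory V K]

/-- The morphisms `A(i, b) ⟶ K(X(a), X(m(a, b)))`. -/
def counitFamily (m : MonoidalStructure V A) (X : EnrichedFunctor V A K) (a b : A) :
    (m.unit ⟶[V] b) ⟶ (X.obj a ⟶[V] X.obj (m.tensor.obj ⟨a, b⟩)) :=
  mapR m X a m.unit b ≫ pre (mapHom X (rightUnitorIso m a).inv)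

lemma gcomp_counitFamily_mapR (X : EnrichedFunctor V A K) (a b b' : A) :
    gcomp (counitFamily m X a b) (mapR m X a b b') =
      eComp V m.unit b b' ≫ counitFamily m X a b' := by
  rw [counitFamily, gcomp_pre, ← eComp_mapR, Category.assoc, counitFamily]

lemma counitFamily_sq (X : EnrichedFunctor V A K) (a a' b : A) :
    Sq (X.map a a') (counitFamily m X a' b) (counitFamily m X a b) (mapL m X a a' b) :=
  IsNatural.pre (G := fixRight (m.tensor.comp V X) m.unit) (H := fixRight (m.tensor.comp V X) b)
    (s := fun a => mapR m X a m.unit b)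
    (fun a a' => Sq.symm (curryApp_natural (m.tensor.comp V X) a a' m.unit b))
    (rightUnitor_mapHom_inv_natural X) a a'

lemma counitFamily_natural {X Y : EnrichedFunctor V A K} {U : V} (φ : U ⟶ (X ⟶[V] Y)) (a b : A) :
    Sq (counitFamily m X a b) (φ ≫ natπ X Y (m.tensor.obj ⟨a, b⟩)) (φ ≫ natπ X Y a)
      (counitFamily m Y a b) := by
  rw [Sq, counitFamily, gcomp_pre, mapR_natural φ a m.unit b, Category.assoc, ← gcomp_pre,
    Category.assoc φ, natπ_pre_mapHom, ← Category.assoc, gcomp_post_left, counitFamily]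

lemma eId_counitFamily (X : EnrichedFunctor V A K) (a : A) :
    eId V m.unit ≫ counitFamily m X a m.unit = mapHom X (rightUnitorIso m a).inv := by
  rw [counitFamily, ← Category.assoc]
  refine (congrArg (fun t => t ≫ pre _) (eId_mapR X a m.unit)).trans ?_
  rw [eId_pre]

end

lemma counitFamily_isBilinear (F : EnrichedFunctor V A V) :
    IsBilinear m F (corep m.unit) F fun a b => cur ((β_ _ _).hom ≫ unc (counitFamily m F a b)) :=
  isBilinear_swap (F := F) (G := corep m.unit) (H := F) (q := fun a b => counitFamily m F a b) (fun a a' b => counitFamily_sq F a a' b) fun a b b' =>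
    (gcomp_counitFamily_mapR F a b b').trans
      (congrArg (fun t => t ≫ counitFamily m F a b') (actR_corep m.unit b b').symm)

lemma elt_unit_aux {X Y U : V} (e : 𝟙_ V ⟶ U) (q : U ⟶ EnrichedCategory.Hom X Y) :
    (λ_ X).inv ≫ e ▷ X ≫ (β_ _ _).hom ≫ unc q = mor (e ≫ q) := by
  rw [mor, unc_comp, BraidedCategory.braiding_naturality_left_assoc, braiding_tensorUnit_left]
  simp

namespace Convolution
variable {tens : EnrichedFunctor V (TensorObj (EnrichedFunctor V A V) (EnrichedFunctor V A V))
    (EnrichedFunctor V A V)} (δ : Convolution m (selfCopowers V) tens) (F : EnrichedFunctor V A V)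

/-- The canonical morphism `A(i, b) ⊗ F(a) ⟶ (F * I)(m(a, b))`. -/
def counitCoproj (a b : A) : (m.unit ⟶[V] b) ⊗ F.obj a ⟶
    (tens.obj ⟨F, corep m.unit⟩).obj (m.tensor.obj ⟨a, b⟩) :=
  δ.τ F (corep m.unit) a b

lemma counitCoproj_mapL (a a' b : A) :
    δ.counitCoproj F a b ▷ (a ⟶[V] a') ≫ unc (mapL m (tens.obj ⟨F, corep m.unit⟩) a a' b) =
      (α_ _ _ _).hom ≫ _ ◁ actR F a a' ≫ δ.counitCoproj F a' b :=
  unc_mapL_of_isBilinear (δ.coproj_isBilinear F (corep m.unit)) a a' b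

lemma counitCoproj_mapR (a b b' : A) :
    δ.counitCoproj F a b ▷ (b ⟶[V] b') ≫ unc (mapR m (tens.obj ⟨F, corep m.unit⟩) a b b') =
      (α_ _ _ _).hom ≫ _ ◁ (β_ _ _).hom ≫ (α_ _ _ _).inv ≫ eComp V m.unit b b' ▷ F.obj a ≫
        δ.counitCoproj F a b' :=
  (unc_mapR_of_isBilinear (δ.coproj_isBilinear F (corep m.unit)) a b b').trans
    (congrArg (fun t => (α_ _ _ _).hom ≫ _ ◁ (β_ _ _).hom ≫ (α_ _ _ _).inv ≫ t ▷ F.obj a ≫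
      δ.counitCoproj F a b') (actR_corep m.unit b b'))

/-- The morphism `F * I ⟶ F`. -/
def counitorHom : 𝟙_ V ⟶ (tens.obj ⟨F, corep m.unit⟩ ⟶[V] F) :=
  (δ.exists_of_isBilinear (counitFamily_isBilinear F)).choose

lemma coproj_counitorHom (a b : A) :
    δ.coproj F (corep m.unit) a b ≫ post (δ.counitorHom F ≫ natπ _ _ (m.tensor.obj ⟨a, b⟩)) =
      cur ((β_ _ _).hom ≫ unc (counitFamily m F a b)) :=
  (δ.exists_of_isBilinear (counitFamily_isBilinear F)).choose_spec a b

lemma counitCoproj_counitorHom (a b : A) :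
    δ.counitCoproj F a b ≫ mor (δ.counitorHom F ≫ natπ _ _ (m.tensor.obj ⟨a, b⟩)) =
      (β_ _ _).hom ≫ unc (counitFamily m F a b) :=
  (δ.τ_mor _ a b).trans ((congrArg unc (δ.coproj_counitorHom F a b)).trans (unc_cur _))

/-- The components of the morphism `F ⟶ F * I`, up to the right unitor of `A`. -/
def counitorInvAux (a : A) :
    F.obj a ⟶ (tens.obj ⟨F, corep m.unit⟩).obj (m.tensor.obj ⟨a, m.unit⟩) :=
  (λ_ _).inv ≫ eId V m.unit ▷ F.obj a ≫ δ.counitCoproj F a m.unit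

lemma counitorInvAux_mapL (a a' : A) : δ.counitorInvAux F a ▷ (a ⟶[V] a') ≫
    unc (mapL m (tens.obj ⟨F, corep m.unit⟩) a a' m.unit) =
      actR F a a' ≫ δ.counitorInvAux F a' := by
  rw [counitorInvAux, comp_whiskerRight, comp_whiskerRight, Category.assoc, Category.assoc,
    counitCoproj_mapL, counitorInvAux, associator_naturality_left_assoc,
    ← whisker_exchange_assoc, leftUnitor_inv_naturality_assoc]
  simp

lemma mapL_rightUnitor (a a' : A) (W : EnrichedFunctor V A V) :
    unc (mapL m W a a' m.unit) ≫ mor (mapHom W (rightUnitorIso m a').hom) =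
      mor (mapHom W (rightUnitorIso m a).hom) ▷ _ ≫ actR W a a' := by
  have h : mapL m W a a' m.unit ≫ post (mapHom W (rightUnitorIso m a').hom) =
      W.map a a' ≫ pre (mapHom W (rightUnitorIso m a).hom) :=
    isNatural_unit_iff.mp (rightUnitor_mapHom_natural W) a a'
  rw [actR, ← unc_post, ← unc_pre, h]

lemma counitorInv_natural (a a' : A) :
    actR F a a' ≫ δ.counitorInvAux F a' ≫ mor (mapHom _ (rightUnitorIso m a').hom) =
      (δ.counitorInvAux F a ≫ mor (mapHom _ (rightUnitorIso m a).hom)) ▷ (a ⟶[V] a') ≫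
        actR (tens.obj ⟨F, corep m.unit⟩) a a' := by
  rw [← Category.assoc, ← counitorInvAux_mapL, Category.assoc, mapL_rightUnitor,
    comp_whiskerRight, Category.assoc]

/-- The morphism `F ⟶ F * I`. -/
def counitorInv : 𝟙_ V ⟶ (F ⟶[V] tens.obj ⟨F, corep m.unit⟩) :=
  (exists_of_actR (F := F) (G := tens.obj ⟨F, corep m.unit⟩) _ (δ.counitorInv_natural F)).choose

lemma mor_counitorInv_π (a : A) : mor (δ.counitorInv F ≫ natπ _ _ a) =
    δ.counitorInvAux F a ≫ mor (mapHom _ (rightUnitorIso m a).hom) :=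
  (exists_of_actR (F := F) (G := tens.obj ⟨F, corep m.unit⟩) _
    (δ.counitorInv_natural F)).choose_spec a

lemma counitorInv_π (a : A) : δ.counitorInv F ≫ natπ _ _ a =
    elt (δ.counitorInvAux F a) ≫ post (mapHom _ (rightUnitorIso m a).hom) :=
  mor_injective (by rw [mor_counitorInv_π, mor_comp, mor_elt])

lemma counitorInvAux_comp (a : A) :
    δ.counitorInvAux F a ≫ mor (δ.counitorHom F ≫ natπ _ _ (m.tensor.obj ⟨a, m.unit⟩)) ≫
      mor (mapHom F (rightUnitorIso m a).hom) = 𝟙 _ := by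
  rw [counitorInvAux, Category.assoc, Category.assoc,
    reassoc_of% (δ.counitCoproj_counitorHom F a m.unit), ← mor_eId,
    ← mapHom_inv_hom F (rightUnitorIso m a), mor_comp, ← eId_counitFamily, ← elt_unit_aux]
  simp only [Category.assoc]

lemma counitorInv_comp_hom : δ.counitorInv F ≫ post (δ.counitorHom F) = eId V F := by
  refine natObj_unit_ext fun a => ?_
  refine (congrArg mor (comp_post_natπ _ _ a)).trans (Eq.trans ?_
    (congrArg mor (functorCategory_eId_π F a)).symm)
  rw [counitorInv_π, Category.assoc, post_mapHom_natπ, ← Category.assoc, mor_comp, mor_comp, mor_elt,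
    mor_eId, Category.assoc, counitorInvAux_comp]

/-- Yoneda in the second variable: transporting the value at the identity of i along A(i,b) recovers
the canonical map at b, up to the symmetry. -/
lemma counitorInvAux_mapR (a b : A) : δ.counitorInvAux F a ▷ (m.unit ⟶[V] b) ≫
    unc (mapR m (tens.obj ⟨F, corep m.unit⟩) a m.unit b) =
      (β_ _ _).hom ≫ δ.counitCoproj F a b := by
  have h : eId V m.unit ▷ (m.unit ⟶[V] b) ≫ eComp V m.unit m.unit b = (λ_ _).hom := by
    have := e_id_comp V m.unit b
    rwa [Iso.inv_comp_eq, Category.comp_id] at this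
  rw [counitorInvAux, ← Category.assoc, comp_whiskerRight, Category.assoc, counitCoproj_mapR]
  have h' := congrArg (fun t => t ≫ δ.counitCoproj F a b)
    (braiding_elt_aux (f := F.obj a) (eId V m.unit) (eComp V m.unit m.unit b) h)
  simp only [Category.assoc] at h' ⊢
  exact h'

lemma counitFamily_counitorInv (a b : A) :
    counitFamily m F a b ≫ post (δ.counitorInv F ≫ natπ _ _ (m.tensor.obj ⟨a, b⟩)) =
      mapR m (tens.obj ⟨F, corep m.unit⟩) a m.unit b ≫ pre (elt (δ.counitorInvAux F a)) := by
  rw [counitFamily, Category.assoc, pre_post, ← Category.assoc,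
    Sq.unit' (mapR_natural (δ.counitorInv F) a m.unit b), Category.assoc, pre_pre, natπ_post_mapHom,
    counitorInv_π, Category.assoc, post_mapHom_comp, Iso.hom_inv_id, post_mapHom_id,
    Category.comp_id]

lemma counitCoproj_counitorHom_comp_inv (a b : A) :
    δ.counitCoproj F a b ≫ mor (δ.counitorHom F ≫ natπ _ _ (m.tensor.obj ⟨a, b⟩)) ≫
      mor (δ.counitorInv F ≫ natπ _ _ (m.tensor.obj ⟨a, b⟩)) = δ.counitCoproj F a b := by
  rw [← Category.assoc, counitCoproj_counitorHom, Category.assoc, ← unc_post,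
    counitFamily_counitorInv, unc_pre, mor_elt, counitorInvAux_mapR,
    SymmetricCategory.symmetry_assoc]

lemma counitorHom_comp_inv : δ.counitorHom F ≫ post (δ.counitorInv F) = eId V _ := by
  refine δ.hom_ext_unit fun a b => unc_injective ?_
  refine (unc_post _ _).trans (Eq.trans ?_ (congrArg unc (δ.coproj_post_eId F _ a b).symm))
  refine (congrArg (fun t => _ ≫ t) ((congrArg mor (comp_post_natπ _ _ _)).trans
    (mor_comp _ _))).trans ?_
  exact δ.counitCoproj_counitorHom_comp_inv F a b

lemma counitorHom_natural {F' : EnrichedFunctor V A V} {U : V} (φ : U ⟶ (F ⟶[V] F')) :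
    mapFst tens (corep m.unit) φ ≫ post (δ.counitorHom F') = φ ≫ pre (δ.counitorHom F) := by
  refine δ.hom_ext fun a b => ?_
  refine (δ.gcomp_coproj_post _ _ a b).trans (Eq.trans ?_ (δ.gcomp_coproj_pre _ _ a b).symm)
  rw [gcomp_coproj_mapFst, Category.assoc, coproj_counitorHom, coproj_counitorHom]
  exact (gcomp_swap_of_sq (counitFamily_natural φ a b).symm).symm

/-- The unit isomorphism `F * I ≅ F`. -/
def counitor :
    NaturalIso (fixRight tens (corep m.unit)) (EnrichedFunctor.id V (EnrichedFunctor V A V)) where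
  iso F := forgetIso (δ.counitorHom F) (δ.counitorInv F) (δ.counitorHom_comp_inv F)
    (δ.counitorInv_comp_hom F)
  natural := isNatural_unit_iff.mpr fun F F' => by
    have := δ.counitorHom_natural F (𝟙 (F ⟶[V] F'))
    rw [mapFst_id] at this
    exact this

lemma isRightUnitor_counitor :
    δ.IsRightUnitor (I := corep m.unit) (eId V m.unit) δ.counitor.iso := by
  intro F a
  have h₁ := unc_post (δ.coproj F (corep m.unit) a m.unit)
    (δ.counitorHom F ≫ natπ _ _ (m.tensor.obj ⟨a, m.unit⟩))
  have h₂ := unc_post (δ.coproj F (corep m.unit) a m.unit ≫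
    post (δ.counitorHom F ≫ natπ _ _ (m.tensor.obj ⟨a, m.unit⟩)))
    (mapHom F (rightUnitorIso m a).hom)
  rw [postComp_eq, postComp_eq]
  refine Eq.trans ?_ (δ.counitorInvAux_comp F a)
  rw [counitorInvAux]
  simp only [Category.assoc] at h₁ h₂ ⊢
  refine congrArg (fun t => (λ_ _).inv ≫ eId V m.unit ▷ _ ≫ t) ?_
  refine h₂.trans ((congrArg (fun t => t ≫ mor _) h₁).trans ?_)
  exact Category.assoc _ _ _

end Convolution

end convolution

/-! ### The unit axioms -/

section convolution
variable [SymmetricCategory V] [MonoidalClosed V] [HasLimits V]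
variable {A : Type w} [EnrichedCategory V A] {m : MonoidalStructure V A}
variable {K : Type u₁} [EnrichedCategory V K] {P : Copowers V K}

lemma mapL_assocMap (W : EnrichedFunctor V A K) (a a' b c : A) :
    (tensorMapL m a a' b ≫ mapL m W (m.tensor.obj ⟨a, b⟩) (m.tensor.obj ⟨a', b⟩) c) ≫
        post (mapHom W (assocIso m a' b c).hom) =
      mapL m W a a' (m.tensor.obj ⟨b, c⟩) ≫ pre (mapHom W (assocIso m a b c).hom) :=
  (congrArg (fun t => t ≫ post _) (leftNested_map₁ _ _ _ _ _ _).symm).trans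
    ((isNatural_unit_iff.mp (((assocMap_natural (m := m) W).whiskerLeft (insertRight _ c)).whiskerLeft
      (insertRight _ b)) a a').trans (congrArg (fun t => t ≫ pre _) (rightNested_map₁ _ _ _ _ _ _)))

lemma mapR_assocMap (W : EnrichedFunctor V A K) (a b b' c : A) :
    (tensorMapR m a b b' ≫ mapL m W (m.tensor.obj ⟨a, b⟩) (m.tensor.obj ⟨a, b'⟩) c) ≫
        post (mapHom W (assocIso m a b' c).hom) =
      (tensorMapL m b b' c ≫ mapR m W a (m.tensor.obj ⟨b, c⟩) (m.tensor.obj ⟨b', c⟩)) ≫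
        pre (mapHom W (assocIso m a b c).hom) :=
  (congrArg (fun t => t ≫ post _) (leftNested_map₂ _ _ _ _ _ _).symm).trans
    ((isNatural_unit_iff.mp (((assocMap_natural (m := m) W).whiskerLeft (insertRight _ c)).whiskerLeft
      (insertLeft _ a)) b b').trans (congrArg (fun t => t ≫ pre _) (rightNested_map₂ _ _ _ _ _ _)))

/-- Not an axiom but a consequence of the pentagon and the triangle in A, taken from the monoidal
category `m.Underlying`. It is what the left unit axiom of the action reduces to. -/
lemma leftUnitor_tensor_assocIso (b c : A) :
    map₂ m.tensor (leftUnitorIso m b).inv (𝟙 (ForgetEnrichment.of V c)) ≫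
      (assocIso m m.unit b c).hom = (leftUnitorIso m (m.tensor.obj ⟨b, c⟩)).inv :=
  (leftUnitor_tensor_inv (m.of b) (m.of c)).symm

lemma triangle_assocIso (a c : A) :
    map₂ m.tensor (rightUnitorIso m a).inv (𝟙 (ForgetEnrichment.of V c)) ≫
      (assocIso m a m.unit c).hom =
        map₂ m.tensor (𝟙 (ForgetEnrichment.of V a)) (leftUnitorIso m c).inv :=
  triangle_assoc_comp_right_inv (m.of a) (m.of c)

namespace IsBilinear
variable {F : EnrichedFunctor V A V} {X W : EnrichedFunctor V A K}
  {t : ∀ a b, F.obj a ⟶ (X.obj b ⟶[V] W.obj (m.tensor.obj ⟨a, b⟩))}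

/-- Bilinearity in the first variable moves the action of a morphism followed by that of a
generalized element from F to W. With `gcomp_map_comp` for the second variable, it brings the unit
families into a form where the associator of A can be applied. -/
lemma unc_map_comp (ht : IsBilinear m F X W t) {x y y' : A} {U : V}
    (f : ForgetEnrichment.of V x ⟶ ForgetEnrichment.of V y) (g : U ⟶ (y ⟶[V] y')) (c : A) :
    unc ((g ≫ F.map y y') ≫ pre (mapHom F f)) ≫ t y' c =
      gcomp (t x c ≫ post (mapHom W (map₂ m.tensor f (𝟙 (ForgetEnrichment.of V c)))))
        (g ≫ mapL m W y y' c) := by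
  rw [unc_pre, unc_comp, ← ht.mapHom_left, ← gcomp_whisker, ← whisker_gcomp, ht.left, actR]
  simp only [Category.assoc]

lemma gcomp_map_comp (ht : IsBilinear m F X W t) {x y y' : A} {U : V}
    (f : ForgetEnrichment.of V x ⟶ ForgetEnrichment.of V y) (g : U ⟶ (y ⟶[V] y')) (a : A) :
    gcomp ((g ≫ X.map y y') ≫ pre (mapHom X f)) (t a y') = (β_ _ _).hom ≫
      gcomp (t a x ≫ post (mapHom W (map₂ m.tensor (𝟙 (ForgetEnrichment.of V a)) f)))
        (g ≫ mapR m W a y y') := by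
  have h := Sq.precomp (ht.right a y y') (𝟙 _) g
  rw [Category.id_comp, Category.id_comp, Sq] at h
  rw [gcomp_pre, h, Category.assoc, ← gcomp_pre, ht.mapHom_right]

end IsBilinear

namespace Convolution
variable {act : EnrichedFunctor V (TensorObj (EnrichedFunctor V A V) (EnrichedFunctor V A K))
    (EnrichedFunctor V A K)}
  {tens : EnrichedFunctor V (TensorObj (EnrichedFunctor V A V) (EnrichedFunctor V A V))
    (EnrichedFunctor V A V)}
  (δ : Convolution m (selfCopowers V) tens) (κ : Convolution m P act)
  (F : EnrichedFunctor V A V) (X : EnrichedFunctor V A K)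

lemma rightCoproj_assocHom_mapFst (G : EnrichedFunctor V A V) {H : EnrichedFunctor V A V}
    (φ : 𝟙_ V ⟶ (tens.obj ⟨F, G⟩ ⟶[V] H)) (a b c : A) :
    κ.rightCoproj F G X a b c ≫ post ((assocHom δ κ F G X ≫ post (mapFst act X φ)) ≫
        natπ _ _ (m.tensor.obj ⟨a, m.tensor.obj ⟨b, c⟩⟩)) =
      ((δ.τ F G a b ≫ mor (φ ≫ natπ _ _ (m.tensor.obj ⟨a, b⟩))) ≫
        κ.coproj H X (m.tensor.obj ⟨a, b⟩) c) ≫ post (mapHom _ (assocIso m a b c).hom) := by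
  rw [post_comp_natπ, ← Category.assoc, rightCoproj_assocHom, Category.assoc, post_mapHom_natπ,
    leftCoproj, Category.assoc, ← Category.assoc (κ.coproj _ _ _ _), coproj_mapFst]
  simp only [Category.assoc]

lemma rightCoproj_unitorHom (a b c : A) :
    κ.rightCoproj (corep m.unit) F X a b c ≫ post (κ.unitorHom (act.obj ⟨F, X⟩) ≫
        natπ _ _ (m.tensor.obj ⟨a, m.tensor.obj ⟨b, c⟩⟩)) =
      gcomp (κ.coproj F X b c) (unitFamily m (act.obj ⟨F, X⟩) a (m.tensor.obj ⟨b, c⟩)) :=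
  (gcomp_post _ _ _).symm.trans (congrArg (gcomp _) (κ.unitCoproj_unitorHom _ a _))

lemma τ_unitorHom (a b : A) :
    δ.τ (corep m.unit) F a b ≫ mor (δ.unitorHom F ≫ natπ _ _ (m.tensor.obj ⟨a, b⟩)) =
      unc (unitFamily m F a b) :=
  (δ.τ_mor _ a b).trans (congrArg unc (δ.unitCoproj_unitorHom F a b))

/-- The action along A(i,a) passes through the associator of A by naturality; what remains is the
inverse left unitor of b tensored with c followed by the associator, which is the inverse left
unitor of m(b,c). -/
lemma unc_unitFamily_coproj (a b c : A) :
    (unc (unitFamily m F a b) ≫ κ.coproj F X (m.tensor.obj ⟨a, b⟩) c) ≫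
        post (mapHom _ (assocIso m a b c).hom) =
      gcomp (κ.coproj F X b c) (unitFamily m (act.obj ⟨F, X⟩) a (m.tensor.obj ⟨b, c⟩)) := by
  rw [unitFamily, mapL_eq_comp, (κ.coproj_isBilinear F X).unc_map_comp, ← gcomp_post,
    mapL_assocMap, ← gcomp_post_left, Category.assoc, post_mapHom_comp, leftUnitor_tensor_assocIso,
    gcomp_post_left, unitFamily]

lemma assocHom_left_unit :
    assocHom δ κ (corep m.unit) F X ≫ post (mapFst act X (δ.unitorHom F)) =
      κ.unitorHom (act.obj ⟨F, X⟩) :=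
  κ.rightNested_ext_unit fun a b c =>
    (rightCoproj_assocHom_mapFst δ κ (corep m.unit) X F (δ.unitorHom F) a b c).trans
      ((congrArg (fun t => (t ≫ κ.coproj F X (m.tensor.obj ⟨a, b⟩) c) ≫ post _)
        (δ.τ_unitorHom F a b)).trans ((κ.unc_unitFamily_coproj F X a b c).trans
          (κ.rightCoproj_unitorHom F X a b c).symm))

lemma rightCoproj_mapSnd_unitorHom (a b c : A) :
    κ.rightCoproj F (corep m.unit) X a b c ≫ post (mapSnd act F (κ.unitorHom X) ≫
        natπ _ _ (m.tensor.obj ⟨a, m.tensor.obj ⟨b, c⟩⟩)) =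
      gcomp (unitFamily m X b c) (κ.coproj F X a (m.tensor.obj ⟨b, c⟩)) := by
  have h := κ.coproj_mapSnd F _ X a (m.tensor.obj ⟨b, c⟩) (κ.unitorHom X)
  refine (gcomp_post _ _ _).symm.trans ((congrArg (gcomp _) h).trans ?_)
  refine (gcomp_post_left _ _ _).symm.trans ?_
  exact congrArg (fun t => gcomp t _) (κ.unitCoproj_unitorHom X b c)

/-- As for the left unit, except that what remains is the inverse right unitor of a tensored with c
followed by the associator. By the triangle in A this is the inverse left unitor of c in the second
variable, where naturality of `coproj` turns it into the unit family of X. -/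
lemma unc_counitFamily_coproj (a b c : A) :
    (((β_ _ _).hom ≫ unc (counitFamily m F a b)) ≫ κ.coproj F X (m.tensor.obj ⟨a, b⟩) c) ≫
        post (mapHom _ (assocIso m a b c).hom) =
      gcomp (unitFamily m X b c) (κ.coproj F X a (m.tensor.obj ⟨b, c⟩)) := by
  rw [counitFamily, mapR_eq_comp, Category.assoc (β_ _ _).hom, (κ.coproj_isBilinear F X).unc_map_comp,
    Category.assoc, ← gcomp_post, mapR_assocMap, ← gcomp_post_left, Category.assoc,
    post_mapHom_comp, triangle_assocIso, unitFamily, mapL_eq_comp,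
    (κ.coproj_isBilinear F X).gcomp_map_comp]

lemma assocHom_right_unit :
    assocHom δ κ F (corep m.unit) X ≫ post (mapFst act X (δ.counitorHom F)) =
      mapSnd act F (κ.unitorHom X) :=
  κ.rightNested_ext_unit fun a b c =>
    (rightCoproj_assocHom_mapFst δ κ F X (corep m.unit) (δ.counitorHom F) a b c).trans
      ((congrArg (fun t => (t ≫ κ.coproj F X (m.tensor.obj ⟨a, b⟩) c) ≫ post _)
        (δ.counitCoproj_counitorHom F a b)).trans ((κ.unc_counitFamily_coproj F X a b c).trans
          (κ.rightCoproj_mapSnd_unitorHom F X a b c).symm))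

end Convolution

end convolution

/-! ### Passage to morphisms of underlying categories -/

section forget
variable [BraidedCategory V]
variable {C : Type u₁} [EnrichedCategory V C] {D : Type u₂} [EnrichedCategory V D]
  {E : Type u₃} [EnrichedCategory V E]

lemma homOf_comp_homOf {X Y Z : C} (f : 𝟙_ V ⟶ (X ⟶[V] Y)) (g : 𝟙_ V ⟶ (Y ⟶[V] Z)) :
    (ForgetEnrichment.homOf V f ≫ ForgetEnrichment.homOf V g :
      ForgetEnrichment.of V X ⟶ ForgetEnrichment.of V Z) = ForgetEnrichment.homOf V (f ≫ post g) :=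
  homTo_comp_eq (ForgetEnrichment.homOf V f) (ForgetEnrichment.homOf V g)

/-- The action of a `V`-functor of two variables on isomorphisms of underlying categories. -/
def map₂Iso (B : EnrichedFunctor V (TensorObj C D) E) {X X' : C} {Y Y' : D}
    (f : ForgetEnrichment.of V X ≅ ForgetEnrichment.of V X')
    (g : ForgetEnrichment.of V Y ≅ ForgetEnrichment.of V Y') :
    ForgetEnrichment.of V (B.obj ⟨X, Y⟩) ≅ ForgetEnrichment.of V (B.obj ⟨X', Y'⟩) where
  hom := map₂ B f.hom g.hom
  inv := map₂ B f.inv g.inv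
  hom_inv_id := by rw [← map₂_comp, f.hom_inv_id, g.hom_inv_id, map₂_id]
  inv_hom_id := by rw [← map₂_comp, f.inv_hom_id, g.inv_hom_id, map₂_id]

end forget

lemma comp_inv_aux {C : Type u₁} [Category.{u₂} C] {P Q R S T : C} (a : P ≅ Q) (b : Q ≅ R)
    (c : P ≅ S) (d : S ≅ T) (e : T ≅ R) (h : a.hom ≫ b.hom = c.hom ≫ d.hom ≫ e.hom) :
    a.hom ≫ b.hom ≫ e.inv = c.hom ≫ d.hom := by
  rw [reassoc_of% h, e.hom_inv_id, Category.comp_id]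

lemma inv_comp_aux {C : Type u₁} [Category.{u₂} C] {P Q R S T : C} (a : P ≅ Q) (b : Q ≅ R)
    (c : P ≅ S) (d : S ≅ T) (e : T ≅ R) (h : a.hom ≫ b.hom = c.hom ≫ d.hom ≫ e.hom) :
    e.inv ≫ d.inv ≫ c.inv = b.inv ≫ a.inv := by
  have := congrArg Iso.inv (Iso.ext (α := a ≪≫ b) (β := c ≪≫ d ≪≫ e) h)
  simpa using this.symm

section forgetSymm
variable [SymmetricCategory V] [MonoidalClosed V]
variable {A₁ : Type u₁} [EnrichedCategory V A₁] {A₂ : Type u₂} [EnrichedCategory V A₂]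
  {A₃ : Type u₃} [EnrichedCategory V A₃] (act : EnrichedFunctor V (TensorObj A₁ A₂) A₃)

lemma map₂_homOf_id {F F' : A₁} (X : A₂) (φ : 𝟙_ V ⟶ (F ⟶[V] F')) :
    map₂ act (ForgetEnrichment.homOf V φ) (𝟙 (ForgetEnrichment.of V X)) =
      ForgetEnrichment.homOf V (mapFst act X φ) :=
  (fixRight_forget_map act X (ForgetEnrichment.homOf V φ)).symm

lemma map₂_id_homOf (F : A₁) {X X' : A₂} (φ : 𝟙_ V ⟶ (X ⟶[V] X')) :
    map₂ act (𝟙 (ForgetEnrichment.of V F)) (ForgetEnrichment.homOf V φ) =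
      ForgetEnrichment.homOf V (mapSnd act F φ) :=
  (fixLeft_forget_map act F (ForgetEnrichment.homOf V φ)).symm

end forgetSymm

/-! ### The Day convolution structure and the action -/

section convolution
variable [SymmetricCategory V] [MonoidalClosed V] [HasLimits V]
variable {A : Type w} [EnrichedCategory V A] {m : MonoidalStructure V A}
variable {K : Type u₁} [EnrichedCategory V K] {P : Copowers V K}

/-- The inverse of a `V`-natural isomorphism. -/
def NaturalIso.symm {C : Type u₂} [EnrichedCategory V C] {D : Type u₃} [EnrichedCategory V D]
    {F G : EnrichedFunctor V C D} (α : NaturalIso F G) : NaturalIso G F where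
  iso c := (α.iso c).symm
  natural := isNatural_inv
    (fun c => (homTo_comp_eq _ _).symm.trans ((congrArg (ForgetEnrichment.homTo V)
      (α.iso c).hom_inv_id).trans (ForgetEnrichment.homTo_id V _)))
    (fun c => (homTo_comp_eq _ _).symm.trans ((congrArg (ForgetEnrichment.homTo V)
      (α.iso c).inv_hom_id).trans (ForgetEnrichment.homTo_id V _))) α.natural

namespace Convolution
variable {act : EnrichedFunctor V (TensorObj (EnrichedFunctor V A V) (EnrichedFunctor V A K))
    (EnrichedFunctor V A K)}
  {tens : EnrichedFunctor V (TensorObj (EnrichedFunctor V A V) (EnrichedFunctor V A V))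
    (EnrichedFunctor V A V)}
  (δ : Convolution m (selfCopowers V) tens) (κ : Convolution m P act)
  (F G H : EnrichedFunctor V A V) (X : EnrichedFunctor V A K)

/-- The isomorphism `F * (G * X) ≅ (F * G) * X`. -/
def associatorIso : ForgetEnrichment.of V (act.obj ⟨F, act.obj ⟨G, X⟩⟩) ≅
    ForgetEnrichment.of V (act.obj ⟨tens.obj ⟨F, G⟩, X⟩) :=
  (associator δ κ).iso ⟨⟨F, G⟩, X⟩

/-- The isomorphism `I * X ≅ X`. -/
def unitorIso : ForgetEnrichment.of V (act.obj ⟨corep m.unit, X⟩) ≅ ForgetEnrichment.of V X :=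
  κ.unitor.iso X

/-- The isomorphism `F * I ≅ F`. -/
def counitorIso : ForgetEnrichment.of V (tens.obj ⟨F, corep m.unit⟩) ≅ ForgetEnrichment.of V F :=
  δ.counitor.iso F

lemma associatorIso_pentagon :
    (associatorIso δ κ F G (act.obj ⟨H, X⟩)).hom ≫ (associatorIso δ κ (tens.obj ⟨F, G⟩) H X).hom =
      map₂ act (𝟙 (ForgetEnrichment.of V F)) (associatorIso δ κ G H X).hom ≫
        (associatorIso δ κ F (tens.obj ⟨G, H⟩) X).hom ≫
          map₂ act (associatorIso δ δ F G H).hom (𝟙 (ForgetEnrichment.of V X)) := by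
  have e₁ := map₂_id_homOf act F (assocHom δ κ G H X)
  have e₂ := map₂_homOf_id act X (assocHom δ δ F G H)
  refine (homOf_comp_homOf _ _).trans ((congrArg (ForgetEnrichment.homOf V)
    (assocHom_pentagon δ κ F G H X)).trans ?_)
  refine (homOf_comp_homOf _ _).symm.trans ?_
  refine congrArg₂ (fun s t => s ≫ t) e₁.symm ?_
  exact (homOf_comp_homOf _ _).symm.trans (congrArg (fun t => _ ≫ t) e₂.symm)

lemma associatorIso_left_unit :
    (associatorIso δ κ (corep m.unit) F X).hom ≫
        map₂ act (δ.unitorIso F).hom (𝟙 (ForgetEnrichment.of V X)) =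
      (κ.unitorIso (act.obj ⟨F, X⟩)).hom :=
  (congrArg (fun t => _ ≫ t) (map₂_homOf_id act X (δ.unitorHom F))).trans
    ((homOf_comp_homOf _ _).trans (congrArg (ForgetEnrichment.homOf V)
      (assocHom_left_unit δ κ F X)))

lemma associatorIso_right_unit :
    (associatorIso δ κ F (corep m.unit) X).hom ≫
        map₂ act (δ.counitorIso F).hom (𝟙 (ForgetEnrichment.of V X)) =
      map₂ act (𝟙 (ForgetEnrichment.of V F)) (κ.unitorIso X).hom :=
  (congrArg (fun t => _ ≫ t) (map₂_homOf_id act X (δ.counitorHom F))).trans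
    ((homOf_comp_homOf _ _).trans ((congrArg (ForgetEnrichment.homOf V)
      (assocHom_right_unit δ κ F X)).trans (map₂_id_homOf act F (κ.unitorHom X)).symm))

/-- The Day convolution monoidal structure. -/
def monoidalStructure : MonoidalStructure V (EnrichedFunctor V A V) where
  tensor := tens
  unit := corep m.unit
  -- A monoidal structure has its associator directed from (F * G) * H, opposite to that of an
  -- action, so its pentagon is the inverse of the action pentagon for [A,V] acting on itself.
  assoc := (associator δ δ).symm
  leftUnitor := δ.unitor
  rightUnitor := δ.counitor
  pentagon F G H X := inv_comp_aux (associatorIso δ δ F G (tens.obj ⟨H, X⟩))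
    (associatorIso δ δ (tens.obj ⟨F, G⟩) H X)
    (map₂Iso tens (Iso.refl (ForgetEnrichment.of V F)) (associatorIso δ δ G H X))
    (associatorIso δ δ F (tens.obj ⟨G, H⟩) X)
    (map₂Iso tens (associatorIso δ δ F G H) (Iso.refl (ForgetEnrichment.of V X)))
    (associatorIso_pentagon δ δ F G H X)
  -- The triangle is the right unit axiom of [A,V] acting on itself, rewritten with the inverse
  -- associator.
  triangle F X := (Iso.inv_comp_eq (associatorIso δ δ F (corep m.unit) X)).mpr
    (associatorIso_right_unit δ δ F X).symm

/-- Since the unit object is A(i,-) itself, the comparison isomorphism is an identity, and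
evaluating an identity at the identity of i returns that element. -/
lemma unitElement_eq :
    (λ_ (𝟙_ V)).inv ≫ (eId V m.unit ⊗ₘ component (Iso.refl (ForgetEnrichment.of V
      (corep m.unit : EnrichedFunctor V A V))).hom m.unit) ≫ evalHom _ _ = eId V m.unit := by
  have h : component (Iso.refl (ForgetEnrichment.of V
      (corep m.unit : EnrichedFunctor V A V))).hom m.unit =
        eId V ((corep m.unit : EnrichedFunctor V A V).obj m.unit) :=
    (congrArg (fun t => t ≫ natπ _ _ m.unit)
      (ForgetEnrichment.homTo_id V (ForgetEnrichment.of V (corep m.unit)))).trans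
      (functorCategory_eId_π _ _)
  have h' (v : V) (e : 𝟙_ V ⟶ v) : (λ_ (𝟙_ V)).inv ≫ (e ⊗ₘ eId V v) ≫ evalHom v v = e := by
    have := (uncurry_eq_evalHom (eId V v)).symm.trans (unc_eId v)
    rw [MonoidalCategory.tensorHom_def, Category.assoc, this, rightUnitor_naturality,
      unitors_inv_equal, Iso.inv_hom_id_assoc]
  rw [h]
  exact h' _ _

/-- The monoidal structure is that of Day convolution. -/
def dayConvolution : DayConvolution m δ.monoidalStructure where
  conv := δ
  unitIso := Iso.refl _
  isAssociator := isAssociator_associator δ δ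
  isLeftUnitor := by
    have h := δ.isLeftUnitor_unitor
    rw [← unitElement_eq] at h
    exact h
  isRightUnitor := by
    have h := δ.isRightUnitor_counitor
    rw [← unitElement_eq] at h
    exact h

/-- The action of `[A, V]` on `[A, K]`. -/
def actegory : Actegory δ.monoidalStructure (EnrichedFunctor V A K) where
  act := act
  assoc := associator δ κ
  unitor := κ.unitor
  pentagon F G H X := comp_inv_aux (associatorIso δ κ F G (act.obj ⟨H, X⟩))
    (associatorIso δ κ (tens.obj ⟨F, G⟩) H X)
    (map₂Iso act (Iso.refl (ForgetEnrichment.of V F)) (associatorIso δ κ G H X))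
    (associatorIso δ κ F (tens.obj ⟨G, H⟩) X)
    (map₂Iso act (associatorIso δ δ F G H) (Iso.refl (ForgetEnrichment.of V X)))
    (associatorIso_pentagon δ κ F G H X)
  left_unit F X := associatorIso_left_unit δ κ F X
  right_unit F X := associatorIso_right_unit δ κ F X

end Convolution

end convolution

/-! ### Closed actions and enriched categories -/

section closedAction
open scoped MonoidalLeftAction
open MonoidalLeftAction

/-- Right adjoints to the functors `F ↦ F ⊙ X` of a left action: the action is closed. -/
structure ClosedAction (C : Type u₁) [Category.{u₂} C] [MonoidalCategory C] (D : Type u₃)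
    [Category.{u₄} D] [MonoidalLeftAction C D] where
  hom : D → D → C
  ev (X Y : D) : hom X Y ⊙ₗ X ⟶ Y
  bijective (F : C) (X Y : D) : Function.Bijective fun g : F ⟶ hom X Y => g ⊵ₗ X ≫ ev X Y

namespace ClosedAction
variable {C : Type u₁} [Category.{u₂} C] [MonoidalCategory C] {D : Type u₃}
  [Category.{u₄} D] [MonoidalLeftAction C D] (H : ClosedAction C D)

/-- The bijection between morphisms `F ⟶ ⟨X, Y⟩` and morphisms `F ⊙ X ⟶ Y`. -/
def equiv {F : C} {X Y : D} : (F ⟶ H.hom X Y) ≃ (F ⊙ₗ X ⟶ Y) :=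
  Equiv.ofBijective _ (H.bijective F X Y)

lemma equiv_id (X Y : D) : H.equiv (𝟙 (H.hom X Y)) = H.ev X Y := by
  simp [equiv]

lemma equiv_comp {F G : C} {X Y : D} (a : F ⟶ G) (g : G ⟶ H.hom X Y) :
    H.equiv (a ≫ g) = a ⊵ₗ X ≫ H.equiv g := by
  simp [equiv]

/-- The identity element `I ⟶ ⟨X, X⟩`. -/
def one (X : D) : 𝟙_ C ⟶ H.hom X X := H.equiv.symm (λₗ X).hom

/-- The composition `⟨Y, Z⟩ ⊗ ⟨X, Y⟩ ⟶ ⟨X, Z⟩`. -/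
def mul (X Y Z : D) : H.hom Y Z ⊗ H.hom X Y ⟶ H.hom X Z :=
  H.equiv.symm ((αₗ _ _ X).hom ≫ H.hom Y Z ⊴ₗ H.ev X Y ≫ H.ev Y Z)

lemma equiv_one (X : D) : H.equiv (H.one X) = (λₗ X).hom := Equiv.apply_symm_apply _ _

/-- Composition in ⟨-,-⟩ transposes to successive application: act with f, then with g. Every
enriched axiom below is checked after transposition by means of this formula. -/
lemma equiv_tensor_mul {F G : C} {X Y Z : D} (g : G ⟶ H.hom Y Z) (f : F ⟶ H.hom X Y) :
    H.equiv ((g ⊗ₘ f) ≫ H.mul X Y Z) =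
      (αₗ G F X).hom ≫ G ⊴ₗ H.equiv f ≫ H.equiv g := by
  have h := actionAssocIso_hom_naturality (C := C) g f (𝟙 X)
  have hf : H.equiv f = f ⊵ₗ X ≫ H.ev X Y := by simp [equiv]
  have hg : H.equiv g = g ⊵ₗ Y ≫ H.ev Y Z := by simp [equiv]
  rw [equiv_comp, mul, Equiv.apply_symm_apply, ← actionHom_id, reassoc_of% h, hf, hg,
    actionHom_id, actionHomRight_comp, Category.assoc,
    action_exchange_assoc, actionHom_def'_assoc]

lemma equiv_whiskerLeft_mul {F : C} {X Y Z : D} (f : F ⟶ H.hom X Y) :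
    H.equiv (H.hom Y Z ◁ f ≫ H.mul X Y Z) =
      (αₗ _ F X).hom ≫ H.hom Y Z ⊴ₗ H.equiv f ≫ H.ev Y Z := by
  rw [← id_tensorHom, equiv_tensor_mul, equiv_id]

lemma equiv_whiskerRight_mul {G : C} {X Y Z : D} (g : G ⟶ H.hom Y Z) :
    H.equiv (g ▷ H.hom X Y ≫ H.mul X Y Z) =
      (αₗ G _ X).hom ≫ G ⊴ₗ H.ev X Y ≫ H.equiv g := by
  rw [← tensorHom_id, equiv_tensor_mul, equiv_id]

lemma equiv_mul (X Y Z : D) :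
    H.equiv (H.mul X Y Z) = (αₗ _ _ X).hom ≫ H.hom Y Z ⊴ₗ H.ev X Y ≫ H.ev Y Z :=
  Equiv.apply_symm_apply _ _

/-- After transposition this is the unit axiom for X acted on by F ⊗ I; `one_left` and `mul_assoc`
reduce likewise to the other unit axiom and to the associativity axiom of the action. -/
lemma one_right (X Y : D) :
    (ρ_ (H.hom X Y)).inv ≫ H.hom X Y ◁ H.one X ≫ H.mul X X Y = 𝟙 _ := by
  apply H.equiv.injective
  rw [equiv_comp, equiv_whiskerLeft_mul, equiv_one, equiv_id]
  have h := rightUnitor_actionHom (H.hom X Y) X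
  rw [← reassoc_of% h, ← comp_actionHomLeft_assoc, Iso.inv_hom_id, id_actionHomLeft,
    Category.id_comp]

lemma one_left (X Y : D) :
    (λ_ (H.hom X Y)).inv ≫ H.one Y ▷ H.hom X Y ≫ H.mul X Y Y = 𝟙 _ := by
  apply H.equiv.injective
  rw [equiv_comp, equiv_whiskerRight_mul, equiv_one, equiv_id, ← actionUnitIso_hom_naturality]
  have h := leftUnitor_actionHom (H.hom X Y) X
  rw [← reassoc_of% h, ← comp_actionHomLeft_assoc, Iso.inv_hom_id, id_actionHomLeft,
    Category.id_comp]

lemma mul_assoc (W X Y Z : D) :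
    (α_ _ _ _).hom ≫ H.hom Y Z ◁ H.mul W X Y ≫ H.mul W Y Z =
      H.mul X Y Z ▷ H.hom W X ≫ H.mul W X Z := by
  apply H.equiv.injective
  rw [equiv_comp, equiv_whiskerLeft_mul, equiv_whiskerRight_mul, equiv_mul, equiv_mul]
  have h := associator_actionHom (H.hom Y Z) (H.hom X Y) (H.hom W X) W
  simp only [actionHomRight_comp, Category.assoc, tensor_actionHomRight, Iso.inv_hom_id_assoc]
  rw [reassoc_of% h]

/-- The enriched category structure of a closed action, with hom-objects `⟨X, Y⟩`. -/
abbrev enrichedOrdinaryCategory : EnrichedOrdinaryCategory Cᴹᵒᵖ D where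
  -- An action naturally composes ⟨Y,Z⟩ ⊗ ⟨X,Y⟩ ⟶ ⟨X,Z⟩, while enriched categories here compose in
  -- the order Hom X Y ⊗ Hom Y Z. No braiding on C is assumed, so the base is its monoidal opposite.
  Hom X Y := MonoidalOpposite.mop (H.hom X Y)
  id X := (H.one X).mop
  comp X Y Z := (H.mul X Y Z).mop
  -- The reversed tensor product exchanges the two identity laws.
  id_comp X Y := Quiver.Hom.unmop_inj (H.one_right X Y)
  comp_id X Y := Quiver.Hom.unmop_inj (H.one_left X Y)
  assoc W X Y Z := Quiver.Hom.unmop_inj (H.mul_assoc W X Y Z)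
  homEquiv {X Y} :=
    { toFun f := (H.equiv.symm ((λₗ X).hom ≫ f)).mop
      invFun g := (λₗ X).inv ≫ H.equiv g.unmop
      left_inv f := by simp
      right_inv g := by simp }
  homEquiv_id X := by
    refine Quiver.Hom.unmop_inj (congrArg H.equiv.symm ?_)
    exact Category.comp_id _
  homEquiv_comp {X Y Z} f g := by
    refine Quiver.Hom.unmop_inj (H.equiv.injective ?_)
    refine (Equiv.apply_symm_apply _ _).trans ?_
    refine Eq.trans ?_ (congrArg H.equiv (show (ρ_ (𝟙_ C)).inv ≫
      (H.equiv.symm ((λₗ Y).hom ≫ g) ⊗ₘ H.equiv.symm ((λₗ X).hom ≫ f)) ≫ H.mul X Y Z = _ from rfl))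
    rw [equiv_comp, equiv_tensor_mul, Equiv.apply_symm_apply, Equiv.apply_symm_apply,
      ← actionUnitIso_hom_naturality_assoc]
    have h := leftUnitor_actionHom (𝟙_ C) X
    rw [Category.assoc, ← reassoc_of% h, ← comp_actionHomLeft_assoc, ← unitors_inv_equal,
      Iso.inv_hom_id, id_actionHomLeft, Category.id_comp]

/-- In the enriched category of a closed action, `F ⊙ X` is the copower of `X` by `F`. -/
lemma isCopower (F : C) (X : D) :
    letI := H.enrichedOrdinaryCategory
    IsCopower (MonoidalOpposite.mop F) X (F ⊙ₗ X)
      (Quiver.Hom.mop (H.equiv.symm (𝟙 (F ⊙ₗ X)))) := by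
  intro Y G
  -- Composition with the copower unit transposes to precomposition with the associativity
  -- isomorphism of the action, hence is bijective.
  have h (g : G.unmop ⟶ H.hom (F ⊙ₗ X) Y) :
      H.equiv ((g ⊗ₘ H.equiv.symm (𝟙 (F ⊙ₗ X))) ≫ H.mul X (F ⊙ₗ X) Y) =
        (αₗ G.unmop F X).hom ≫ H.equiv g := by
    rw [equiv_tensor_mul, Equiv.apply_symm_apply, actionHomRight_id, Category.id_comp]
  constructor
  · intro g g' e
    refine Quiver.Hom.unmop_inj (H.equiv.injective ?_)
    have e' := congrArg (fun t => H.equiv (Quiver.Hom.unmop t)) e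
    exact (cancel_epi (αₗ G.unmop F X).hom).mp ((h _).symm.trans (e'.trans (h _)))
  · intro f
    refine ⟨Quiver.Hom.mop (H.equiv.symm ((αₗ G.unmop F X).inv ≫ H.equiv (Quiver.Hom.unmop f))),
      Quiver.Hom.unmop_inj (H.equiv.injective ?_)⟩
    refine (h _).trans ((congrArg (fun t => (αₗ G.unmop F X).hom ≫ t)
      (Equiv.apply_symm_apply _ _)).trans ?_)
    rw [Iso.hom_inv_id_assoc]

end ClosedAction

end closedAction

/-! ### From an enriched actegory to an action of underlying categories -/

section adjunction
variable [BraidedCategory V] {C : Type u₁} [EnrichedCategory V C] {D : Type u₂}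
  [EnrichedCategory V D]

lemma Adjunction.bijective {L : EnrichedFunctor V C D} {R : EnrichedFunctor V D C}
    (adj : Adjunction L R) (c : C) (d : D) :
    Function.Bijective fun g : ForgetEnrichment.of V c ⟶ ForgetEnrichment.of V (R.obj d) =>
      L.forget.map g ≫ adj.counit d := by
  refine Function.bijective_iff_has_inverse.mpr
    ⟨fun f => adj.unit c ≫ R.forget.map f, fun g => ?_, fun f => ?_⟩
  · have h := adj.unit_natural.forget g
    refine (congrArg (fun t => adj.unit c ≫ t) (R.forget.map_comp _ _)).trans ?_
    refine (Category.assoc _ _ _).symm.trans ((congrArg (fun t => t ≫ _)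
      ((congrArg (fun t => adj.unit c ≫ t) (forget_comp_map L R g)).symm.trans
        (h.symm.trans (congrArg (fun t => t ≫ _) (forget_id_map g))))).trans ?_)
    exact (Category.assoc _ _ _).trans ((congrArg (fun t => g ≫ t) (adj.right_triangle d)).trans
      (Category.comp_id g))
  · have h := adj.counit_natural.forget f
    refine (congrArg (fun t => t ≫ adj.counit d) (L.forget.map_comp _ _)).trans ?_
    refine (Category.assoc _ _ _).trans ((congrArg (fun t => _ ≫ t)
      ((congrArg (fun t => t ≫ adj.counit d) (forget_comp_map R L f)).symm.trans
        (h.trans (congrArg (fun t => _ ≫ t) (forget_id_map f))))).trans ?_)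
    exact (Category.assoc _ _ _).symm.trans ((congrArg (fun t => t ≫ f)
      (adj.left_triangle c)).trans (Category.id_comp f))

end adjunction

lemma inv_inv_comp_aux {C : Type u₁} [Category.{u₂} C] {P Q R S T : C} (p : P ≅ Q) (q : R ≅ P)
    (e : R ⟶ S) (i : T ≅ Q) (r : S ≅ T) (h : p.inv ≫ q.inv ≫ e = i.inv ≫ r.inv) :
    e ≫ r.hom ≫ i.hom = q.hom ≫ p.hom := by
  rw [Iso.inv_comp_eq, Iso.inv_comp_eq] at h
  simp [h]

section actegory
open scoped MonoidalLeftAction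
variable [BraidedCategory V] {M : Type u₁} [EnrichedCategory V M] {S : MonoidalStructure V M}
  {L : Type u₂} [EnrichedCategory V L] (T : Actegory S L)

namespace Actegory

lemma assoc_naturality {X X' Y Y' : M} {Z Z' : L}
    (f : ForgetEnrichment.of V X ⟶ ForgetEnrichment.of V X')
    (g : ForgetEnrichment.of V Y ⟶ ForgetEnrichment.of V Y')
    (h : ForgetEnrichment.of V Z ⟶ ForgetEnrichment.of V Z') :
    map₂ T.act f (map₂ T.act g h) ≫ (T.assoc.iso ⟨⟨X', Y'⟩, Z'⟩).hom =
      (T.assoc.iso ⟨⟨X, Y⟩, Z⟩).hom ≫ map₂ T.act (map₂ S.tensor f g) h := by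
  have key := T.assoc.natural.forget (pairHom (pairHom f g) h)
  have h₁ : ((prodFunctor S.tensor (EnrichedFunctor.id V L)).comp V T.act).forget.map
      (pairHom (pairHom f g) h) = map₂ T.act (map₂ S.tensor f g) h := by
    refine (forget_comp_map (prodFunctor S.tensor (EnrichedFunctor.id V L)) T.act _).trans
      (congrArg T.act.forget.map ?_)
    exact (prodFunctor_map_pairHom _ _ _ _).trans (congrArg (pairHom _) (forget_id_map h))
  have h₂ : ((assocFunctor M M L).comp V
      ((prodFunctor (EnrichedFunctor.id V M) T.act).comp V T.act)).forget.map
      (pairHom (pairHom f g) h) = map₂ T.act f (map₂ T.act g h) := by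
    refine (forget_comp_map (assocFunctor M M L) _ _).trans ?_
    refine (congrArg _ (assocFunctor_map_pairHom f g h)).trans ?_
    refine (forget_comp_map (prodFunctor (EnrichedFunctor.id V M) T.act) T.act _).trans
      (congrArg T.act.forget.map ?_)
    exact (prodFunctor_map_pairHom _ _ _ _).trans
      (congrArg (fun t => pairHom t _) (forget_id_map f))
  exact (congrArg (fun t => t ≫ (T.assoc.iso ⟨⟨X', Y'⟩, Z'⟩).hom) h₂).symm.trans
    (key.trans (congrArg (fun t => (T.assoc.iso ⟨⟨X, Y⟩, Z⟩).hom ≫ t) h₁))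

lemma unitor_naturality {X Y : L} (f : ForgetEnrichment.of V X ⟶ ForgetEnrichment.of V Y) :
    map₂ T.act (𝟙 (ForgetEnrichment.of V S.unit)) f ≫ (T.unitor.iso Y).hom =
      (T.unitor.iso X).hom ≫ f :=
  (congrArg (fun t => t ≫ (T.unitor.iso Y).hom) (fixLeft_forget_map _ _ f)).symm.trans
    ((T.unitor.natural.forget f).trans
      (congrArg (fun t => (T.unitor.iso X).hom ≫ t) (forget_id_map f)))

/-- The isomorphism `(X ⊗ Y) * K ≅ X * (Y * K)`. -/
def assocIso (X Y : M) (Z : L) : ForgetEnrichment.of V (T.act.obj ⟨S.tensor.obj ⟨X, Y⟩, Z⟩) ≅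
    ForgetEnrichment.of V (T.act.obj ⟨X, T.act.obj ⟨Y, Z⟩⟩) :=
  (T.assoc.iso ⟨⟨X, Y⟩, Z⟩).symm

lemma assocIso_naturality {X X' Y Y' : M} {Z Z' : L}
    (f : ForgetEnrichment.of V X ⟶ ForgetEnrichment.of V X')
    (g : ForgetEnrichment.of V Y ⟶ ForgetEnrichment.of V Y')
    (h : ForgetEnrichment.of V Z ⟶ ForgetEnrichment.of V Z') :
    map₂ T.act (map₂ S.tensor f g) h ≫ (T.assocIso X' Y' Z').hom =
      (T.assocIso X Y Z).hom ≫ map₂ T.act f (map₂ T.act g h) := by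
  rw [← Iso.eq_comp_inv, Category.assoc, ← Iso.inv_comp_eq]
  exact (T.assoc_naturality f g h).symm

lemma map₂_comp_id {X X' : M} {Y Y' : L} (f : ForgetEnrichment.of V X ⟶ ForgetEnrichment.of V X')
    (g : ForgetEnrichment.of V Y ⟶ ForgetEnrichment.of V Y') :
    map₂ T.act f g = map₂ T.act f (𝟙 _) ≫ map₂ T.act (𝟙 _) g := by
  rw [← map₂_comp, Category.comp_id, Category.id_comp]

lemma assocIso_whisker {X X' Y Y' : M} (Z : L)
    (f : ForgetEnrichment.of V X ⟶ ForgetEnrichment.of V X')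
    (g : ForgetEnrichment.of V Y ⟶ ForgetEnrichment.of V Y') :
    map₂ T.act (map₂ S.tensor f g) (𝟙 (ForgetEnrichment.of V Z)) =
      (T.assocIso X Y Z).hom ≫ map₂ T.act f (map₂ T.act g (𝟙 (ForgetEnrichment.of V Z))) ≫
        (T.assocIso X' Y' Z).inv := by
  rw [← Category.assoc, Iso.eq_comp_inv]
  exact T.assocIso_naturality f g _

/-- The action pentagon with the isomorphisms X * (Y * K) ≅ (X ⊗ Y) * K inverted, which is the
orientation used by `MonoidalLeftAction`. -/
lemma pentagon_assocIso (X Y Z : M) (K : L) :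
    map₂ T.act (S.assoc.iso ⟨⟨X, Y⟩, Z⟩).hom (𝟙 (ForgetEnrichment.of V K)) ≫
        (T.assocIso X (S.tensor.obj ⟨Y, Z⟩) K).hom ≫
          map₂ T.act (𝟙 (ForgetEnrichment.of V X)) (T.assocIso Y Z K).hom =
      (T.assocIso (S.tensor.obj ⟨X, Y⟩) Z K).hom ≫ (T.assocIso X Y (T.act.obj ⟨Z, K⟩)).hom :=
  inv_inv_comp_aux (T.assocIso X Y (T.act.obj ⟨Z, K⟩)) (T.assocIso (S.tensor.obj ⟨X, Y⟩) Z K) _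
    (map₂Iso T.act (Iso.refl (ForgetEnrichment.of V X)) (T.assocIso Y Z K))
    (T.assocIso X (S.tensor.obj ⟨Y, Z⟩) K) (T.pentagon X Y Z K)

/-- The action of underlying categories given by an actegory. -/
abbrev monoidalLeftAction : MonoidalLeftAction S.Underlying (ForgetEnrichment V L) where
  actionObj X Y := ForgetEnrichment.of V (T.act.obj ⟨X, ForgetEnrichment.to V Y⟩)
  actionHomLeft {X X'} f Y := map₂ (X := X) (X' := X') T.act f (𝟙 Y)
  actionHomRight X _ _ g := map₂ T.act (𝟙 (ForgetEnrichment.of V (C := M) X)) g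
  actionHom {X X' _ _} f g := map₂ (X := X) (X' := X') T.act f g
  actionAssocIso X Y Z := T.assocIso X Y (ForgetEnrichment.to V Z)
  actionUnitIso Z := T.unitor.iso (ForgetEnrichment.to V Z)
  actionHom_def _ _ := T.map₂_comp_id _ _
  actionHomRight_id _ _ := map₂_id _ _ _
  id_actionHomLeft _ _ := map₂_id _ _ _
  actionHom_comp _ _ _ _ := map₂_comp _ _ _ _ _
  actionAssocIso_hom_naturality f g h := T.assocIso_naturality f g h
  actionUnitIso_hom_naturality f := (T.unitor_naturality f).symm
  whiskerLeft_actionHomLeft _ _ _ f _ := T.assocIso_whisker _ _ f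
  whiskerRight_actionHomLeft _ f _ := (T.assocIso_whisker _ f _).trans
    (congrArg (fun t => _ ≫ map₂ T.act f t ≫ _) (map₂_id T.act _ _))
  associator_actionHom X Y Z W := T.pentagon_assocIso X Y Z W
  leftUnitor_actionHom X Y := (Iso.inv_comp_eq (T.assocIso _ _ _)).mp (T.left_unit X Y)
  rightUnitor_actionHom X Y := (Iso.inv_comp_eq (T.assocIso _ _ _)).mp (T.right_unit X Y)

end Actegory

end actegory

/-! ### Closedness of the action and the main theorem -/

section convolution
variable [SymmetricCategory V] [MonoidalClosed V] [HasLimits V]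
variable {A : Type w} [EnrichedCategory V A] {m : MonoidalStructure V A}
variable {K : Type u₁} [EnrichedCategory V K] {P : Copowers V K}

namespace Convolution
variable {act : EnrichedFunctor V (TensorObj (EnrichedFunctor V A V) (EnrichedFunctor V A K))
    (EnrichedFunctor V A K)}
  {tens : EnrichedFunctor V (TensorObj (EnrichedFunctor V A V) (EnrichedFunctor V A V))
    (EnrichedFunctor V A V)}
  (δ : Convolution m (selfCopowers V) tens) (κ : Convolution m P act)

lemma bijective_adjCounit (F : EnrichedFunctor V A V) (X Y : EnrichedFunctor V A K) :
    Function.Bijective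
      fun g : ForgetEnrichment.of V F ⟶ ForgetEnrichment.of V (angle m X Y) =>
        map₂ act g (𝟙 (ForgetEnrichment.of V X)) ≫
          ForgetEnrichment.homOf V (κ.adjCounit X Y) := by
  have h := (κ.adjunction X).bijective F Y
  refine (congrArg Function.Bijective (funext fun g => ?_)).mp h
  exact congrArg (fun t => t ≫ ForgetEnrichment.homOf V (κ.adjCounit X Y))
    (fixRight_forget_map act X g)

/-- The action of the category `[A, V]₀` on `[A, K]₀` is closed. -/
def closedAction :
    letI := (actegory δ κ).monoidalLeftAction
    ClosedAction δ.monoidalStructure.Underlying (ForgetEnrichment V (EnrichedFunctor V A K)) :=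
  letI := (actegory δ κ).monoidalLeftAction
  { hom X Y := δ.monoidalStructure.of (angle m (ForgetEnrichment.to V X) (ForgetEnrichment.to V Y))
    ev X Y := ForgetEnrichment.homOf V (κ.adjCounit (ForgetEnrichment.to V X)
      (ForgetEnrichment.to V Y))
    bijective F X Y := κ.bijective_adjCounit F (ForgetEnrichment.to V X)
      (ForgetEnrichment.to V Y) }

end Convolution

end convolution

end VCat

end

theorem mainTheorem2 {V : Type v} [Category.{w} V] [MonoidalCategory V] [SymmetricCategory V]
    [MonoidalClosed V] [HasLimits V] [HasColimits V]
    {A : Type w} [EnrichedCategory V A] (m : VCat.MonoidalStructure V A)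
    {K : Type u} [EnrichedCategory V K] (P : VCat.Copowers V K)
    (hK : ∀ (F : EnrichedFunctor V A V) (X : EnrichedFunctor V A K) (x : A),
      VCat.HasCoend (VCat.integrand m P F X x)) :
    ∃ (S : VCat.MonoidalStructure V (EnrichedFunctor V A V)) (day : VCat.DayConvolution m S)
      (L : VCat.Actegory S (EnrichedFunctor V A K)) (κ : VCat.Convolution m P L.act),
      -- the associativity and unit isomorphisms of the action are the canonical ones
      day.conv.IsAssociator κ (fun F G X => L.assoc.iso ⟨⟨F, G⟩, X⟩) ∧
      κ.IsLeftUnitor day.unitElement L.unitor.iso ∧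
      -- `- * X` has a right adjoint `⟨X, -⟩`
      (∀ X : EnrichedFunctor V A K,
        ∃ R : EnrichedFunctor V (EnrichedFunctor V A K) (EnrichedFunctor V A V),
          (∀ Y, R.obj Y = VCat.angle m X Y) ∧
            Nonempty (VCat.Adjunction (VCat.fixRight L.act X) R)) ∧
      -- the category `[A, K]₀` is a copowered `[A, V]`-category
      ∃ _ : EnrichedOrdinaryCategory S.Underlyingᴹᵒᵖ (ForgetEnrichment V (EnrichedFunctor V A K)),
        (∀ X Y : EnrichedFunctor V A K,
          (ForgetEnrichment.of V X ⟶[S.Underlyingᴹᵒᵖ] ForgetEnrichment.of V Y) =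
            MonoidalOpposite.mop (S.of (VCat.angle m X Y))) ∧
        ∀ (F : EnrichedFunctor V A V) (X : EnrichedFunctor V A K),
          ∃ η : MonoidalOpposite.mop (S.of F) ⟶
              (ForgetEnrichment.of V X ⟶[S.Underlyingᴹᵒᵖ] ForgetEnrichment.of V (L.act.obj ⟨F, X⟩)),
            VCat.IsCopower (MonoidalOpposite.mop (S.of F)) (ForgetEnrichment.of V X)
              (ForgetEnrichment.of V (L.act.obj ⟨F, X⟩)) η := by
  -- The coends for K = V exist because A is small and V is cocomplete; the hypothesis `hK` enters
  -- only through the convolution with values in K.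
  let δ := VCat.convolution m (VCat.selfCopowers V) fun F G x =>
    VCat.hasCoend_self (VCat.integrand m (VCat.selfCopowers V) F G x)
  let κ := VCat.convolution m P hK
  refine ⟨δ.monoidalStructure, δ.dayConvolution, VCat.Convolution.actegory δ κ, κ,
    VCat.Convolution.isAssociator_associator δ κ, ?_,
    fun X => ⟨VCat.angleFunctor m X, fun _ => rfl, ⟨κ.adjunction X⟩⟩, ?_⟩
  -- The unit isomorphism is normalized with respect to the identity of i, which is rewritten as the
  -- universal element of the unit.
  · have h := κ.isLeftUnitor_unitor
    rw [← VCat.Convolution.unitElement_eq] at h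
    exact h
  · let := (VCat.Convolution.actegory δ κ).monoidalLeftAction
    -- The right adjoints of the closed action are `angle` by definition, so the hom-objects are as
    -- required by `rfl`.
    exact ⟨(VCat.Convolution.closedAction δ κ).enrichedOrdinaryCategory, fun _ _ => rfl,
      fun F X => ⟨_, (VCat.Convolution.closedAction δ κ).isCopower (δ.monoidalStructure.of F)
        (ForgetEnrichment.of V X)⟩⟩
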